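/- **Theorem A.** Let $\alpha,\eta,\sigma\in\mathbb R$ and let $f:\mathbb R^3\to\mathbb R$ be of class $C^1$ with $f(t+\sigma,x,y)=f(t,x,y)$. For $\varepsilon\in\mathbb R$ consider $$\ddot x+\alpha\,\mathrm{sign}(x)=\eta x+\varepsilon f(t,x,\dot x),\qquad(1_\varepsilon)$$ whose solutions are understood in the sense of Filippov: $(x,\dot x)$ is locally absolutely continuous on $\mathbb R$ and, for almost every $t$, its derivative equals $(\dot x,\eta x-\alpha\,\mathrm{sign}(x)+\varepsilon f(t,x,\dot x))$ if $x\neq0$, and lies on the segment joining the two one-sided values $(\dot x,\eta x\mp\alpha+\varepsilon f(t,x,\dot x))$ if $x=0$. Suppose that one of the following holds: **(C1)** $\eta>0,\ \alpha>0$; **(C4)** $\eta=0,\ \alpha>0$; **(C7)** $\eta<0,\ \alpha>0$; **(C9)** $\eta<0,\ \alpha<0$. Put $\omega=\sqrt{-\eta}$ when $\eta<0$. Let $\tau_0$ be the half-period function of the unperturbed equation $(1_0)$, that is, $$\tau_0(y_0)=\begin{cases}\frac1{\sqrt\eta}\log\frac{\alpha+y_0\sqrt\eta}{\alpha-y_0\sqrt\eta},\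 0<y_0<\frac{\alpha}{\sqrt\eta}&\text{(C1)}\\[2pt] \frac{2y_0}{\alpha},\ y_0>0&\text{(C4)}\\[2pt] \frac2\omega\arctan\frac{\omega y_0}{\alpha},\ y_0>0&\text{(C7)}\\[2pt] \frac2\omega\bigl(\pi+\arctan\frac{\omega y_0}{\alpha}\bigr),\ y_0>0&\text{(C9)}\end{cases}$$ and let $v$ be its inverse: $v(s)=\frac{\alpha}{\sqrt\eta}\tanh\frac{\sqrt\eta s}{2}$ in (C1), $v(s)=\frac{\alpha s}2$ in (C4), $v(s)=\frac\alpha\omega\tan\frac{\omega s}{2}$ in (C7) and (C9). Assume that $\sigma/2$ lies in the image of $\tau_0$. Let $\Gamma(t,y_0)$ be the solution of $\dot x=y,\ \dot y=\eta x-\alpha$ with $\Gamma(0,y_0)=(0,y_0)$, let $R(x,y)=(-x,y)$, let $$U(t,s)=\begin{cases}-\frac{\alpha}{\sqrt\eta}\,\mathrm{sech}\bigl(\frac{\sqrt\eta s}{2}\bigr)\sinh\bigl(\frac{\sqrt\eta(2t-s)}{2}\bigr)&\eta>0\\[2pt]-\frac{\alpha(2t-s)}2&\eta=0\\[2pt]-\frac\alpha\omega\sec\bigl(\frac{\omega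 s}{2}\bigr)\sin\bigl(\frac{\omega(2t-s)}{2}\bigr)&\eta<0\end{cases}$$ and $$M(\phi)=\int_0^{\sigma/2}U\bigl(t,\tfrac\sigma2\bigr)\Bigl(f\bigl(\phi+t,\Gamma(t,v(\tfrac\sigma2))\bigr)+f\bigl(\phi-t,R\,\Gamma(t,v(\tfrac\sigma2))\bigr)\Bigr)\,dt .$$ Let $\phi^*$ satisfy $M(\phi^*)=0$ and $M'(\phi^*)\ne0$. Then there are $\bar\varepsilon>0$ and a family $x_\varepsilon$, $\varepsilon\in(-\bar\varepsilon,\bar\varepsilon)$, such that: 1. $x_\varepsilon(t)$ is of class $C^1$ in $(\varepsilon,t)$, each $x_\varepsilon$ is a $\sigma$-periodic solution of $(1_\varepsilon)$, and $(x_0(\phi^*),\dot x_0(\phi^*))=(0,v(\sigma/2))$. Moreover there are $C^1$ functions $\varepsilon\mapsto\bar\phi(\varepsilon)$ and $\varepsilon\mapsto\bar y(\varepsilon)>0$ with $\bar\phi(0)=\phi^*$ and $(x_\varepsilon,\dot x_\varepsilon)(\bar\phi(\varepsilon))=(0,\bar y(\varepsilon))$. 2. For $\varepsilon\neq0$, $x_\varepsilon$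 is isolated: there is $\delta>0$ such that every $\sigma$-periodic solution $z$ of $(1_\varepsilon)$ with $|z-x_\varepsilon|<\delta$ and $|\dot z-\dot x_\varepsilon|<\delta$ at all times equals $x_\varepsilon$. For $\varepsilon=0$ the orbit of $x_0$ is isolated: there is $\delta>0$ such that every $\sigma$-periodic solution of $(1_0)$ that is $\delta$-close to $x_0$ in the same sense is a translate of $x_0$ in time. 3. The branch is unique: if $0<\varepsilon_1\le\bar\varepsilon$ and $z_\varepsilon$, $\varepsilon\in(-\varepsilon_1,\varepsilon_1)$, is a family of $\sigma$-periodic solutions of $(1_\varepsilon)$, of class $C^1$ in $(\varepsilon,t)$, with $(z_0(\phi^*),\dot z_0(\phi^*))=(0,v(\sigma/2))$, then $z_\varepsilon=x_\varepsilon$ for all $\varepsilon\in(-\varepsilon_1,\varepsilon_1)$. -/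

import Mathlib

noncomputable section

namespace DiscontinuousOscillator

open Set

/-! ### Filippov solutions of `x'' + α sign(x) = η x + ε f(t, x, x')` -/

/-- The smooth vector field `(x, y) ↦ (y, η x - a + ε f(t, x, y))`. It is the right-hand side of
the first order system on `x > 0` when `a = α`, and on `x < 0` when `a = -α`. -/
def smoothField (a η ε : ℝ) (f : ℝ × ℝ × ℝ → ℝ) (t : ℝ) (p : ℝ × ℝ) : ℝ × ℝ :=
  (p.2, η * p.1 - a + ε * f (t, p.1, p.2))

/-- Filippov's set-valued right-hand side of the system
`x' = y, y' = η x - α sign(x) + ε f(t, x, y)`: off the line `x = 0` it is the value of the field,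
and on that line it is the convex hull of the two one-sided limits. -/
def filippovSet (α η ε : ℝ) (f : ℝ × ℝ × ℝ → ℝ) (t : ℝ) (p : ℝ × ℝ) : Set (ℝ × ℝ) :=
  if 0 < p.1 then {smoothField α η ε f t p}
  else if p.1 < 0 then {smoothField (-α) η ε f t p}
  else segment ℝ (smoothField (-α) η ε f t p) (smoothField α η ε f t p)

/-- A Filippov solution, on the whole time line, of the first order system: a locally absolutely
continuous curve whose velocity lies in the Filippov set at almost every time. -/
structure IsFilippovSolution (α η ε : ℝ) (f : ℝ × ℝ × ℝ → ℝ) (z : ℝ → ℝ × ℝ) : Prop where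
  absolutelyContinuous : ∀ a b : ℝ, AbsolutelyContinuousOnInterval z a b
  velocity_mem : ∀ᵐ t : ℝ, ∃ w ∈ filippovSet α η ε f t (z t), HasDerivAt z w t

/-- `x` is a solution of `x'' + α sign(x) = η x + ε f(t, x, x')`: the curve `(x, x')` is a Filippov
solution of the first order system. -/
def IsSolution (α η ε : ℝ) (f : ℝ × ℝ × ℝ → ℝ) (x : ℝ → ℝ) : Prop :=
  IsFilippovSolution α η ε f (fun t => (x t, deriv x t))

/-- `x` is a `σ`-periodic solution of `x'' + α sign(x) = η x + ε f(t, x, x')`. -/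
def IsPeriodicSolution (α η ε σ : ℝ) (f : ℝ × ℝ × ℝ → ℝ) (x : ℝ → ℝ) : Prop :=
  IsSolution α η ε f x ∧ Function.Periodic x σ

/-- `z` stays, in the phase plane, within distance `δ` of `x` at all times. -/
def PhaseClose (δ : ℝ) (z x : ℝ → ℝ) : Prop :=
  ∀ t : ℝ, |z t - x t| < δ ∧ |deriv z t - deriv x t| < δ

/-- A `σ`-periodic solution `x` is isolated: no other `σ`-periodic solution is close to it. -/
def IsIsolatedPeriodic (α η ε σ : ℝ) (f : ℝ × ℝ × ℝ → ℝ) (x : ℝ → ℝ) : Prop :=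
  ∃ δ > 0, ∀ z : ℝ → ℝ, IsPeriodicSolution α η ε σ f z → PhaseClose δ z x → z = x

/-- Isolation of the orbit of a `σ`-periodic solution `x`: every `σ`-periodic solution close to
`x` is a translate of `x` in time. This is the meaningful notion for an autonomous equation. -/
def IsOrbitallyIsolatedPeriodic (α η ε σ : ℝ) (f : ℝ × ℝ × ℝ → ℝ) (x : ℝ → ℝ) : Prop :=
  ∃ δ > 0, ∀ z : ℝ → ℝ, IsPeriodicSolution α η ε σ f z → PhaseClose δ z x →
    ∃ s : ℝ, ∀ t : ℝ, z t = x (t + s)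

/-! ### The unperturbed equation -/

/-- The cases of the unperturbed equation with a period annulus about the origin and `α ≠ 0`. -/
def PeriodAnnulusCase (α η : ℝ) : Prop :=
  (0 < η ∧ 0 < α) ∨ (η = 0 ∧ 0 < α) ∨ (η < 0 ∧ 0 < α) ∨ (η < 0 ∧ α < 0)

/-- The solution of `x' = y, y' = η x - α` which starts at `(0, y₀)`. -/
def Gam (α η t y₀ : ℝ) : ℝ × ℝ :=
  if 0 < η then
    ((α * (1 - Real.cosh (√η * t)) + √η * y₀ * Real.sinh (√η * t)) / η,
      y₀ * Real.cosh (√η * t) - α * Real.sinh (√η * t) / √η)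
  else if η = 0 then
    (t * y₀ - α * t ^ 2 / 2, y₀ - α * t)
  else
    ((α * (Real.cos (√(-η) * t) - 1) + √(-η) * y₀ * Real.sin (√(-η) * t)) / √(-η) ^ 2,
      y₀ * Real.cos (√(-η) * t) - α * Real.sin (√(-η) * t) / √(-η))

/-- The reflection `(x, y) ↦ (-x, y)`. -/
def reflect (p : ℝ × ℝ) : ℝ × ℝ := (-p.1, p.2)

/-- The domain of the half-period function. -/
def halfPeriodDomain (α η : ℝ) : Set ℝ :=
  if 0 < η then Ioo 0 (α / √η) else Ioi 0

/-- The half-period function `τ₀`. -/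
def halfPeriod (α η y₀ : ℝ) : ℝ :=
  if 0 < η then 1 / √η * Real.log ((α + y₀ * √η) / (α - y₀ * √η))
  else if η = 0 then 2 * y₀ / α
  else if 0 < α then 2 / √(-η) * Real.arctan (√(-η) * y₀ / α)
  else 2 / √(-η) * (Real.pi + Real.arctan (√(-η) * y₀ / α))

/-- The inverse `v` of the half-period function. -/
def halfPeriodInv (α η s : ℝ) : ℝ :=
  if 0 < η then α / √η * Real.tanh (√η * s / 2)
  else if η = 0 then α * s / 2
  else α / √(-η) * Real.tan (√(-η) * s / 2)

/-! ### The Melnikov-like function -/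

/-- The weight `U(t, s)`. -/
def weight (α η t s : ℝ) : ℝ :=
  if 0 < η then
    -(α / √η) * (1 / Real.cosh (√η * s / 2)) * Real.sinh (√η * (2 * t - s) / 2)
  else if η = 0 then -(α * (2 * t - s) / 2)
  else -(α / √(-η)) * (1 / Real.cos (√(-η) * s / 2)) * Real.sin (√(-η) * (2 * t - s) / 2)

/-- The Melnikov-like function `M`. -/
def melnikov (α η σ : ℝ) (f : ℝ × ℝ × ℝ → ℝ) (φ : ℝ) : ℝ :=
  ∫ t in (0 : ℝ)..(σ / 2), weight α η t (σ / 2) *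
    (f (φ + t, Gam α η t (halfPeriodInv α η (σ / 2))) +
      f (φ - t, reflect (Gam α η t (halfPeriodInv α η (σ / 2)))))

/-! ### Branches of periodic solutions -/

/-- `X ε = x_ε`, for `|ε| < ε₀`, is a smooth branch of `σ`-periodic solutions through the
unperturbed solution with `(x_0(φ), x_0'(φ)) = (0, v(σ/2))`. Smooth means that `x_ε(t)` is of
class `C¹` in `(ε, t)`. -/
structure IsSmoothBranch (α η σ : ℝ) (f : ℝ × ℝ × ℝ → ℝ) (φ ε₀ : ℝ) (X : ℝ → ℝ → ℝ) : Prop where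
  smooth : ContDiffOn ℝ 1 (fun p : ℝ × ℝ => X p.1 p.2) (Ioo (-ε₀) ε₀ ×ˢ univ)
  periodicSolution : ∀ ε ∈ Ioo (-ε₀) ε₀, IsPeriodicSolution α η ε σ f (X ε)
  initial : X 0 φ = 0 ∧ deriv (X 0) φ = halfPeriodInv α η (σ / 2)

end DiscontinuousOscillator

end

/-! The unperturbed equation has a family of orbits crossing `x = 0` twice per period, and `v(σ/2)`
selects the one of period `σ`. Its phase is free, and `M` decides which phase survives. A nearby
periodic solution is encoded by `(ε, t₁, h, y)`: it crosses upwards at `t₁` with velocity `y`, and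
downwards at `t₁ + h`. From the upward crossing the smooth equation of `x > 0` is followed forwards
for time `h`, and that of `x < 0` backwards for time `σ - h`. Periodicity asks that both pieces end
on `x = 0` with equal velocities. No return map has to be composed.

At `ε = 0` equality of the end velocities follows from the two position equations, so the system is
degenerate and the velocity equation must be divided by `ε`. Since `f` is only `C¹`, a naive
division would lose a derivative. Variation of constants avoids this. Let `A`, `B` be the integrals
of `cs * f` and `sn * f` along a solution. The perturbation then enters position and velocity as `ε`
times an explicit expression in `A`, `B`, and these are `C¹` in all parameters
(`nonempty_localFlow`). By `LocalFlow.half_identity`, a solution back on `x = 0` after time `t` has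
`sn (t / 2) * (Y + y) = ε * P`. Subtracting the two sides gives an exact factor `ε`, and the
quotient is the third component of `bifurcation`.

At `ε = 0`, `h = σ/2`, `y = v` this quotient is a nonzero multiple of `M(t₁)`
(`bifurcation_melnikov`), by the symmetry between the two half orbits. The time equations determine
`h` and `y`, and `M' ≠ 0` takes care of the phase, so the implicit function theorem yields a unique
`C¹` branch (`exists_branch`). Pasting the half orbits gives Filippov solutions that are `C¹` in
`(ε, t)` (`contDiffOn_paste`, `HalfOrbits.isPeriodicSolution`).

Conversely, a periodic solution `C¹`-close to the unperturbed one has the same sign pattern and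
follows the smooth flows, so its data are a zero of `bifurcation` when `ε ≠ 0`
(`exists_eq_orbit_of_phaseClose`). This gives isolation. At `ε = 0` only the phase stays free, which
gives orbital isolation. Uniqueness of the branch is a connectedness argument in `ε`
(`IsSmoothBranch.eq_of_unique`). -/

noncomputable section

namespace DiscontinuousOscillator

open Set Topology MeasureTheory

/-! ### The fundamental solutions of `x'' = η x` -/

/-- The solution of `x'' = η x` with `x 0 = 0` and `x' 0 = 1`. -/
def sn (η t : ℝ) : ℝ :=
  if 0 < η then Real.sinh (√η * t) / √η
  else if η = 0 then t
  else Real.sin (√(-η) * t) / √(-η)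

/-- The solution of `x'' = η x` with `x 0 = 1` and `x' 0 = 0`. -/
def cs (η t : ℝ) : ℝ :=
  if 0 < η then Real.cosh (√η * t)
  else if η = 0 then 1
  else Real.cos (√(-η) * t)

lemma sn_of_pos {η : ℝ} (h : 0 < η) (t : ℝ) : sn η t = Real.sinh (√η * t) / √η := by
  simp [sn, h]

lemma cs_of_pos {η : ℝ} (h : 0 < η) (t : ℝ) : cs η t = Real.cosh (√η * t) := by
  simp [cs, h]

lemma sn_zero_left (t : ℝ) : sn 0 t = t := by simp [sn]

lemma cs_zero_left (t : ℝ) : cs 0 t = 1 := by simp [cs]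

lemma sn_of_neg {η : ℝ} (h : η < 0) (t : ℝ) : sn η t = Real.sin (√(-η) * t) / √(-η) := by
  simp [sn, h.le.not_gt, h.ne]

lemma cs_of_neg {η : ℝ} (h : η < 0) (t : ℝ) : cs η t = Real.cos (√(-η) * t) := by
  simp [cs, h.le.not_gt, h.ne]

@[simp] lemma sn_zero (η : ℝ) : sn η 0 = 0 := by simp [sn]

@[simp] lemma cs_zero (η : ℝ) : cs η 0 = 1 := by simp [cs]

lemma sn_neg (η t : ℝ) : sn η (-t) = -sn η t := by
  unfold sn; split_ifs <;> simp [neg_div]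

lemma cs_neg (η t : ℝ) : cs η (-t) = cs η t := by
  unfold cs; split_ifs <;> simp

lemma hasDerivAt_sn (η t : ℝ) : HasDerivAt (sn η) (cs η t) t := by
  rcases lt_trichotomy 0 η with h | rfl | h
  · have h0 : √η ≠ 0 := (Real.sqrt_pos.2 h).ne'
    rw [funext (sn_of_pos h), cs_of_pos h]
    have := (((hasDerivAt_id t).const_mul √η).sinh).div_const √η
    simpa [h0] using this
  · rw [funext sn_zero_left, cs_zero_left]; exact hasDerivAt_id t
  · have h0 : √(-η) ≠ 0 := (Real.sqrt_pos.2 (neg_pos.2 h)).ne'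
    rw [funext (sn_of_neg h), cs_of_neg h]
    have := (((hasDerivAt_id t).const_mul √(-η)).sin).div_const √(-η)
    simpa [h0] using this

lemma hasDerivAt_cs (η t : ℝ) : HasDerivAt (cs η) (η * sn η t) t := by
  rcases lt_trichotomy 0 η with h | rfl | h
  · have h0 : √η ≠ 0 := (Real.sqrt_pos.2 h).ne'
    rw [funext (cs_of_pos h), sn_of_pos h]
    refine (((hasDerivAt_id t).const_mul √η).cosh).congr_deriv ?_
    field_simp
    rw [Real.sq_sqrt h.le]; simp
  · rw [funext cs_zero_left]; simpa using hasDerivAt_const t (1 : ℝ)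
  · have h0 : √(-η) ≠ 0 := (Real.sqrt_pos.2 (neg_pos.2 h)).ne'
    rw [funext (cs_of_neg h), sn_of_neg h]
    refine (((hasDerivAt_id t).const_mul √(-η)).cos).congr_deriv ?_
    field_simp
    rw [Real.sq_sqrt (by linarith)]; simp

lemma sn_add (η a b : ℝ) : sn η (a + b) = sn η a * cs η b + cs η a * sn η b := by
  rcases lt_trichotomy 0 η with h | rfl | h
  · simp only [sn_of_pos h, cs_of_pos h, mul_add, Real.sinh_add]; ring
  · simp [sn_zero_left, cs_zero_left]
  · simp only [sn_of_neg h, cs_of_neg h, mul_add, Real.sin_add]; ring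

lemma cs_add (η a b : ℝ) : cs η (a + b) = cs η a * cs η b + η * (sn η a * sn η b) := by
  rcases lt_trichotomy 0 η with h | rfl | h
  · have h0 : √η ≠ 0 := (Real.sqrt_pos.2 h).ne'
    simp only [sn_of_pos h, cs_of_pos h, mul_add, Real.cosh_add]
    field_simp
    rw [Real.sq_sqrt h.le]; ring
  · simp [cs_zero_left]
  · have h0 : √(-η) ≠ 0 := (Real.sqrt_pos.2 (neg_pos.2 h)).ne'
    simp only [sn_of_neg h, cs_of_neg h, mul_add, Real.cos_add]
    field_simp
    rw [Real.sq_sqrt (by linarith)]; ring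

lemma cs_sq_sub (η t : ℝ) : cs η t ^ 2 - η * sn η t ^ 2 = 1 := by
  have := cs_add η t (-t)
  rw [add_neg_cancel, cs_zero, cs_neg, sn_neg] at this
  linear_combination -this

lemma sn_sub (η a b : ℝ) : sn η (a - b) = sn η a * cs η b - cs η a * sn η b := by
  rw [sub_eq_add_neg, sn_add, sn_neg, cs_neg]; ring

lemma sn_eq_half (η t : ℝ) : sn η t = 2 * sn η (t / 2) * cs η (t / 2) := by
  have := sn_add η (t / 2) (t / 2)
  rw [add_halves] at this
  linear_combination this

lemma cs_eq_half (η t : ℝ) : cs η t = cs η (t / 2) ^ 2 + η * sn η (t / 2) ^ 2 := by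
  have := cs_add η (t / 2) (t / 2)
  rw [add_halves] at this
  linear_combination this

/-- Up to the factor `η` each function is the derivative of the other, so the induction has to treat
both at once. -/
lemma contDiff_cs_sn (η : ℝ) (n : ℕ) : ContDiff ℝ n (cs η) ∧ ContDiff ℝ n (sn η) := by
  have hc : deriv (cs η) = fun t => η * sn η t := funext fun t => (hasDerivAt_cs η t).deriv
  have hs : deriv (sn η) = cs η := funext fun t => (hasDerivAt_sn η t).deriv
  have dc : Differentiable ℝ (cs η) := fun t => (hasDerivAt_cs η t).differentiableAt
  have ds : Differentiable ℝ (sn η) := fun t => (hasDerivAt_sn η t).differentiableAt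
  induction n with
  | zero => exact ⟨contDiff_zero.2 dc.continuous, contDiff_zero.2 ds.continuous⟩
  | succ n ih =>
    constructor
    · rw [Nat.cast_succ, contDiff_succ_iff_deriv]
      refine ⟨dc, by simp, ?_⟩
      rw [hc]; exact contDiff_const.mul ih.2
    · rw [Nat.cast_succ, contDiff_succ_iff_deriv]
      refine ⟨ds, by simp, ?_⟩
      rw [hs]; exact ih.1

@[fun_prop] lemma contDiff_sn (η : ℝ) : ContDiff ℝ 1 (sn η) := by
  exact_mod_cast (contDiff_cs_sn η 1).2

@[fun_prop] lemma contDiff_cs (η : ℝ) : ContDiff ℝ 1 (cs η) := by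
  exact_mod_cast (contDiff_cs_sn η 1).1

@[fun_prop] lemma continuous_sn (η : ℝ) : Continuous (sn η) := (contDiff_sn η).continuous

@[fun_prop] lemma continuous_cs (η : ℝ) : Continuous (cs η) := (contDiff_cs η).continuous

/-- The solution of `x'' = η x + 1` with `x 0 = x' 0 = 0`. -/
def vs (η t : ℝ) : ℝ := 2 * sn η (t / 2) ^ 2

@[simp] lemma vs_zero (η : ℝ) : vs η 0 = 0 := by simp [vs]

lemma vs_neg (η t : ℝ) : vs η (-t) = vs η t := by
  rw [vs, vs, neg_div, sn_neg, neg_sq]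

lemma cs_eq_vs (η t : ℝ) : cs η t = 1 + η * vs η t := by
  have := cs_sq_sub η (t / 2)
  rw [vs, cs_eq_half]; linear_combination this

lemma hasDerivAt_vs (η t : ℝ) : HasDerivAt (vs η) (sn η t) t := by
  have h := (((hasDerivAt_sn η (t / 2)).comp t ((hasDerivAt_id t).div_const 2)).pow 2).const_mul 2
  refine h.congr_deriv ?_
  rw [sn_eq_half η t]; simp; ring

@[fun_prop] lemma contDiff_vs (η : ℝ) : ContDiff ℝ 1 (vs η) := by
  unfold vs; fun_prop

@[fun_prop] lemma continuous_vs (η : ℝ) : Continuous (vs η) := (contDiff_vs η).continuous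

/-! ### The unperturbed equation in terms of the fundamental solutions -/

lemma Gam_eq (α η t y : ℝ) :
    Gam α η t y = (y * sn η t - α * vs η t, y * cs η t - α * sn η t) := by
  have hv := cs_eq_vs η t
  rcases lt_trichotomy 0 η with h | rfl | h
  · have h0 : √η ≠ 0 := (Real.sqrt_pos.2 h).ne'
    have h1 : vs η t = (cs η t - 1) / η := by field_simp; linear_combination -hv
    rw [h1]
    simp only [Gam, h, if_true, sn_of_pos h, cs_of_pos h, Prod.mk.injEq]
    constructor
    · field_simp
      linear_combination y * Real.sinh (√η * t) * Real.sq_sqrt h.le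
    · ring
  · simp only [Gam, lt_irrefl, if_false, if_true, sn_zero_left, cs_zero_left, vs, Prod.mk.injEq]
    constructor <;> ring
  · have h0 : √(-η) ≠ 0 := (Real.sqrt_pos.2 (neg_pos.2 h)).ne'
    have h1 : vs η t = (cs η t - 1) / η := by
      have := h.ne
      field_simp; linear_combination -hv
    have h2 : √(-η) ^ 2 = -η := Real.sq_sqrt (by linarith)
    rw [h1]
    simp only [Gam, h.le.not_gt, h.ne, if_false, sn_of_neg h, cs_of_neg h, Prod.mk.injEq]
    constructor
    · have := h.ne
      rw [h2]
      field_simp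
      linear_combination -(y * Real.sin (√(-η) * t)) * h2
    · ring

lemma halfPeriodInv_eq (α η s : ℝ) :
    halfPeriodInv α η s = α * sn η (s / 2) / cs η (s / 2) := by
  rcases lt_trichotomy 0 η with h | rfl | h
  · simp only [halfPeriodInv, h, if_true, sn_of_pos h, cs_of_pos h, Real.tanh_eq_sinh_div_cosh,
      mul_div_assoc]
    field_simp
  · simp [halfPeriodInv, sn_zero_left, cs_zero_left, mul_div_assoc]
  · simp only [halfPeriodInv, h.le.not_gt, h.ne, if_false, sn_of_neg h, cs_of_neg h,
      Real.tan_eq_sin_div_cos, mul_div_assoc]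
    field_simp

lemma weight_eq (α η t s : ℝ) :
    weight α η t s = -(α / cs η (s / 2)) * sn η (t - s / 2) := by
  rcases lt_trichotomy 0 η with h | rfl | h
  · simp only [weight, h, if_true, sn_of_pos h, cs_of_pos h]
    rw [show √η * (2 * t - s) / 2 = √η * (t - s / 2) by ring, mul_div_assoc √η s 2]
    field_simp
  · simp [weight, sn_zero_left, cs_zero_left]; ring
  · simp only [weight, h.le.not_gt, h.ne, if_false, sn_of_neg h, cs_of_neg h]
    rw [show √(-η) * (2 * t - s) / 2 = √(-η) * (t - s / 2) by ring, mul_div_assoc √(-η) s 2]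
    field_simp

/-- What the values `s` of the half-period function have in common. -/
structure IsHalfPeriod (α η s : ℝ) : Prop where
  pos : 0 < s
  sn_pos : ∀ u, 0 < u → u ≤ s / 2 → 0 < sn η u
  div_cs_pos : 0 < α / cs η (s / 2)

lemma isHalfPeriod_of_neg {α η s : ℝ} (hη : η < 0) (hs : 0 < s) (hs' : √(-η) * (s / 2) < Real.pi)
    (h : 0 < α / Real.cos (√(-η) * (s / 2))) : IsHalfPeriod α η s := by
  have h0 : 0 < √(-η) := Real.sqrt_pos.2 (neg_pos.2 hη)
  refine ⟨hs, fun u hu hu' => ?_, by rwa [cs_of_neg hη]⟩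
  rw [sn_of_neg hη]
  refine div_pos (Real.sin_pos_of_pos_of_lt_pi (by positivity) (lt_of_le_of_lt ?_ hs')) h0
  gcongr

/-- The only place where the four cases are told apart. For `η < 0` the half angle `√(-η) * (s / 2)`
is an arctangent, shifted by `π` when `α < 0`. It stays below `π`, so `sn` is positive up to `s /
2`. The shift reverses the sign of the cosine, which compensates the sign of `α`. -/
lemma isHalfPeriod_of_mem {α η s : ℝ} (hcase : PeriodAnnulusCase α η)
    (hs : s ∈ halfPeriod α η '' halfPeriodDomain α η) : IsHalfPeriod α η s := by
  obtain ⟨y, hy, rfl⟩ := hs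
  rcases hcase with ⟨h, hα⟩ | ⟨rfl, hα⟩ | ⟨h, hα⟩ | ⟨h, hα⟩
  · have h0 : 0 < √η := Real.sqrt_pos.2 h
    simp only [halfPeriodDomain, h, if_true, mem_Ioo] at hy
    have hy2 : y * √η < α := by have := hy.2; rwa [lt_div_iff₀ h0] at this
    have hy3 : 0 < y * √η := mul_pos hy.1 h0
    refine ⟨?_, fun u hu _ => ?_, ?_⟩
    · simp only [halfPeriod, h, if_true]
      refine mul_pos (by positivity) (Real.log_pos ?_)
      rw [one_lt_div (by linarith)]; linarith
    · rw [sn_of_pos h]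
      exact div_pos (Real.sinh_pos_iff.2 (by positivity)) h0
    · rw [cs_of_pos h]; exact div_pos hα (Real.cosh_pos _)
  · simp only [halfPeriodDomain, lt_irrefl, if_false, mem_Ioi] at hy
    refine ⟨?_, fun u hu _ => by rwa [sn_zero_left], by rw [cs_zero_left]; simpa⟩
    simp only [halfPeriod, lt_irrefl, if_false, if_true]; positivity
  · have h0 : 0 < √(-η) := Real.sqrt_pos.2 (neg_pos.2 h)
    simp only [halfPeriodDomain, h.le.not_gt, if_false, mem_Ioi] at hy
    have ht : 0 < Real.arctan (√(-η) * y / α) := Real.arctan_pos.2 (by positivity)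
    have ht' := Real.arctan_lt_pi_div_two (√(-η) * y / α)
    have he : halfPeriod α η y = 2 / √(-η) * Real.arctan (√(-η) * y / α) := by
      simp [halfPeriod, h.le.not_gt, h.ne, hα]
    have he' : √(-η) * (halfPeriod α η y / 2) = Real.arctan (√(-η) * y / α) := by
      rw [he]; field_simp
    refine isHalfPeriod_of_neg h (by rw [he]; positivity) (by rw [he']; linarith [Real.pi_pos]) ?_
    rw [he']; exact div_pos hα (Real.cos_arctan_pos _)
  · have h0 : 0 < √(-η) := Real.sqrt_pos.2 (neg_pos.2 h)
    simp only [halfPeriodDomain, h.le.not_gt, if_false, mem_Ioi] at hy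
    have ht : Real.arctan (√(-η) * y / α) < 0 :=
      Real.arctan_lt_zero.2 (div_neg_of_pos_of_neg (by positivity) hα)
    have ht' := Real.neg_pi_div_two_lt_arctan (√(-η) * y / α)
    have he : halfPeriod α η y = 2 / √(-η) * (Real.pi + Real.arctan (√(-η) * y / α)) := by
      simp [halfPeriod, h.le.not_gt, h.ne, hα.le.not_gt]
    have he' : √(-η) * (halfPeriod α η y / 2) = Real.arctan (√(-η) * y / α) + Real.pi := by
      rw [he]; field_simp; ring
    refine isHalfPeriod_of_neg h ?_ (by rw [he']; linarith) ?_
    · rw [he]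
      have : 0 < Real.pi + Real.arctan (√(-η) * y / α) := by linarith [Real.pi_pos]
      positivity
    · rw [he', Real.cos_add_pi]
      exact div_pos_of_neg_of_neg hα (neg_lt_zero.2 (Real.cos_arctan_pos _))


/-! ### The unperturbed half orbit -/

namespace IsHalfPeriod

lemma ne_zero {α η s : ℝ} (hs : IsHalfPeriod α η s) : α ≠ 0 := by
  rintro rfl
  simpa using hs.div_cs_pos

lemma cs_half_ne {α η s : ℝ} (hs : IsHalfPeriod α η s) : cs η (s / 2) ≠ 0 := by
  intro h
  simpa [h] using hs.div_cs_pos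

lemma sn_half_pos {α η s : ℝ} (hs : IsHalfPeriod α η s) : 0 < sn η (s / 2) :=
  hs.sn_pos _ (half_pos hs.pos) le_rfl

lemma sn_ne {α η s : ℝ} (hs : IsHalfPeriod α η s) : sn η s ≠ 0 := by
  rw [sn_eq_half]
  exact mul_ne_zero (mul_ne_zero two_ne_zero hs.sn_half_pos.ne') hs.cs_half_ne

lemma halfPeriodInv_pos {α η s : ℝ} (hs : IsHalfPeriod α η s) : 0 < halfPeriodInv α η s := by
  rw [halfPeriodInv_eq, mul_div_right_comm]
  exact mul_pos hs.div_cs_pos hs.sn_half_pos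

lemma halfPeriodInv_mul_cs {α η s : ℝ} (hs : IsHalfPeriod α η s) :
    halfPeriodInv α η s * cs η (s / 2) = α * sn η (s / 2) := by
  rw [halfPeriodInv_eq, div_mul_cancel₀ _ hs.cs_half_ne]

/-- The unperturbed solution is positive in between its zeros `0` and `s`. -/
lemma position_pos {α η s t : ℝ} (hs : IsHalfPeriod α η s) (h0 : 0 < t) (ht : t < s) :
    0 < halfPeriodInv α η s * sn η t - α * vs η t := by
  -- In half angles the position factors, with one factor for each of the two zeros `0` and `s`; the
  -- remaining factor is positive by `div_cs_pos`.
  have e : halfPeriodInv α η s * sn η t - α * vs η t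
      = 2 * sn η (t / 2) * (sn η ((s - t) / 2) * (α / cs η (s / 2))) := by
    have h1 := hs.cs_half_ne
    rw [halfPeriodInv_eq, sub_div, sn_sub, vs, sn_eq_half η t]
    field_simp
  rw [e]
  have := hs.sn_pos (t / 2) (by linarith) (by linarith)
  have := hs.sn_pos ((s - t) / 2) (by linarith) (by linarith)
  have := hs.div_cs_pos
  positivity

lemma position_eq_zero {α η s : ℝ} (hs : IsHalfPeriod α η s) :
    halfPeriodInv α η s * sn η s - α * vs η s = 0 := by
  rw [vs, sn_eq_half η s]
  linear_combination 2 * sn η (s / 2) * hs.halfPeriodInv_mul_cs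

lemma velocity_eq {α η s : ℝ} (hs : IsHalfPeriod α η s) :
    halfPeriodInv α η s * cs η s - α * sn η s = -halfPeriodInv α η s := by
  have := hs.halfPeriodInv_mul_cs
  have h2 := cs_sq_sub η (s / 2)
  rw [sn_eq_half η s, cs_eq_half η s]
  linear_combination 2 * cs η (s/2) * this - halfPeriodInv α η s * h2

end IsHalfPeriod

/-! ### Superposition and integration operators on spaces of continuous functions -/

section Superposition

variable {K E F : Type*} [TopologicalSpace K] [CompactSpace K]
  [NormedAddCommGroup E] [NormedSpace ℝ E] [NormedAddCommGroup F] [NormedSpace ℝ F]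

/-- Pointwise application of operators, `(A, u) ↦ (s ↦ A s (u s))`. -/
def applyL : C(K, E →L[ℝ] F) →L[ℝ] C(K, E) →L[ℝ] C(K, F) :=
  LinearMap.mkContinuous₂
    (LinearMap.mk₂ ℝ (fun (A : C(K, E →L[ℝ] F)) (u : C(K, E)) =>
        (⟨fun s => A s (u s), by fun_prop⟩ : C(K, F)))
      (fun A B u => by ext; simp) (fun c A u => by ext; simp)
      (fun A u v => by ext; simp) (fun c A u => by ext; simp)) 1
    (fun A u => by
      rw [one_mul, ContinuousMap.norm_le _ (by positivity)]
      intro s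
      refine ((A s).le_opNorm _).trans ?_
      gcongr
      · exact A.norm_coe_le_norm s
      · exact u.norm_coe_le_norm s)

@[simp] lemma applyL_apply (A : C(K, E →L[ℝ] F)) (u : C(K, E)) (s : K) :
    applyL A u s = A s (u s) := rfl

/-- The superposition operator of a `C¹` function is `C¹`. -/
lemma contDiff_superposition {f : E → F} (hf : ContDiff ℝ 1 f) :
    ContDiff ℝ 1 (fun u : C(K, E) => (ContinuousMap.comp ⟨f, hf.continuous⟩ u : C(K, F))) := by
  let Df : C(E, E →L[ℝ] F) := ⟨fderiv ℝ f, hf.continuous_fderiv one_ne_zero⟩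
  have hDf : Continuous fun u : C(K, E) => Df.comp u := ContinuousMap.continuous_postcomp Df
  rw [contDiff_one_iff_hasFDerivAt]
  refine ⟨fun u => applyL (Df.comp u), applyL.continuous.comp hDf, fun u => ?_⟩
  rw [hasFDerivAt_iff_isLittleO, Asymptotics.isLittleO_iff]
  intro c hc
  -- Continuity of `u ↦ Df ∘ u` in the sup norm makes the bound on the variation of the derivative
  -- uniform in `s`. The mean value inequality is then applied on each segment from `u s` to `w s`.
  obtain ⟨δ, hδ, h⟩ := (Metric.continuousAt_iff (α := C(K, E)) (β := C(K, E →L[ℝ] F))).1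
    hDf.continuousAt c hc
  filter_upwards [Metric.ball_mem_nhds u hδ] with w hw
  rw [ContinuousMap.norm_le _ (by positivity)]
  intro s
  have key : ∀ z ∈ segment ℝ (u s) (w s), ‖fderiv ℝ f z - fderiv ℝ f (u s)‖ ≤ c := by
    rw [segment_eq_image']
    rintro _ ⟨θ, hθ, rfl⟩
    have hb : dist (u + θ • (w - u)) u < δ := by
      rw [dist_eq_norm, add_sub_cancel_left, norm_smul, Real.norm_of_nonneg hθ.1]
      rw [mem_ball_iff_norm] at hw
      exact lt_of_le_of_lt (mul_le_of_le_one_left (norm_nonneg _) hθ.2) hw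
    have := (ContinuousMap.dist_apply_le_dist s).trans_lt (h hb)
    rw [dist_eq_norm] at this
    exact this.le
  have := Convex.norm_image_sub_le_of_norm_hasFDerivWithin_le'
    (fun z _ => (hf.differentiable one_ne_zero z).hasFDerivAt.hasFDerivWithinAt) key
    (convex_segment _ _) (left_mem_segment ..) (right_mem_segment ..)
  refine le_trans this ?_
  gcongr
  exact (w - u).norm_coe_le_norm s

end Superposition

/-! ### Integration operators -/

section Integration

variable {T : ℝ} (hT : 0 < T)

/-- The extension by constants of a continuous function on `[-T, T]`. -/
def extend (w : C(Icc (-T) T, ℝ)) : ℝ → ℝ := IccExtend (neg_le_self hT.le) w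

lemma continuous_extend (w : C(Icc (-T) T, ℝ)) : Continuous (extend hT w) :=
  w.continuous.Icc_extend'

lemma norm_extend_le (w : C(Icc (-T) T, ℝ)) (t : ℝ) : ‖extend hT w t‖ ≤ ‖w‖ :=
  w.norm_coe_le_norm _

lemma extend_of_mem (w : C(Icc (-T) T, ℝ)) (t : Icc (-T) T) : extend hT w t = w t :=
  IccExtend_val _ _ t

lemma continuous_uncurry_extend :
    Continuous fun p : C(Icc (-T) T, ℝ) × ℝ => extend hT p.1 p.2 := by
  have h : Continuous fun p : C(Icc (-T) T, ℝ) × ℝ => projIcc _ _ (neg_le_self hT.le) p.2 :=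
    continuous_projIcc.comp continuous_snd
  exact continuous_fst.eval h

/-- The integral from `0` to `t` of the extension by constants of a continuous function. -/
def integralL (t : ℝ) : C(Icc (-T) T, ℝ) →L[ℝ] ℝ :=
  LinearMap.mkContinuous
    { toFun := fun w => ∫ r in (0 : ℝ)..t, extend hT w r
      map_add' := fun u w => intervalIntegral.integral_add
        ((continuous_extend hT u).intervalIntegrable _ _)
        ((continuous_extend hT w).intervalIntegrable _ _)
      map_smul' := fun c w => intervalIntegral.integral_smul c _ } |t|
    (fun w => by
      have := intervalIntegral.norm_integral_le_of_norm_le_const (a := 0) (b := t)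
        (fun r _ => norm_extend_le hT w r)
      rwa [sub_zero, mul_comm] at this)

lemma integralL_apply (t : ℝ) (w : C(Icc (-T) T, ℝ)) :
    integralL hT t w = ∫ r in (0 : ℝ)..t, extend hT w r := rfl

lemma hasDerivAt_integralL (w : C(Icc (-T) T, ℝ)) (t : ℝ) :
    HasDerivAt (fun t => integralL hT t w) (extend hT w t) t :=
  (continuous_extend hT w).integral_hasStrictDerivAt 0 t |>.hasDerivAt

/-- In operator norm: the integral of `w` between `t'` and `t` is at most `‖w‖ * |t - t'|`. -/
lemma continuous_integralL : Continuous (integralL hT) := by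
  suffices h : LipschitzWith 1 (integralL hT) from h.continuous
  refine LipschitzWith.of_dist_le_mul fun t t' => ?_
  rw [dist_eq_norm, NNReal.coe_one, one_mul]
  refine ContinuousLinearMap.opNorm_le_bound _ dist_nonneg fun w => ?_
  rw [sub_apply, integralL_apply, integralL_apply,
    intervalIntegral.integral_interval_sub_left
      ((continuous_extend hT w).intervalIntegrable _ _)
      ((continuous_extend hT w).intervalIntegrable _ _), mul_comm]
  exact intervalIntegral.norm_integral_le_of_norm_le_const (fun r _ => norm_extend_le hT w r)

/-- Both partial derivatives exist and are jointly continuous: the map is linear in `w`, and its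
derivative in `t` is the integrand. The extension by constants lets `t` range over all of `ℝ`, so no
boundary of `[-T, T]` interferes. -/
lemma contDiff_integralL :
    ContDiff ℝ 1 fun p : C(Icc (-T) T, ℝ) × ℝ => integralL hT p.2 p.1 := by
  have h1 := (continuous_integralL hT).comp
    (continuous_snd (X := C(Icc (-T) T, ℝ)) (Y := ℝ))
  have h2 : Continuous fun p : C(Icc (-T) T, ℝ) × ℝ =>
      ContinuousLinearMap.toSpanSingleton ℝ (extend hT p.1 p.2) :=
    (ContinuousLinearMap.toSpanSingletonLIE ℝ ℝ).continuous.comp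
      (continuous_uncurry_extend hT)
  rw [contDiff_one_iff_hasFDerivAt]
  refine ⟨fun p => (integralL hT p.2).coprod (ContinuousLinearMap.toSpanSingleton ℝ
    (extend hT p.1 p.2)), ?_, fun p => ?_⟩
  · exact (ContinuousLinearMap.coprodEquivL ℝ).continuous.comp (h1.prodMk h2)
  · refine (hasStrictFDerivAt_uncurry_coprod (u := p) (f := fun w t => integralL hT t w)
      (f₁ := fun w t => integralL hT t)
      (f₂ := fun w t => ContinuousLinearMap.toSpanSingleton ℝ (extend hT w t))
      (Filter.Eventually.of_forall fun v => (integralL hT v.2).hasFDerivAt)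
      (Filter.Eventually.of_forall fun v => (hasDerivAt_integralL hT v.1 v.2).hasFDerivAt)
      ?_ ?_).hasFDerivAt
    · exact h1.continuousAt
    · exact h2.continuousAt

/-- Integration from `0`, as an operator on continuous functions. -/
def primitiveL : C(Icc (-T) T, ℝ) →L[ℝ] C(Icc (-T) T, ℝ) :=
  LinearMap.mkContinuous
    { toFun := fun w => ⟨fun t => integralL hT t w,
        (continuous_iff_continuousAt.2 fun t =>
          (hasDerivAt_integralL hT w t).continuousAt).comp continuous_subtype_val⟩
      map_add' := fun u w => by ext; simp
      map_smul' := fun c w => by ext; simp } T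
    (fun w => by
      rw [ContinuousMap.norm_le _ (by positivity)]
      intro t
      refine ((integralL hT t).le_of_opNorm_le (c := T) ?_ w)
      exact (LinearMap.mkContinuous_norm_le _ (abs_nonneg _) _).trans (abs_le.2 t.2))

lemma primitiveL_apply (w : C(Icc (-T) T, ℝ)) (t : Icc (-T) T) :
    primitiveL hT w t = integralL hT t w := rfl

end Integration

/-! ### Local flow of a smooth side of the equation -/

/-- The position at time `t` of a solution of `x'' = η x - c + ε f` with `x 0 = 0` and `x' 0 = y`,
in terms of the integrals `A`, `B` of `cs * f` and `sn * f` along the solution. -/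
def position (c η ε y A B t : ℝ) : ℝ :=
  y * sn η t - c * vs η t + ε * (sn η t * A - cs η t * B)

/-- The velocity that belongs to `position`. -/
def velocity (c η ε y A B t : ℝ) : ℝ :=
  y * cs η t - c * sn η t + ε * (cs η t * A - η * (sn η t * B))

/-- The solutions of `x'' = η x - c + ε f(t, x, x')` that cross `x = 0` at time `t₁` with velocity
`y₁`, for `(ε, t₁, y₁)` near `p₀`, in the form of variation of constants: `A` and `B` are the
integrals from `0` to `t` of `cs * f` and `sn * f` along the solution. -/
structure LocalFlow (c η T : ℝ) (f : ℝ × ℝ × ℝ → ℝ) (p₀ : ℝ × ℝ × ℝ) where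
  N : Set (ℝ × ℝ × ℝ)
  A : ℝ × ℝ × ℝ → ℝ → ℝ
  B : ℝ × ℝ × ℝ → ℝ → ℝ
  isOpen : IsOpen N
  mem : p₀ ∈ N
  contDiffOn_A : ContDiffOn ℝ 1 (fun q : (ℝ × ℝ × ℝ) × ℝ => A q.1 q.2) (N ×ˢ univ)
  contDiffOn_B : ContDiffOn ℝ 1 (fun q : (ℝ × ℝ × ℝ) × ℝ => B q.1 q.2) (N ×ˢ univ)
  A_zero : ∀ p, A p 0 = 0
  B_zero : ∀ p, B p 0 = 0
  hasDerivAt_A : ∀ p ∈ N, ∀ t ∈ Ioo (-T) T, HasDerivAt (A p)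
    (cs η t * f (p.2.1 + t, position c η p.1 p.2.2 (A p t) (B p t) t,
      velocity c η p.1 p.2.2 (A p t) (B p t) t)) t
  hasDerivAt_B : ∀ p ∈ N, ∀ t ∈ Ioo (-T) T, HasDerivAt (B p)
    (sn η t * f (p.2.1 + t, position c η p.1 p.2.2 (A p t) (B p t) t,
      velocity c η p.1 p.2.2 (A p t) (B p t) t)) t

section Existence

variable {T : ℝ} (hT : 0 < T)

/-- The restriction of a continuous function to `[-T, T]`. -/
def restr (T : ℝ) (g : ℝ → ℝ) (hg : Continuous g) : C(Icc (-T) T, ℝ) :=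
  ⟨fun t => g t, hg.comp continuous_subtype_val⟩

/-- Time, position and velocity along a candidate for a solution, as a function of the parameters
`p = (ε, t₁, y₁)` and of the values `g` of `f` along the solution. -/
def candidate (c η : ℝ) (q : (ℝ × ℝ × ℝ) × C(Icc (-T) T, ℝ)) : C(Icc (-T) T, ℝ × ℝ × ℝ) :=
  let S := restr T (sn η) (continuous_sn η)
  let C := restr T (cs η) (continuous_cs η)
  let V := restr T (vs η) (continuous_vs η)
  let A := primitiveL hT (C * q.2)
  let B := primitiveL hT (S * q.2)
  (ContinuousLinearMap.inl ℝ ℝ (ℝ × ℝ)).compLeftContinuous ℝ _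
      (q.1.2.1 • 1 + restr T id continuous_id) +
    (ContinuousLinearMap.inr ℝ ℝ (ℝ × ℝ) ∘L ContinuousLinearMap.inl ℝ ℝ ℝ).compLeftContinuous ℝ _
      (q.1.2.2 • S - c • V + q.1.1 • (S * A - C * B)) +
    (ContinuousLinearMap.inr ℝ ℝ (ℝ × ℝ) ∘L ContinuousLinearMap.inr ℝ ℝ ℝ).compLeftContinuous ℝ _
      (q.1.2.2 • C - c • S + q.1.1 • (C * A - η • (S * B)))

lemma contDiff_candidate (c η : ℝ) : ContDiff ℝ 1 (candidate hT c η) := by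
  unfold candidate
  fun_prop

lemma candidate_apply (c η : ℝ) (p : ℝ × ℝ × ℝ) (g : C(Icc (-T) T, ℝ)) (t : Icc (-T) T) :
    candidate hT c η (p, g) t =
      let A := integralL hT t (restr T (cs η) (continuous_cs η) * g)
      let B := integralL hT t (restr T (sn η) (continuous_sn η) * g)
      (p.2.1 + t, position c η p.1 p.2.2 A B t, velocity c η p.1 p.2.2 A B t) := by
  simp [candidate, position, velocity, restr, primitiveL_apply]

/-- A local flow exists about every unperturbed solution. -/
lemma nonempty_localFlow (hT : 0 < T) (c η φ v : ℝ) {f : ℝ × ℝ × ℝ → ℝ} (hf : ContDiff ℝ 1 f) :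
    Nonempty (LocalFlow c η T f (0, φ, v)) := by
  -- The unknown is not the solution but the function `g` of values of `f` along it. A zero of `Ψ`
  -- says that the candidate built from `g` really sees the values `g`.
  let Ψ : (ℝ × ℝ × ℝ) × C(Icc (-T) T, ℝ) → C(Icc (-T) T, ℝ) := fun q =>
    q.2 - ContinuousMap.comp ⟨f, hf.continuous⟩ (candidate hT c η q)
  have hΨ : ContDiff ℝ 1 Ψ :=
    contDiff_snd.sub ((contDiff_superposition hf).comp (contDiff_candidate hT c η))
  let p₀ : ℝ × ℝ × ℝ := (0, φ, v)
  let g₀ : C(Icc (-T) T, ℝ) := ContinuousMap.comp ⟨f, hf.continuous⟩ (candidate hT c η (p₀, 0))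
  -- At `ε = 0` the candidate ignores `g`, so the partial derivative of `Ψ` in `g` is the identity.
  -- The implicit function theorem applies on the whole interval, without any smallness of `T`.
  have hcand : ∀ g, candidate hT c η (p₀, g) = candidate hT c η (p₀, 0) := fun g => by
    ext t <;> simp [candidate_apply, position, velocity, p₀]
  have hΨ₀ : Ψ (p₀, g₀) = 0 := by simp [Ψ, g₀, hcand g₀]
  have hinv : (fderiv ℝ Ψ (p₀, g₀) ∘L
      ContinuousLinearMap.inr ℝ (ℝ × ℝ × ℝ) C(Icc (-T) T, ℝ)).IsInvertible := by
    have h1 : HasFDerivAt (fun g => Ψ (p₀, g)) (fderiv ℝ Ψ (p₀, g₀) ∘L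
        ContinuousLinearMap.inr ℝ (ℝ × ℝ × ℝ) C(Icc (-T) T, ℝ)) g₀ :=
      (hΨ.differentiable one_ne_zero (p₀, g₀)).hasFDerivAt.comp g₀ (hasFDerivAt_prodMk_right p₀ g₀)
    have h2 : HasFDerivAt (fun g => Ψ (p₀, g)) (ContinuousLinearMap.id ℝ C(Icc (-T) T, ℝ)) g₀ := by
      simp only [Ψ, hcand]
      exact (hasFDerivAt_id g₀).sub_const _
    rw [h1.unique h2]
    exact ContinuousLinearMap.isInvertible_equiv (f := ContinuousLinearEquiv.refl ℝ _)
  have hc := hΨ.contDiffAt (x := (p₀, g₀))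
  let ψ := hc.implicitFunction one_ne_zero hinv
  have hψ : ContDiffAt ℝ 1 ψ p₀ := hc.contDiffAt_implicitFunction one_ne_zero hinv
  have hev := hc.eventually_apply_implicitFunction one_ne_zero hinv
  obtain ⟨N, hN, hNo, hNm⟩ := mem_nhds_iff.1
    ((hψ.eventually (by simp)).and hev)
  have hψN : ContDiffOn ℝ 1 ψ N := fun p hp => (hN hp).1.contDiffWithinAt
  have hsm : ∀ w : C(Icc (-T) T, ℝ), ContDiffOn ℝ 1
      (fun q : (ℝ × ℝ × ℝ) × ℝ => integralL hT q.2 (w * ψ q.1)) (N ×ˢ univ) := fun w => by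
    refine (contDiff_integralL hT).comp_contDiffOn (ContDiffOn.prodMk (contDiffOn_const.mul
      (hψN.comp contDiff_fst.contDiffOn fun q hq => hq.1)) contDiff_snd.contDiffOn)
  have hd : ∀ p ∈ N, ∀ (h : ℝ → ℝ) (hh : Continuous h), ∀ t ∈ Ioo (-T) T,
      HasDerivAt (fun t => integralL hT t (restr T h hh * ψ p)) (h t * f (p.2.1 + t,
        position c η p.1 p.2.2 (integralL hT t (restr T (cs η) (continuous_cs η) * ψ p))
          (integralL hT t (restr T (sn η) (continuous_sn η) * ψ p)) t,
        velocity c η p.1 p.2.2 (integralL hT t (restr T (cs η) (continuous_cs η) * ψ p))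
          (integralL hT t (restr T (sn η) (continuous_sn η) * ψ p)) t)) t := by
    intro p hp h hh t ht
    refine (hasDerivAt_integralL hT _ t).congr_deriv ?_
    have h1 : Ψ (p, ψ p) = 0 := (hN hp).2.trans hΨ₀
    have h2 := DFunLike.congr_fun (sub_eq_zero.1 h1) ⟨t, Ioo_subset_Icc_self ht⟩
    have h3 := candidate_apply hT c η p (ψ p) ⟨t, Ioo_subset_Icc_self ht⟩
    simp only at h3
    rw [← h3, extend_of_mem hT _ ⟨t, Ioo_subset_Icc_self ht⟩, ContinuousMap.mul_apply]
    exact congrArg (h t * ·) h2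
  exact ⟨{
    N := N
    A := fun p t => integralL hT t (restr T (cs η) (continuous_cs η) * ψ p)
    B := fun p t => integralL hT t (restr T (sn η) (continuous_sn η) * ψ p)
    isOpen := hNo
    mem := hNm
    contDiffOn_A := hsm _
    contDiffOn_B := hsm _
    A_zero := fun p => by simp [integralL_apply]
    B_zero := fun p => by simp [integralL_apply]
    hasDerivAt_A := fun p hp => hd p hp _ _
    hasDerivAt_B := fun p hp => hd p hp _ _ }⟩

end Existence

/-! ### Consequences of variation of constants -/

namespace LocalFlow

variable {c η T : ℝ} {f : ℝ × ℝ × ℝ → ℝ} {p₀ : ℝ × ℝ × ℝ} (L : LocalFlow c η T f p₀)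

/-- The position component of a local flow. -/
def X (p : ℝ × ℝ × ℝ) (t : ℝ) : ℝ := position c η p.1 p.2.2 (L.A p t) (L.B p t) t

/-- The velocity component of a local flow. -/
def Y (p : ℝ × ℝ × ℝ) (t : ℝ) : ℝ := velocity c η p.1 p.2.2 (L.A p t) (L.B p t) t

lemma contDiffOn_X : ContDiffOn ℝ 1 (fun q : (ℝ × ℝ × ℝ) × ℝ => L.X q.1 q.2) (L.N ×ˢ univ) := by
  have := L.contDiffOn_A
  have := L.contDiffOn_B
  unfold X position
  fun_prop

lemma contDiffOn_Y : ContDiffOn ℝ 1 (fun q : (ℝ × ℝ × ℝ) × ℝ => L.Y q.1 q.2) (L.N ×ˢ univ) := by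
  have := L.contDiffOn_A
  have := L.contDiffOn_B
  unfold Y velocity
  fun_prop

@[simp] lemma X_zero (p : ℝ × ℝ × ℝ) : L.X p 0 = 0 := by
  simp [X, position, L.B_zero]

@[simp] lemma Y_zero (p : ℝ × ℝ × ℝ) : L.Y p 0 = p.2.2 := by
  simp [Y, velocity, L.A_zero]

lemma X_unperturbed (t₁ y t : ℝ) : L.X (0, t₁, y) t = y * sn η t - c * vs η t := by
  simp [X, position]

lemma Y_unperturbed (t₁ y t : ℝ) : L.Y (0, t₁, y) t = y * cs η t - c * sn η t := by
  simp [Y, velocity]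

lemma hasDerivAt_X {p : ℝ × ℝ × ℝ} (hp : p ∈ L.N) {t : ℝ} (ht : t ∈ Ioo (-T) T) :
    HasDerivAt (L.X p) (L.Y p t) t := by
  have hA := L.hasDerivAt_A p hp t ht
  have hB := L.hasDerivAt_B p hp t ht
  have := (((hasDerivAt_sn η t).const_mul p.2.2).sub ((hasDerivAt_vs η t).const_mul c)).add
    ((((hasDerivAt_sn η t).mul hA).sub ((hasDerivAt_cs η t).mul hB)).const_mul p.1)
  refine this.congr_deriv ?_
  simp only [Y, velocity]
  ring

lemma hasDerivAt_Y {p : ℝ × ℝ × ℝ} (hp : p ∈ L.N) {t : ℝ} (ht : t ∈ Ioo (-T) T) :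
    HasDerivAt (L.Y p) (η * L.X p t - c + p.1 * f (p.2.1 + t, L.X p t, L.Y p t)) t := by
  have hA := L.hasDerivAt_A p hp t ht
  have hB := L.hasDerivAt_B p hp t ht
  change HasDerivAt (L.A p) (cs η t * f (p.2.1 + t, L.X p t, L.Y p t)) t at hA
  change HasDerivAt (L.B p) (sn η t * f (p.2.1 + t, L.X p t, L.Y p t)) t at hB
  have := (((hasDerivAt_cs η t).const_mul p.2.2).sub ((hasDerivAt_sn η t).const_mul c)).add
    ((((hasDerivAt_cs η t).mul hA).sub (((hasDerivAt_sn η t).mul hB).const_mul η)).const_mul p.1)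
  refine this.congr_deriv ?_
  have h1 := cs_eq_vs η t
  have h2 := cs_sq_sub η t
  generalize f (p.2.1 + t, L.X p t, L.Y p t) = F
  simp only [X, position]
  -- The derivatives of `A` and `B` contribute `ε * f` times the Wronskian `cs ^ 2 - η * sn ^ 2 =
  -- 1`.
  linear_combination (p.1 * F) * h2 - c * h1

/-- The integral of `sn (r - t / 2) f` along a solution, for `r` from `0` to `t`. -/
def P (p : ℝ × ℝ × ℝ) (t : ℝ) : ℝ := cs η (t / 2) * L.B p t - sn η (t / 2) * L.A p t

lemma contDiffOn_P : ContDiffOn ℝ 1 (fun q : (ℝ × ℝ × ℝ) × ℝ => L.P q.1 q.2) (L.N ×ˢ univ) := by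
  have := L.contDiffOn_A
  have := L.contDiffOn_B
  unfold P
  fun_prop

/-- The left-hand side vanishes identically along unperturbed solutions, by the half-angle formulas,
so only the explicit terms in `ε` survive. When the solution is back on `x = 0`, this expresses the
deviation of `Y` from `-y` with an exact factor `ε`. -/
lemma half_identity (p : ℝ × ℝ × ℝ) (t : ℝ) :
    sn η (t / 2) * (L.Y p t + p.2.2) - cs η (t / 2) * L.X p t = p.1 * L.P p t := by
  have h1 := cs_sq_sub η (t / 2)
  simp only [X, Y, P, position, velocity, vs]
  rw [sn_eq_half η t, cs_eq_half η t]
  generalize sn η (t / 2) = S at *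
  generalize cs η (t / 2) = C at *
  linear_combination (p.1 * (C * L.B p t - S * L.A p t) - p.2.2 * S) * h1

/-- At `ε = 0` the integral `P` runs along the unperturbed solution. -/
lemma P_unperturbed (hf : Continuous f) (hT : 0 < T) {t₁ y t : ℝ} (hp : (0, t₁, y) ∈ L.N)
    (ht : t ∈ Ioo (-T) T) :
    L.P (0, t₁, y) t = ∫ r in (0 : ℝ)..t, sn η (r - t / 2) *
      f (t₁ + r, y * sn η r - c * vs η r, y * cs η r - c * sn η r) := by
  have hsub : uIcc 0 t ⊆ Ioo (-T) T :=
    ordConnected_Ioo.uIcc_subset ⟨neg_neg_of_pos hT, hT⟩ ht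
  have hc : Continuous fun r =>
      f (t₁ + r, y * sn η r - c * vs η r, y * cs η r - c * sn η r) := by fun_prop
  have hA := intervalIntegral.integral_eq_sub_of_hasDerivAt (a := 0) (b := t)
    (f := L.A (0, t₁, y)) (f' := fun r => cs η r *
      f (t₁ + r, y * sn η r - c * vs η r, y * cs η r - c * sn η r))
    (fun r hr => by simpa [position, velocity] using L.hasDerivAt_A _ hp r (hsub hr))
    (((continuous_cs η).mul hc).intervalIntegrable _ _)
  have hB := intervalIntegral.integral_eq_sub_of_hasDerivAt (a := 0) (b := t)
    (f := L.B (0, t₁, y)) (f' := fun r => sn η r *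
      f (t₁ + r, y * sn η r - c * vs η r, y * cs η r - c * sn η r))
    (fun r hr => by simpa [position, velocity] using L.hasDerivAt_B _ hp r (hsub hr))
    (((continuous_sn η).mul hc).intervalIntegrable _ _)
  rw [L.A_zero, sub_zero] at hA
  rw [L.B_zero, sub_zero] at hB
  rw [P, ← hA, ← hB, ← intervalIntegral.integral_const_mul, ← intervalIntegral.integral_const_mul,
    ← intervalIntegral.integral_sub]
  · refine intervalIntegral.integral_congr fun r _ => ?_
    simp only [sn_sub]
    ring
  · exact (((continuous_sn η).mul hc).const_mul _).intervalIntegrable _ _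
  · exact (((continuous_cs η).mul hc).const_mul _).intervalIntegrable _ _

end LocalFlow

/-! ### The bifurcation equations -/

section Bifurcation

variable {α η σ φ v : ℝ} {f : ℝ × ℝ × ℝ → ℝ}
  (Lp : LocalFlow α η σ f (0, φ, v)) (Lm : LocalFlow (-α) η σ f (0, φ, v))

/-- The bifurcation equations for `(t₁, h, y)`: the solution that crosses `x = 0` upwards at time
`t₁` with velocity `y` crosses `x = 0` again at the times `t₁ + h` and `t₁ + h - σ`, and (after
division by `ε`) the velocities agree there. -/
def bifurcation (q : ℝ × ℝ × ℝ × ℝ) : ℝ × ℝ × ℝ :=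
  (Lp.X (q.1, q.2.1, q.2.2.2) q.2.2.1, Lm.X (q.1, q.2.1, q.2.2.2) (q.2.2.1 - σ),
    sn η ((q.2.2.1 - σ) / 2) * Lp.P (q.1, q.2.1, q.2.2.2) q.2.2.1 -
      sn η (q.2.2.1 / 2) * Lm.P (q.1, q.2.1, q.2.2.2) (q.2.2.1 - σ))

/-- The point at which the bifurcation equations are solved. -/
def basePoint (σ φ v : ℝ) : ℝ × ℝ × ℝ × ℝ := (0, φ, σ / 2, v)

lemma contDiffAt_bifurcation : ContDiffAt ℝ 1 (bifurcation Lp Lm) (basePoint σ φ v) := by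
  have aux : ∀ (N : Set (ℝ × ℝ × ℝ)) (F : ℝ × ℝ × ℝ → ℝ → ℝ), IsOpen N →
      (0, φ, v) ∈ N →
      ContDiffOn ℝ 1 (fun q : (ℝ × ℝ × ℝ) × ℝ => F q.1 q.2) (N ×ˢ univ) →
      ∀ k : ℝ, ContDiffAt ℝ 1 (fun q : ℝ × ℝ × ℝ × ℝ => F (q.1, q.2.1, q.2.2.2) (q.2.2.1 - k))
        (basePoint σ φ v) := by
    intro N F hN hm hF k
    have h1 : ContDiffAt ℝ 1 (fun q : (ℝ × ℝ × ℝ) × ℝ => F q.1 q.2)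
        ((0, φ, v), σ / 2 - k) :=
      hF.contDiffAt ((hN.prod isOpen_univ).mem_nhds ⟨hm, mem_univ _⟩)
    have h2 : ContDiffAt ℝ 1 (fun q : ℝ × ℝ × ℝ × ℝ =>
        (((q.1, q.2.1, q.2.2.2), q.2.2.1 - k) : (ℝ × ℝ × ℝ) × ℝ)) (basePoint σ φ v) := by
      fun_prop
    exact h1.comp (basePoint σ φ v) h2
  -- The shift `k = 0` serves the flow of `x > 0`, the shift `k = σ` that of `x < 0`.
  have a0 : ∀ (F : ℝ × ℝ × ℝ → ℝ → ℝ),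
      (fun q : ℝ × ℝ × ℝ × ℝ => F (q.1, q.2.1, q.2.2.2) q.2.2.1) =
      fun q => F (q.1, q.2.1, q.2.2.2) (q.2.2.1 - 0) := by simp
  have h1 := aux _ _ Lp.isOpen Lp.mem Lp.contDiffOn_X 0
  have h2 := aux _ _ Lm.isOpen Lm.mem Lm.contDiffOn_X σ
  have h3 := aux _ _ Lp.isOpen Lp.mem Lp.contDiffOn_P 0
  have h4 := aux _ _ Lm.isOpen Lm.mem Lm.contDiffOn_P σ
  rw [← a0] at h1 h3
  unfold bifurcation
  fun_prop

/-- Time reversal composed with the reflection in the `y`-axis exchanges the two unperturbed sides.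
This is where `R` and the time `φ - t` in `M` come from. -/
lemma unperturbed_neg (v t : ℝ) :
    (v * sn η (-t) - -α * vs η (-t), v * cs η (-t) - -α * sn η (-t)) =
      reflect (v * sn η t - α * vs η t, v * cs η t - α * sn η t) := by
  simp only [sn_neg, cs_neg, vs_neg, reflect, Prod.mk.injEq]
  constructor <;> ring

/-- Both end times are zeros of the unperturbed position. In the third component, substituting `r ↦
-r` on the side `x < 0` turns its integral into one over the reflected right half orbit. Both
integrals then carry the kernel `sn (r - σ / 4)`, which is the weight `U` up to a constant. -/
lemma bifurcation_melnikov (hs : IsHalfPeriod α η (σ / 2))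
    (hv : v = halfPeriodInv α η (σ / 2)) (hf : Continuous f) {t₁ : ℝ}
    (hp : (0, t₁, v) ∈ Lp.N)
    (hm : (0, t₁, v) ∈ Lm.N) :
    bifurcation Lp Lm (0, t₁, σ / 2, v) =
      (0, 0, sn η (σ / 2 / 2) * cs η (σ / 2 / 2) / α * melnikov α η σ f t₁) := by
  have hpos := hs.pos
  have e : σ / 2 - σ = -(σ / 2) := by ring
  have hT : 0 < σ := by linarith
  simp only [bifurcation, e, Lp.X_unperturbed, Lm.X_unperturbed]
  have hn := unperturbed_neg (α := α) (η := η) v (σ / 2)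
  have h0 : v * sn η (σ / 2) - α * vs η (σ / 2) = 0 := hv ▸ hs.position_eq_zero
  refine Prod.ext h0 (Prod.ext ?_ ?_)
  · refine (congrArg Prod.fst hn).trans ?_
    simp [reflect, h0]
  · dsimp only
    have h2 : -(σ / 2) ∈ Ioo (-σ) σ := ⟨by linarith, by linarith⟩
    rw [Lp.P_unperturbed hf hT hp ⟨by linarith, by linarith⟩,
      Lm.P_unperturbed hf hT hm h2]
    have h3 : ∀ g : ℝ → ℝ, ∫ r in (0 : ℝ)..(-(σ / 2)), g r =
        -∫ r in (0 : ℝ)..(σ / 2), g (-r) := fun g => by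
      rw [intervalIntegral.integral_comp_neg, neg_zero, intervalIntegral.integral_symm]
    rw [h3, melnikov]
    simp only [weight_eq, Gam_eq, ← hv]
    have h4 : ∀ r, f (t₁ + -r, v * sn η (-r) - -α * vs η (-r), v * cs η (-r) - -α * sn η (-r)) =
        f (t₁ - r, reflect (v * sn η r - α * vs η r, v * cs η r - α * sn η r)) := fun r => by
      rw [← unperturbed_neg, sub_eq_add_neg t₁ r]
    simp only [h4]
    have c1 : Continuous fun r => sn η (r - σ / 2 / 2) *
        f (t₁ + r, v * sn η r - α * vs η r, v * cs η r - α * sn η r) := by fun_prop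
    have c2 : Continuous fun r => sn η (r - σ / 2 / 2) *
        f (t₁ - r, reflect (v * sn η r - α * vs η r, v * cs η r - α * sn η r)) := by
      unfold reflect; fun_prop
    have h5 : ∀ r, sn η (-r - -(σ / 2) / 2) = -sn η (r - σ / 2 / 2) := fun r => by
      rw [← sn_neg]; congr 1; ring
    have h7 : sn η (-(σ / 2) / 2) = -sn η (σ / 2 / 2) := by rw [neg_div, sn_neg]
    simp only [h5, h7]
    have h6 : ∀ r, -(α / cs η (σ / 2 / 2)) * sn η (r - σ / 2 / 2) *
        (f (t₁ + r, v * sn η r - α * vs η r, v * cs η r - α * sn η r) +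
          f (t₁ - r, reflect (v * sn η r - α * vs η r, v * cs η r - α * sn η r))) =
        -(α / cs η (σ / 2 / 2)) * (sn η (r - σ / 2 / 2) *
          f (t₁ + r, v * sn η r - α * vs η r, v * cs η r - α * sn η r) +
        sn η (r - σ / 2 / 2) *
          f (t₁ - r, reflect (v * sn η r - α * vs η r, v * cs η r - α * sn η r))) := fun r => by
      ring
    simp only [h6, intervalIntegral.integral_const_mul]
    rw [intervalIntegral.integral_add (c1.intervalIntegrable _ _) (c2.intervalIntegrable _ _)]
    simp only [neg_mul, intervalIntegral.integral_neg]
    have hα := hs.ne_zero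
    have hC := hs.cs_half_ne
    generalize (∫ r in (0 : ℝ)..(σ / 2), sn η (r - σ / 2 / 2) *
      f (t₁ + r, v * sn η r - α * vs η r, v * cs η r - α * sn η r)) = I₁
    generalize (∫ r in (0 : ℝ)..(σ / 2), sn η (r - σ / 2 / 2) *
      f (t₁ - r, reflect (v * sn η r - α * vs η r, v * cs η r - α * sn η r))) = I₂
    generalize cs η (σ / 2 / 2) = C at hC ⊢
    field_simp
    ring

lemma hasDerivAt_fst {E F : Type*} [NormedAddCommGroup E] [NormedSpace ℝ E]
    [NormedAddCommGroup F] [NormedSpace ℝ F] {g : ℝ → E × F} {g' : E × F} {t : ℝ}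
    (h : HasDerivAt g g' t) : HasDerivAt (fun t => (g t).1) g'.1 t :=
  (ContinuousLinearMap.fst ℝ E F).hasFDerivAt.comp_hasDerivAt t h

lemma hasDerivAt_snd {E F : Type*} [NormedAddCommGroup E] [NormedSpace ℝ E]
    [NormedAddCommGroup F] [NormedSpace ℝ F] {g : ℝ → E × F} {g' : E × F} {t : ℝ}
    (h : HasDerivAt g g' t) : HasDerivAt (fun t => (g t).2) g'.2 t :=
  (ContinuousLinearMap.snd ℝ E F).hasFDerivAt.comp_hasDerivAt t h

lemma isInvertible_of_forall_eq_zero {E : Type*} [NormedAddCommGroup E] [NormedSpace ℝ E]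
    [FiniteDimensional ℝ E] (L : E →L[ℝ] E) (h : ∀ x, L x = 0 → x = 0) : L.IsInvertible :=
  ⟨(LinearEquiv.ofInjectiveEndo (L : E →ₗ[ℝ] E)
    ((injective_iff_map_eq_zero _).2 h)).toContinuousLinearEquiv, by ext; rfl⟩

/-- In the variables `(t₁, h, y)` the rows of the Jacobian are `(0, -v, sn (σ / 2))`, `(0, -v, -sn
(σ / 2))` and `(k * M', *, *)` with `k ≠ 0`. The first two force the `h` and `y` components of a
kernel vector to vanish, so the starred entries need not be known. -/
lemma isInvertible_bifurcation (hs : IsHalfPeriod α η (σ / 2))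
    (hv : v = halfPeriodInv α η (σ / 2)) (hf : Continuous f)
    (hsimple : deriv (melnikov α η σ f) φ ≠ 0) :
    (fderiv ℝ (bifurcation Lp Lm) (basePoint σ φ v) ∘L
      ContinuousLinearMap.inr ℝ ℝ (ℝ × ℝ × ℝ)).IsInvertible := by
  set D := fderiv ℝ (bifurcation Lp Lm) (basePoint σ φ v) ∘L
      ContinuousLinearMap.inr ℝ ℝ (ℝ × ℝ × ℝ) with hD
  have hvpos : 0 < v := hv ▸ hs.halfPeriodInv_pos
  have hpos := hs.pos
  have hF : HasFDerivAt (fun q => bifurcation Lp Lm (0, q)) D (φ, σ / 2, v) :=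
    HasFDerivAt.comp (φ, σ / 2, v)
      ((contDiffAt_bifurcation Lp Lm).differentiableAt one_ne_zero).hasFDerivAt
      (hasFDerivAt_prodMk_right (0 : ℝ) (φ, σ / 2, v))
  have e : σ / 2 - σ = -(σ / 2) := by ring
  -- the derivative in `t₁`
  have ht : HasDerivAt (fun t => bifurcation Lp Lm (0, t, σ / 2, v)) (D (1, 0, 0)) φ :=
    HasFDerivAt.comp_hasDerivAt (f := fun t : ℝ => (t, σ / 2, v)) φ hF
      ((hasDerivAt_id φ).prodMk (hasDerivAt_const φ (σ / 2, v)))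
  have ht' : HasDerivAt (fun t => ((0, 0, sn η (σ / 2 / 2) * cs η (σ / 2 / 2) / α *
      melnikov α η σ f t) : ℝ × ℝ × ℝ)) (0, 0, sn η (σ / 2 / 2) * cs η (σ / 2 / 2) / α *
      deriv (melnikov α η σ f) φ) φ :=
    (hasDerivAt_const _ _).prodMk ((hasDerivAt_const _ _).prodMk
      ((differentiableAt_of_deriv_ne_zero hsimple).hasDerivAt.const_mul _))
  -- The formula in terms of `M` is available only where the local flows are defined, which suffices
  -- for a derivative at `φ`.
  have hev : ∀ᶠ t in 𝓝 φ, (0, t, v) ∈ Lp.N ∩ Lm.N :=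
    ContinuousAt.eventually_mem (f := fun t : ℝ => ((0, t, v) : ℝ × ℝ × ℝ)) (by fun_prop)
      ((Lp.isOpen.inter Lm.isOpen).mem_nhds ⟨Lp.mem, Lm.mem⟩)
  have D1 := ht.unique (ht'.congr_of_eventuallyEq
    (hev.mono fun t h => bifurcation_melnikov Lp Lm hs hv hf h.1 h.2))
  -- the derivative in `h`
  have hh : HasDerivAt (fun h => bifurcation Lp Lm (0, φ, h, v)) (D (0, 1, 0)) (σ / 2) :=
    HasFDerivAt.comp_hasDerivAt (f := fun h : ℝ => (φ, h, v)) (σ / 2) hF ((hasDerivAt_const _ φ).prodMk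
      ((hasDerivAt_id (σ / 2)).prodMk (hasDerivAt_const _ v)))
  have D21 : (D (0, 1, 0)).1 = -v := by
    have h1 : HasDerivAt (fun h => v * sn η h - α * vs η h) (D (0, 1, 0)).1 (σ / 2) := by
      simpa [bifurcation, Lp.X_unperturbed] using hasDerivAt_fst hh
    rw [h1.unique (((hasDerivAt_sn η _).const_mul v).sub ((hasDerivAt_vs η _).const_mul α))]
    exact hv ▸ hs.velocity_eq
  have D22 : (D (0, 1, 0)).2.1 = -v := by
    have h1 : HasDerivAt (fun h => v * sn η (h - σ) - -α * vs η (h - σ)) (D (0, 1, 0)).2.1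
        (σ / 2) := by
      simpa [bifurcation, Lm.X_unperturbed] using hasDerivAt_fst (hasDerivAt_snd hh)
    have hsub := (hasDerivAt_id (σ / 2)).sub_const σ
    have h2 := (((hasDerivAt_sn η (σ / 2 - σ)).comp_of_eq (σ / 2) hsub rfl).const_mul v).sub
      (((hasDerivAt_vs η (σ / 2 - σ)).comp_of_eq (σ / 2) hsub rfl).const_mul (-α))
    rw [h1.unique h2, e, cs_neg, sn_neg, ← (hv ▸ hs.velocity_eq : v * cs η (σ / 2) - _ = -v)]
    ring
  have hy : HasDerivAt (fun y => bifurcation Lp Lm (0, φ, σ / 2, y)) (D (0, 0, 1)) v :=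
    HasFDerivAt.comp_hasDerivAt (f := fun y : ℝ => (φ, σ / 2, y)) v hF ((hasDerivAt_const _ φ).prodMk
      ((hasDerivAt_const _ (σ / 2)).prodMk (hasDerivAt_id v)))
  have D31 : (D (0, 0, 1)).1 = sn η (σ / 2) := by
    have h1 : HasDerivAt (fun y => y * sn η (σ / 2) - α * vs η (σ / 2)) (D (0, 0, 1)).1 v := by
      simpa [bifurcation, Lp.X_unperturbed] using hasDerivAt_fst hy
    simpa using h1.unique (((hasDerivAt_id v).mul_const (sn η (σ / 2))).sub_const _)
  have D32 : (D (0, 0, 1)).2.1 = -sn η (σ / 2) := by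
    have h1 : HasDerivAt (fun y => y * sn η (σ / 2 - σ) - -α * vs η (σ / 2 - σ))
        (D (0, 0, 1)).2.1 v := by
      simpa [bifurcation, Lm.X_unperturbed] using hasDerivAt_fst (hasDerivAt_snd hy)
    rw [← sn_neg, ← e]
    simpa using h1.unique (((hasDerivAt_id v).mul_const (sn η (σ / 2 - σ))).sub_const _)
  refine isInvertible_of_forall_eq_zero D fun x hx => ?_
  obtain ⟨a, b, c⟩ := x
  have hlin : D (a, b, c) = a • D (1, 0, 0) + b • D (0, 1, 0) + c • D (0, 0, 1) := by
    rw [← map_smul, ← map_smul, ← map_smul, ← map_add, ← map_add]; simp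
  rw [hlin, D1] at hx
  have e1 := congrArg Prod.fst hx
  have e2 := congrArg (fun z => z.2.1) hx
  have e3 := congrArg (fun z => z.2.2) hx
  simp [D21, D22, D31, D32] at e1 e2
  have hc : c = 0 := by
    have : c * sn η (σ / 2) = 0 := by linarith
    exact (mul_eq_zero.1 this).resolve_right hs.sn_ne
  have hb : b = 0 := by
    have : b * v = 0 := by rw [hc] at e1; linarith
    exact (mul_eq_zero.1 this).resolve_right hvpos.ne'
  subst hc hb
  have := hs.ne_zero
  have := hs.cs_half_ne
  have := hs.sn_half_pos.ne'
  simp_all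

/-- The bifurcation equations have a unique smooth branch of solutions. -/
lemma exists_branch (hs : IsHalfPeriod α η (σ / 2))
    (hv : v = halfPeriodInv α η (σ / 2)) (hf : Continuous f)
    (hzero : melnikov α η σ f φ = 0) (hsimple : deriv (melnikov α η σ f) φ ≠ 0) :
    ∃ ψ : ℝ → ℝ × ℝ × ℝ, ContDiffAt ℝ 1 ψ 0 ∧ ψ 0 = (φ, σ / 2, v) ∧
      (∀ᶠ ε in 𝓝 0, bifurcation Lp Lm (ε, ψ ε) = 0) ∧
      ∀ᶠ q in 𝓝 (basePoint σ φ v), bifurcation Lp Lm q = 0 → q.2 = ψ q.1 := by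
  have hc := contDiffAt_bifurcation Lp Lm
  have hinv := isInvertible_bifurcation Lp Lm hs hv hf hsimple
  have h0 : bifurcation Lp Lm (basePoint σ φ v) = 0 := by
    rw [basePoint, bifurcation_melnikov Lp Lm hs hv hf Lp.mem Lm.mem, hzero, mul_zero]; rfl
  refine ⟨hc.implicitFunction one_ne_zero hinv, hc.contDiffAt_implicitFunction one_ne_zero hinv,
    hc.implicitFunction_apply_self one_ne_zero hinv, ?_, ?_⟩
  · rw [← h0]
    exact hc.eventually_apply_implicitFunction one_ne_zero hinv
  · filter_upwards [hc.eventually_apply_eq_iff_implicitFunction one_ne_zero hinv] with q hq h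
    exact (hq.1 (h.trans h0.symm)).symm

end Bifurcation

/-! ### Pasting differentiable functions -/

/-- On the switching set both pieces have the same value and derivative, so the pasted function has
this derivative within `p` and within its complement. -/
lemma hasFDerivAt_ite {E F : Type*} [NormedAddCommGroup E] [NormedSpace ℝ E]
    [NormedAddCommGroup F] [NormedSpace ℝ F] {p : E → Prop} [DecidablePred p] {a b : E → F}
    {a' b' : E →L[ℝ] F} {x : E} (ha : HasFDerivAt a a' x) (hb : HasFDerivAt b b' x)
    (h : (∀ᶠ y in 𝓝 x, p y) ∨ (∀ᶠ y in 𝓝 x, ¬p y) ∨ (a x = b x ∧ a' = b')) :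
    HasFDerivAt (fun y => if p y then a y else b y) (if p x then a' else b') x := by
  rcases h with h | h | ⟨h, rfl⟩
  · rw [if_pos h.self_of_nhds]
    exact ha.congr_of_eventuallyEq (h.mono fun y hy => if_pos hy)
  · rw [if_neg h.self_of_nhds]
    exact hb.congr_of_eventuallyEq (h.mono fun y hy => if_neg hy)
  · rw [ite_self, ← hasFDerivWithinAt_univ, ← union_compl_self {y | p y}]
    refine HasFDerivWithinAt.union ?_ ?_
    · refine ha.hasFDerivWithinAt.congr (fun y hy => if_pos hy) ?_
      split_ifs <;> simp [h]
    · refine hb.hasFDerivWithinAt.congr (fun y hy => if_neg hy) ?_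
      split_ifs <;> simp [h]

lemma continuousAt_ite {E F : Type*} [TopologicalSpace E] [TopologicalSpace F] {p : E → Prop}
    [DecidablePred p] {a b : E → F} {x : E} (ha : ContinuousAt a x) (hb : ContinuousAt b x)
    (h : (∀ᶠ y in 𝓝 x, p y) ∨ (∀ᶠ y in 𝓝 x, ¬p y) ∨ a x = b x) :
    ContinuousAt (fun y => if p y then a y else b y) x := by
  rcases h with h | h | h
  · exact ha.congr (h.mono fun y hy => (if_pos hy).symm)
  · exact hb.congr (h.mono fun y hy => (if_neg hy).symm)
  · rw [← continuousWithinAt_univ, ← union_compl_self {y | p y}]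
    refine ContinuousWithinAt.union ?_ ?_
    · refine ha.continuousWithinAt.congr (fun y hy => if_pos hy) ?_
      split_ifs <;> simp [h]
    · refine hb.continuousWithinAt.congr (fun y hy => if_neg hy) ?_
      split_ifs <;> simp [h]

lemma le_trichotomy {E : Type*} [TopologicalSpace E] {u w : E → ℝ} {x : E}
    (hu : ContinuousAt u x) (hw : ContinuousAt w x) :
    (∀ᶠ y in 𝓝 x, u y ≤ w y) ∨ (∀ᶠ y in 𝓝 x, ¬u y ≤ w y) ∨ u x = w x := by
  rcases lt_trichotomy (u x) (w x) with h | h | h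
  · exact Or.inl ((hu.eventually_lt hw h).mono fun y hy => hy.le)
  · exact Or.inr (Or.inr h)
  · exact Or.inr (Or.inl ((hw.eventually_lt hu h).mono fun y hy => not_le.2 hy))

lemma hasDerivAt_ite_le {a b a' b' : ℝ → ℝ} {T s : ℝ} (ha : s ≤ T → HasDerivAt a (a' s) s)
    (hb : T ≤ s → HasDerivAt b (b' s) s) (h : a T = b T ∧ a' T = b' T) :
    HasDerivAt (fun s => if s ≤ T then a s else b s) (if s ≤ T then a' s else b' s) s := by
  rcases lt_trichotomy s T with hs | rfl | hs
  · rw [if_pos hs.le]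
    exact (ha hs.le).congr_of_eventuallyEq ((eventually_lt_nhds hs).mono fun y hy => if_pos hy.le)
  · have := hasFDerivAt_ite (p := fun y => y ≤ s) (ha le_rfl).hasFDerivAt (hb le_rfl).hasFDerivAt
      (Or.inr (Or.inr ⟨h.1, by rw [h.2]⟩))
    rw [if_pos le_rfl] at this
    rw [if_pos le_rfl]
    exact this
  · rw [if_neg hs.not_ge]
    exact (hb hs.le).congr_of_eventuallyEq
      ((eventually_gt_nhds hs).mono fun y hy => if_neg (not_le.2 hy))

/-- Two `C¹` functions of `(ε, s)`, pasted along the graph of a `C¹` function of `ε` on which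
their values and their derivatives in `s` agree, form a `C¹` function. -/
lemma contDiffOn_paste {J : Set ℝ} (hJ : IsOpen J) {F G : ℝ × ℝ → ℝ} {T : ℝ → ℝ}
    (hF : ContDiffOn ℝ 1 F (J ×ˢ univ)) (hG : ContDiffOn ℝ 1 G (J ×ˢ univ))
    (hT : ContDiffOn ℝ 1 T J) (hval : ∀ ε ∈ J, F (ε, T ε) = G (ε, T ε))
    (hder : ∀ ε ∈ J, ∃ m, HasDerivAt (fun s => F (ε, s)) m (T ε) ∧
      HasDerivAt (fun s => G (ε, s)) m (T ε)) :
    ContDiffOn ℝ 1 (fun q : ℝ × ℝ => if q.2 ≤ T q.1 then F q else G q) (J ×ˢ univ) := by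
  have hO : IsOpen (J ×ˢ (univ : Set ℝ)) := hJ.prod isOpen_univ
  have dF : ∀ q ∈ J ×ˢ (univ : Set ℝ), HasFDerivAt F (fderiv ℝ F q) q := fun q hq =>
    ((hF.contDiffAt (hO.mem_nhds hq)).differentiableAt one_ne_zero).hasFDerivAt
  have dG : ∀ q ∈ J ×ˢ (univ : Set ℝ), HasFDerivAt G (fderiv ℝ G q) q := fun q hq =>
    ((hG.contDiffAt (hO.mem_nhds hq)).differentiableAt one_ne_zero).hasFDerivAt
  have hTc : ∀ q ∈ J ×ˢ (univ : Set ℝ), ContinuousAt (fun q : ℝ × ℝ => T q.1) q := fun q hq =>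
    (hT.continuousOn.continuousAt (hJ.mem_nhds hq.1)).comp continuousAt_fst
  -- Differentiating the equality of values along the graph gives agreement in the direction `(1, T'
  -- ε)`. The hypothesis on the derivatives in `s` gives agreement on `(0, 1)`, and the two
  -- directions span the plane.
  have hgraph : ∀ ε ∈ J, fderiv ℝ F (ε, T ε) = fderiv ℝ G (ε, T ε) := by
    intro ε hε
    have hm : (ε, T ε) ∈ J ×ˢ (univ : Set ℝ) := ⟨hε, mem_univ _⟩
    have hTd := ((hT.contDiffAt (hJ.mem_nhds hε)).differentiableAt one_ne_zero).hasDerivAt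
    have h1 := (dF _ hm).comp_hasDerivAt ε ((hasDerivAt_id ε).prodMk hTd)
    have h2 := (dG _ hm).comp_hasDerivAt ε ((hasDerivAt_id ε).prodMk hTd)
    have e1 := h1.unique (h2.congr_of_eventuallyEq
      (Filter.eventually_of_mem (hJ.mem_nhds hε) fun x hx => hval x hx))
    obtain ⟨m, hm1, hm2⟩ := hder ε hε
    have h3 := (dF _ hm).comp_hasDerivAt (T ε) ((hasDerivAt_const (T ε) ε).prodMk (hasDerivAt_id _))
    have h4 := (dG _ hm).comp_hasDerivAt (T ε) ((hasDerivAt_const (T ε) ε).prodMk (hasDerivAt_id _))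
    have e2 : fderiv ℝ F (ε, T ε) (0, 1) = fderiv ℝ G (ε, T ε) (0, 1) :=
      (h3.unique hm1).trans (h4.unique hm2).symm
    refine ContinuousLinearMap.ext fun x => ?_
    have hx : x = x.1 • ((1, deriv T ε) : ℝ × ℝ) + (x.2 - x.1 * deriv T ε) • ((0, 1) : ℝ × ℝ) := by
      ext <;> simp
    rw [hx, map_add, map_add, map_smul, map_smul, map_smul, map_smul, e1, e2]
  have htri := fun (q : ℝ × ℝ) (hq : q ∈ J ×ˢ (univ : Set ℝ)) =>
    le_trichotomy (u := fun q : ℝ × ℝ => q.2) (continuousAt_snd (p := q)) (hTc q hq)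
  have heq : ∀ q ∈ J ×ˢ (univ : Set ℝ), q.2 = T q.1 →
      F q = G q ∧ fderiv ℝ F q = fderiv ℝ G q := fun q hq e => by
    have : q = (q.1, T q.1) := Prod.ext rfl e
    rw [this]; exact ⟨hval _ hq.1, hgraph _ hq.1⟩
  have main : ∀ q ∈ J ×ˢ (univ : Set ℝ),
      HasFDerivAt (fun q : ℝ × ℝ => if q.2 ≤ T q.1 then F q else G q)
        (if q.2 ≤ T q.1 then fderiv ℝ F q else fderiv ℝ G q) q := fun q hq =>
    hasFDerivAt_ite (dF q hq) (dG q hq)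
      ((htri q hq).imp_right (Or.imp_right fun e => heq q hq e))
  intro q hq
  refine (contDiffAt_one_iff.2 ⟨fun q => if q.2 ≤ T q.1 then fderiv ℝ F q else fderiv ℝ G q,
    J ×ˢ univ, hO.mem_nhds hq, fun q hq => ?_, main⟩).contDiffWithinAt
  exact (continuousAt_ite
    ((hF.continuousOn_fderiv_of_isOpen hO le_rfl).continuousAt (hO.mem_nhds hq))
    ((hG.continuousOn_fderiv_of_isOpen hO le_rfl).continuousAt (hO.mem_nhds hq))
    ((htri q hq).imp_right (Or.imp_right fun e => (heq q hq e).2))).continuousWithinAt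

/-! ### Periodic functions pasted from two pieces -/

section Profile

variable {σ : ℝ} (hσ : 0 < σ)

/-- The `σ`-periodic function which equals `a` on `[0, h]` and `b` on `(h - σ, 0)`. -/
def profile (h : ℝ) (a b : ℝ → ℝ) (s : ℝ) : ℝ :=
  if toIcoMod hσ 0 s ≤ h then a (toIcoMod hσ 0 s) else b (toIcoMod hσ 0 s - σ)

lemma profile_periodic (h : ℝ) (a b : ℝ → ℝ) : Function.Periodic (profile hσ h a b) σ :=
  fun s => by simp [profile, toIcoMod_add_right]

lemma profile_of_mem {h : ℝ} {a b : ℝ → ℝ} {s : ℝ} (hs : s ∈ Ico 0 σ) :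
    profile hσ h a b s = if s ≤ h then a s else b (s - σ) := by
  have : toIcoMod hσ 0 s = s := (toIcoMod_eq_self hσ).2 (by simpa using hs)
  rw [profile, this]

lemma profile_of_mem_Ioo {h : ℝ} {a b : ℝ → ℝ} {s : ℝ} (hh : h ∈ Ioo 0 σ)
    (hs : s ∈ Ioo (h - σ) h) (hab : a 0 = b 0) :
    profile hσ h a b s = if s ≤ 0 then b s else a s := by
  rcases lt_trichotomy s 0 with h0 | rfl | h0
  · rw [← profile_periodic hσ h a b s, profile_of_mem hσ ⟨by linarith [hs.1, hh.1], by linarith⟩,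
      if_neg (by linarith [hs.1]), if_pos h0.le, add_sub_cancel_right]
  · rw [profile_of_mem hσ ⟨le_rfl, hσ⟩, if_pos hh.1.le, if_pos le_rfl, hab]
  · rw [profile_of_mem hσ ⟨h0.le, hs.2.trans hh.2⟩, if_pos hs.2.le, if_neg h0.not_ge]

lemma profile_eq_left {h : ℝ} {a b : ℝ → ℝ} {s : ℝ} (hh : h ∈ Ioo 0 σ) (hs : s ∈ Icc 0 h) :
    profile hσ h a b s = a s := by
  rw [profile_of_mem hσ ⟨hs.1, hs.2.trans_lt hh.2⟩, if_pos hs.2]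

lemma profile_eq_right {h : ℝ} {a b : ℝ → ℝ} {s : ℝ} (hh : h ∈ Ioo 0 σ) (h0 : a 0 = b 0)
    (h1 : a h = b (h - σ)) (hs : s ∈ Icc (h - σ) 0) : profile hσ h a b s = b s := by
  rcases hs.2.eq_or_lt with rfl | h2
  · rw [profile_eq_left hσ hh ⟨le_rfl, hh.1.le⟩, h0]
  · rw [← profile_periodic hσ h a b s]
    rcases hs.1.eq_or_lt with e | h3
    · rw [← e, sub_add_cancel, profile_eq_left hσ hh ⟨hh.1.le, le_rfl⟩, h1]
    · rw [profile_of_mem hσ ⟨by linarith [hh.1], by linarith⟩, if_neg (by linarith),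
        add_sub_cancel_right]

lemma exists_int_sub_mem (hσ : 0 < σ) (s : ℝ) : ∃ n : ℤ, s - n * σ ∈ Ico 0 σ := by
  refine ⟨toIcoDiv hσ 0 s, ?_⟩
  have := sub_toIcoDiv_zsmul_mem_Ico hσ 0 s
  simpa [zsmul_eq_mul] using this

lemma profile_sub_int (h : ℝ) (a b : ℝ → ℝ) (n : ℤ) (s : ℝ) :
    profile hσ h a b (s - n * σ) = profile hσ h a b s :=
  (profile_periodic hσ h a b).sub_int_mul_eq n

/-- A `C¹` family of pasted periodic functions. -/
lemma contDiffOn_profile {J : Set ℝ} (hJ : IsOpen J) {h : ℝ → ℝ} {a b a' b' : ℝ → ℝ → ℝ}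
    (ha : ContDiffOn ℝ 1 (fun q : ℝ × ℝ => a q.1 q.2) (J ×ˢ univ))
    (hb : ContDiffOn ℝ 1 (fun q : ℝ × ℝ => b q.1 q.2) (J ×ˢ univ))
    (hh : ContDiffOn ℝ 1 h J) (hmem : ∀ ε ∈ J, h ε ∈ Ioo 0 σ)
    (da : ∀ ε ∈ J, ∀ s ∈ Icc 0 (h ε), HasDerivAt (a ε) (a' ε s) s)
    (db : ∀ ε ∈ J, ∀ s ∈ Icc (h ε - σ) 0, HasDerivAt (b ε) (b' ε s) s)
    (h0 : ∀ ε ∈ J, a ε 0 = b ε 0 ∧ a' ε 0 = b' ε 0)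
    (h1 : ∀ ε ∈ J, a ε (h ε) = b ε (h ε - σ) ∧ a' ε (h ε) = b' ε (h ε - σ)) :
    ContDiffOn ℝ 1 (fun q : ℝ × ℝ => profile hσ (h q.1) (a q.1) (b q.1) q.2) (J ×ˢ univ) := by
  have hO : IsOpen (J ×ˢ (univ : Set ℝ)) := hJ.prod isOpen_univ
  have hshift : ∀ k : ℝ, ContDiff ℝ 1 fun q : ℝ × ℝ => (q.1, q.2 - k) := fun k => by fun_prop
  have hb' : ContDiffOn ℝ 1 (fun q : ℝ × ℝ => b q.1 (q.2 - σ)) (J ×ˢ univ) :=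
    hb.comp (hshift σ).contDiffOn fun q hq => ⟨hq.1, mem_univ _⟩
  have c0 := contDiffOn_paste hJ (T := fun _ => 0) hb ha contDiffOn_const
    (fun ε hε => (h0 ε hε).1.symm) (fun ε hε => ⟨a' ε 0,
      (h0 ε hε).2 ▸ db ε hε 0 ⟨by linarith [(hmem ε hε).2], le_rfl⟩,
      da ε hε 0 ⟨le_rfl, (hmem ε hε).1.le⟩⟩)
  have c1 := contDiffOn_paste hJ ha hb' hh
    (fun ε hε => (h1 ε hε).1) (fun ε hε => ⟨a' ε (h ε),
      da ε hε _ ⟨(hmem ε hε).1.le, le_rfl⟩, by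
        rw [(h1 ε hε).2]
        exact (db ε hε (h ε - σ) ⟨le_rfl, by linarith [(hmem ε hε).2]⟩).comp_sub_const (h ε) σ⟩)
  rintro ⟨ε, s⟩ hq
  obtain ⟨n, hn⟩ := exists_int_sub_mem hσ s
  have hε : ∀ᶠ q : ℝ × ℝ in 𝓝 (ε, s), q.1 ∈ J :=
    continuousAt_fst.eventually_mem (hJ.mem_nhds hq.1)
  have hs : ContinuousAt (fun q : ℝ × ℝ => q.2 - n * σ) (ε, s) := by fun_prop
  refine ContDiffAt.contDiffWithinAt ?_
  -- Reduced modulo `σ`, the point is either the junction at `0`, or lies in `(0, σ)` where the only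
  -- junction is at `h`.
  rcases hn.1.eq_or_lt with e | e
  · have hc : ContinuousAt (fun q : ℝ × ℝ => h q.1) (ε, s) :=
      (hh.continuousOn.continuousAt (hJ.mem_nhds hq.1)).comp continuousAt_fst
    refine ((c0.contDiffAt (hO.mem_nhds
      (show (ε, s - n * σ) ∈ J ×ˢ univ from ⟨hq.1, mem_univ _⟩))).comp (ε, s)
      (hshift (n * σ)).contDiffAt).congr_of_eventuallyEq ?_
    have l1 : ∀ᶠ q : ℝ × ℝ in 𝓝 (ε, s), q.2 - n * σ < h q.1 :=
      hs.eventually_lt hc (by simpa [← e] using (hmem ε hq.1).1)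
    have l2 : ∀ᶠ q : ℝ × ℝ in 𝓝 (ε, s), h q.1 - σ < q.2 - n * σ :=
      (hc.sub_const σ).eventually_lt hs (by simpa [← e] using (hmem ε hq.1).2)
    filter_upwards [hε, l1, l2] with q hq1 hq2 hq3
    simp only [Function.comp]
    rw [← profile_of_mem_Ioo hσ (hmem _ hq1) ⟨hq3, hq2⟩ (h0 _ hq1).1, profile_sub_int]
  · refine ((c1.contDiffAt (hO.mem_nhds
      (show (ε, s - n * σ) ∈ J ×ˢ univ from ⟨hq.1, mem_univ _⟩))).comp (ε, s)
      (hshift (n * σ)).contDiffAt).congr_of_eventuallyEq ?_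
    filter_upwards [hs.eventually_mem (isOpen_Ioo.mem_nhds ⟨e, hn.2⟩)] with q hq1
    simp only [Function.comp]
    rw [← profile_of_mem hσ (Ioo_subset_Ico_self hq1), profile_sub_int]

lemma hasDerivAt_profile {h : ℝ} {a b a' b' : ℝ → ℝ} (hh : h ∈ Ioo 0 σ)
    (da : ∀ s ∈ Icc 0 h, HasDerivAt a (a' s) s)
    (db : ∀ s ∈ Icc (h - σ) 0, HasDerivAt b (b' s) s)
    (h0 : a 0 = b 0 ∧ a' 0 = b' 0) (h1 : a h = b (h - σ) ∧ a' h = b' (h - σ)) (s : ℝ) :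
    HasDerivAt (profile hσ h a b) (profile hσ h a' b' s) s := by
  obtain ⟨n, hn⟩ := exists_int_sub_mem hσ s
  suffices H : HasDerivAt (profile hσ h a b) (profile hσ h a' b' (s - n * σ)) (s - n * σ) by
    have := H.comp_sub_const s (n * σ)
    rw [profile_sub_int] at this
    refine this.congr_of_eventuallyEq (Filter.Eventually.of_forall fun y => ?_)
    exact (profile_sub_int hσ h a b n y).symm
  generalize s - n * σ = r at hn
  rcases hn.1.eq_or_lt with rfl | e
  · have hm : (0 : ℝ) ∈ Ioo (h - σ) h := ⟨by linarith [hh.2], hh.1⟩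
    rw [profile_of_mem_Ioo hσ hh hm h0.2]
    refine (hasDerivAt_ite_le (fun _ => db 0 ⟨hm.1.le, le_rfl⟩) (fun _ => da 0 ⟨le_rfl, hm.2.le⟩)
      ⟨h0.1.symm, h0.2.symm⟩).congr_of_eventuallyEq ?_
    filter_upwards [isOpen_Ioo.mem_nhds hm] with y hy
    exact profile_of_mem_Ioo hσ hh hy h0.1
  · rw [profile_of_mem hσ hn]
    refine (hasDerivAt_ite_le (b := fun s => b (s - σ)) (b' := fun s => b' (s - σ))
      (fun hr => da r ⟨hn.1, hr⟩) (fun hr => (db (r - σ) ⟨by linarith, by linarith [hn.2]⟩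
        ).comp_sub_const r σ) h1).congr_of_eventuallyEq ?_
    filter_upwards [isOpen_Ioo.mem_nhds ⟨e, hn.2⟩] with y hy
    exact profile_of_mem hσ (Ioo_subset_Ico_self hy)

end Profile

/-! ### Regularity and uniqueness of Filippov solutions -/

section Regularity

variable {α η ε : ℝ} {f : ℝ × ℝ × ℝ → ℝ} {x : ℝ → ℝ}

lemma absolutelyContinuousOnInterval_comp {X Y : Type*} [PseudoMetricSpace X]
    [PseudoMetricSpace Y] {g : X → Y} (hg : ∀ p q, dist (g p) (g q) ≤ dist p q) {z : ℝ → X}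
    {a b : ℝ} (hz : AbsolutelyContinuousOnInterval z a b) :
    AbsolutelyContinuousOnInterval (fun t => g (z t)) a b := by
  unfold AbsolutelyContinuousOnInterval at hz ⊢
  exact squeeze_zero (fun E => Finset.sum_nonneg fun i _ => dist_nonneg)
    (fun E => Finset.sum_le_sum fun i _ => hg _ _) hz

lemma IsSolution.absolutelyContinuous_fst (hx : IsSolution α η ε f x) (a b : ℝ) :
    AbsolutelyContinuousOnInterval x a b :=
  absolutelyContinuousOnInterval_comp (g := Prod.fst) (fun _ _ => le_max_left _ _)
    (hx.absolutelyContinuous a b)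

lemma IsSolution.absolutelyContinuous_deriv (hx : IsSolution α η ε f x) (a b : ℝ) :
    AbsolutelyContinuousOnInterval (deriv x) a b :=
  absolutelyContinuousOnInterval_comp (g := Prod.snd) (fun _ _ => le_max_right _ _)
    (hx.absolutelyContinuous a b)

lemma IsSolution.continuous_deriv (hx : IsSolution α η ε f x) : Continuous (deriv x) := by
  refine continuous_iff_continuousAt.2 fun t => ?_
  refine (hx.absolutelyContinuous_deriv (t - 1) (t + 1)).continuousOn.continuousAt ?_
  rw [uIcc_of_le (by linarith)]
  exact Icc_mem_nhds (by linarith) (by linarith)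

/-- An absolutely continuous function is the integral of its derivative, and here this derivative is
continuous. So differentiability holds at every time, not just almost everywhere. -/
lemma IsSolution.hasDerivAt (hx : IsSolution α η ε f x) (t : ℝ) :
    HasDerivAt x (deriv x t) t := by
  have h1 : x = fun t => (∫ r in (0 : ℝ)..t, deriv x r) + x 0 := funext fun t => by
    rw [(hx.absolutelyContinuous_fst 0 t).integral_deriv_eq_sub, sub_add_cancel]
  have h2 := ((hx.continuous_deriv.integral_hasStrictDerivAt 0 t).hasDerivAt).add_const (x 0)
  rw [← h1] at h2
  exact h2

lemma IsSolution.continuous (hx : IsSolution α η ε f x) : Continuous x :=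
  continuous_iff_continuousAt.2 fun t => (hx.hasDerivAt t).continuousAt

/-- The smooth field with parameter `c` governs the solution `x` on `(a, b)`. -/
def OnSide (α c a b : ℝ) (x : ℝ → ℝ) : Prop :=
  (c = α ∧ ∀ t ∈ Ioo a b, 0 < x t) ∨ (c = -α ∧ ∀ t ∈ Ioo a b, x t < 0)

lemma OnSide.filippovSet_eq {c a b t : ℝ} (h : OnSide α c a b x) (ht : t ∈ Ioo a b) (y : ℝ) :
    filippovSet α η ε f t (x t, y) = {smoothField c η ε f t (x t, y)} := by
  rcases h with ⟨rfl, h⟩ | ⟨rfl, h⟩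
  · simp [filippovSet, h t ht]
  · simp [filippovSet, h t ht, (h t ht).le.not_gt]

/-- On a side the Filippov set is a single point, so `deriv x` is the integral of a continuous
function there. The end points, where `x` may vanish, are included. -/
lemma IsSolution.hasDerivWithinAt_deriv (hx : IsSolution α η ε f x) (hf : Continuous f)
    {c a b : ℝ} (hc : OnSide α c a b x) {t : ℝ} (ht : t ∈ Icc a b) :
    HasDerivWithinAt (deriv x) (η * x t - c + ε * f (t, x t, deriv x t)) (Icc a b) t := by
  have hx' := hx.continuous
  have hy' := hx.continuous_deriv
  have hg : Continuous fun t => η * x t - c + ε * f (t, x t, deriv x t) := by fun_prop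
  have key : ∀ r ∈ Icc a b, deriv x r =
      (∫ r in a..r, (η * x r - c + ε * f (r, x r, deriv x r))) + deriv x a := by
    intro r hr
    rw [← sub_eq_iff_eq_add, ← (hx.absolutelyContinuous_deriv a r).integral_deriv_eq_sub]
    refine intervalIntegral.integral_congr_ae ?_
    have hb : ∀ᵐ r : ℝ, r ≠ b := by simp [ae_iff, measure_singleton]
    filter_upwards [hx.velocity_mem, hb] with q hq hqb hqr
    rw [uIoc_of_le hr.1] at hqr
    have hqm : q ∈ Ioo a b := ⟨hqr.1, lt_of_le_of_ne (hqr.2.trans hr.2) hqb⟩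
    obtain ⟨w, hw, hd⟩ := hq
    rw [hc.filippovSet_eq hqm, mem_singleton_iff] at hw
    rw [(hasDerivAt_snd hd).deriv, hw, smoothField]
  exact ((((hg.integral_hasStrictDerivAt a t).hasDerivAt).add_const (deriv x a)).hasDerivWithinAt
    ).congr key (key t ht)

/-- A `C¹` function of time and state is Lipschitz on a compact convex product, with a constant that
does not depend on the time. -/
lemma exists_lipschitzOnWith_smoothField (c η ε : ℝ) (hf : ContDiff ℝ 1 f) (a b R : ℝ) :
    ∃ K, ∀ t ∈ Icc a b, LipschitzOnWith K (smoothField c η ε f t) (Metric.closedBall 0 R) := by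
  have hs : ContDiff ℝ 1 fun q : ℝ × ℝ × ℝ => smoothField c η ε f q.1 q.2 := by
    unfold smoothField; fun_prop
  obtain ⟨K, hK⟩ := hs.contDiffOn.exists_lipschitzOnWith one_ne_zero
    ((convex_Icc a b).prod (convex_closedBall (0 : ℝ × ℝ) R))
    (isCompact_Icc.prod (isCompact_closedBall (0 : ℝ × ℝ) R))
  refine ⟨K, fun t ht p hp q hq => ?_⟩
  have := hK (x := (t, p)) ⟨ht, hp⟩ (y := (t, q)) ⟨ht, hq⟩
  simpa [Prod.edist_eq] using this

/-- On an interval on which it has a sign, a solution agrees with any solution of the smooth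
equation of that side with the same data at an end point. -/
lemma IsSolution.eqOn_of_onSide (hx : IsSolution α η ε f x) (hf : ContDiff ℝ 1 f)
    {c a b : ℝ} (hc : OnSide α c a b x) {u w : ℝ → ℝ}
    (hu : ∀ t ∈ Icc a b, HasDerivAt u (w t) t)
    (hw : ∀ t ∈ Icc a b, HasDerivAt w (η * u t - c + ε * f (t, u t, w t)) t)
    (h0 : (x a = u a ∧ deriv x a = w a) ∨ (x b = u b ∧ deriv x b = w b)) :
    ∀ t ∈ Icc a b, x t = u t ∧ deriv x t = w t := by
  let z : ℝ → ℝ × ℝ := fun t => (x t, deriv x t)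
  let z' : ℝ → ℝ × ℝ := fun t => (u t, w t)
  have hz : ∀ t ∈ Icc a b, HasDerivWithinAt z (smoothField c η ε f t (z t)) (Icc a b) t :=
    fun t ht => (hx.hasDerivAt t).hasDerivWithinAt.prodMk
      (hx.hasDerivWithinAt_deriv hf.continuous hc ht)
  have hz' : ∀ t ∈ Icc a b, HasDerivWithinAt z' (smoothField c η ε f t (z' t)) (Icc a b) t :=
    fun t ht => ((hu t ht).prodMk (hw t ht)).hasDerivWithinAt
  have cz : ContinuousOn z (Icc a b) := fun t ht => (hz t ht).continuousWithinAt
  have cz' : ContinuousOn z' (Icc a b) := fun t ht => (hz' t ht).continuousWithinAt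
  obtain ⟨R, hR⟩ := isCompact_Icc.exists_bound_of_continuousOn cz
  obtain ⟨R', hR'⟩ := isCompact_Icc.exists_bound_of_continuousOn cz'
  obtain ⟨K, hK⟩ := exists_lipschitzOnWith_smoothField c η ε hf a b (max R R')
  have hb : ∀ t ∈ Icc a b, z t ∈ Metric.closedBall 0 (max R R') := fun t ht =>
    mem_closedBall_zero_iff.2 ((hR t ht).trans (le_max_left _ _))
  have hb' : ∀ t ∈ Icc a b, z' t ∈ Metric.closedBall 0 (max R R') := fun t ht =>
    mem_closedBall_zero_iff.2 ((hR' t ht).trans (le_max_right _ _))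
  suffices h : EqOn z z' (Icc a b) from fun t ht => Prod.ext_iff.1 (h ht)
  rcases h0 with h0 | h0
  · have hn : ∀ t ∈ Ico a b, Icc a b ∈ 𝓝[≥] t := fun t ht => Icc_mem_nhdsGE_of_mem ht
    exact ODE_solution_unique_of_mem_Icc_right (fun t ht => hK t (Ico_subset_Icc_self ht)) cz
      (fun t ht => (hz t (Ico_subset_Icc_self ht)).mono_of_mem_nhdsWithin (hn t ht))
      (fun t ht => hb t (Ico_subset_Icc_self ht)) cz'
      (fun t ht => (hz' t (Ico_subset_Icc_self ht)).mono_of_mem_nhdsWithin (hn t ht))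
      (fun t ht => hb' t (Ico_subset_Icc_self ht)) (Prod.ext h0.1 h0.2)
  · have hn : ∀ t ∈ Ioc a b, Icc a b ∈ 𝓝[≤] t := fun t ht => Icc_mem_nhdsLE_of_mem ht
    exact ODE_solution_unique_of_mem_Icc_left (fun t ht => hK t (Ioc_subset_Icc_self ht)) cz
      (fun t ht => (hz t (Ioc_subset_Icc_self ht)).mono_of_mem_nhdsWithin (hn t ht))
      (fun t ht => hb t (Ioc_subset_Icc_self ht)) cz'
      (fun t ht => (hz' t (Ioc_subset_Icc_self ht)).mono_of_mem_nhdsWithin (hn t ht))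
      (fun t ht => hb' t (Ioc_subset_Icc_self ht)) (Prod.ext h0.1 h0.2)

/-- While it has a sign, a solution which leaves `x = 0` follows the local flow of that side. -/
lemma IsSolution.eq_localFlow (hx : IsSolution α η ε f x) (hf : ContDiff ℝ 1 f) {c T : ℝ}
    {p₀ : ℝ × ℝ × ℝ} (L : LocalFlow c η T f p₀) {t₁ a b : ℝ}
    (h0 : a = 0 ∨ b = 0) (haT : -T < a) (hbT : b < T)
    (hc : OnSide α c (t₁ + a) (t₁ + b) x) (hx0 : x t₁ = 0)
    (hp : (ε, t₁, deriv x t₁) ∈ L.N) {s : ℝ} (hs : s ∈ Icc a b) :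
    x (t₁ + s) = L.X (ε, t₁, deriv x t₁) s ∧ deriv x (t₁ + s) = L.Y (ε, t₁, deriv x t₁) s := by
  have hmem : ∀ t ∈ Icc (t₁ + a) (t₁ + b), t - t₁ ∈ Ioo (-T) T := fun t ht =>
    ⟨by linarith [ht.1], by linarith [ht.2]⟩
  have h1 : x t₁ = L.X (ε, t₁, deriv x t₁) (t₁ - t₁) ∧
      deriv x t₁ = L.Y (ε, t₁, deriv x t₁) (t₁ - t₁) := by simp [hx0]
  have := hx.eqOn_of_onSide hf hc
    (u := fun t => L.X (ε, t₁, deriv x t₁) (t - t₁))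
    (w := fun t => L.Y (ε, t₁, deriv x t₁) (t - t₁))
    (fun t ht => (L.hasDerivAt_X hp (hmem t ht)).comp_sub_const t t₁)
    (fun t ht => by
      have := (L.hasDerivAt_Y hp (hmem t ht)).comp_sub_const t t₁
      simpa only [add_sub_cancel] using this)
    (by
      rcases h0 with rfl | rfl
      · left; simpa only [add_zero] using h1
      · right; simpa only [add_zero] using h1)
    (t₁ + s) ⟨by linarith [hs.1], by linarith [hs.2]⟩
  simpa only [add_sub_cancel_left] using this

end Regularity

/-! ### Periodic solutions from two half orbits -/

/-- A pair of solutions of the smooth equations of the two sides, on `[0, h]` and `[h - σ, 0]`,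
which together form a `σ`-periodic solution that crosses `x = 0` at the times `t₁` and `t₁ + h`. -/
structure HalfOrbits (α η ε σ : ℝ) (f : ℝ × ℝ × ℝ → ℝ) (t₁ h : ℝ) (xp yp xm ym : ℝ → ℝ) :
    Prop where
  mem : h ∈ Ioo 0 σ
  hasDerivAt_xp : ∀ s ∈ Icc 0 h, HasDerivAt xp (yp s) s
  hasDerivAt_yp : ∀ s ∈ Icc 0 h,
    HasDerivAt yp (η * xp s - α + ε * f (t₁ + s, xp s, yp s)) s
  hasDerivAt_xm : ∀ s ∈ Icc (h - σ) 0, HasDerivAt xm (ym s) s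
  hasDerivAt_ym : ∀ s ∈ Icc (h - σ) 0,
    HasDerivAt ym (η * xm s - -α + ε * f (t₁ + s, xm s, ym s)) s
  xp_zero : xp 0 = 0
  xm_zero : xm 0 = 0
  xp_end : xp h = 0
  xm_end : xm (h - σ) = 0
  y_zero : yp 0 = ym 0
  y_end : yp h = ym (h - σ)
  xp_pos : ∀ s ∈ Ioo 0 h, 0 < xp s
  xm_neg : ∀ s ∈ Ioo (h - σ) 0, xm s < 0

section Construction

variable {σ : ℝ} (hσ : 0 < σ)

/-- The local normal forms of a pasted function: inside one of the pieces, or at one of the two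
kinds of junction. -/
lemma profile_eventuallyEq {h : ℝ} {a b : ℝ → ℝ} (hh : h ∈ Ioo 0 σ) (hab : a 0 = b 0) (s : ℝ) :
    ∃ n : ℤ,
      (s - n * σ ∈ Ioo 0 h ∧ profile hσ h a b =ᶠ[𝓝 s] fun y => a (y - n * σ)) ∨
      (s - n * σ ∈ Ioo (h - σ) 0 ∧ profile hσ h a b =ᶠ[𝓝 s] fun y => b (y - n * σ)) ∨
      (s = n * σ ∧ profile hσ h a b =ᶠ[𝓝 s]
        fun y => if y ≤ s then b (y - n * σ) else a (y - n * σ)) ∨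
      (s = n * σ + h ∧ profile hσ h a b =ᶠ[𝓝 s]
        fun y => if y ≤ s then a (y - n * σ) else b (y - (n + 1 : ℤ) * σ)) := by
  obtain ⟨n, hn⟩ := exists_int_sub_mem hσ s
  have hc : ContinuousAt (fun y : ℝ => y - n * σ) s := by fun_prop
  rcases hn.1.eq_or_lt with e | e
  · refine ⟨n, Or.inr (Or.inr (Or.inl ⟨by linarith, ?_⟩))⟩
    have hm : s - n * σ ∈ Ioo (h - σ) h := ⟨by linarith [hh.2], by linarith [hh.1]⟩
    filter_upwards [hc.eventually_mem (isOpen_Ioo.mem_nhds hm)] with y hy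
    rw [← profile_sub_int hσ h a b n, profile_of_mem_Ioo hσ hh hy hab]
    exact if_congr (by constructor <;> intro <;> linarith) rfl rfl
  · have hev : ∀ᶠ y in 𝓝 s, y - n * σ ∈ Ioo 0 σ :=
      hc.eventually_mem (isOpen_Ioo.mem_nhds ⟨e, hn.2⟩)
    rcases lt_trichotomy (s - n * σ) h with h1 | h1 | h1
    · refine ⟨n, Or.inl ⟨⟨e, h1⟩, ?_⟩⟩
      filter_upwards [hev, hc.eventually_mem (isOpen_Iio.mem_nhds h1)] with y hy hy'
      rw [← profile_sub_int hσ h a b n, profile_of_mem hσ (Ioo_subset_Ico_self hy),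
        if_pos (le_of_lt hy')]
    · refine ⟨n, Or.inr (Or.inr (Or.inr ⟨by linarith, ?_⟩))⟩
      filter_upwards [hev] with y hy
      rw [← profile_sub_int hσ h a b n, profile_of_mem hσ (Ioo_subset_Ico_self hy)]
      refine if_congr (by constructor <;> intro <;> linarith) rfl ?_
      congr 1; push_cast; ring
    · refine ⟨n + 1, Or.inr (Or.inl ⟨⟨?_, ?_⟩, ?_⟩)⟩
      · push_cast; linarith
      · push_cast; linarith [hn.2]
      · filter_upwards [hev, hc.eventually_mem (isOpen_Ioi.mem_nhds h1)] with y hy hy'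
        rw [← profile_sub_int hσ h a b n, profile_of_mem hσ (Ioo_subset_Ico_self hy),
          if_neg (not_le.2 hy')]
        congr 1; push_cast; ring

/-- Here the slopes of the pieces need not match, as is the case for the velocity, whose derivative
jumps on `x = 0`. One-sided derivatives exist everywhere and are enough for the mean value
inequality. -/
lemma hasDerivWithinAt_profile {h : ℝ} {a b a' b' : ℝ → ℝ} (hh : h ∈ Ioo 0 σ)
    (da : ∀ s ∈ Icc 0 h, HasDerivAt a (a' s) s)
    (db : ∀ s ∈ Icc (h - σ) 0, HasDerivAt b (b' s) s)
    (h0 : a 0 = b 0) (h1 : a h = b (h - σ)) (s : ℝ) :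
    ContinuousAt (profile hσ h a b) s ∧ ∃ d,
      HasDerivWithinAt (profile hσ h a b) d (Ici s) s ∧
        ((∃ r ∈ Icc 0 h, d = a' r) ∨ ∃ r ∈ Icc (h - σ) 0, d = b' r) := by
  have i0 : (0 : ℝ) ∈ Icc 0 h := ⟨le_rfl, hh.1.le⟩
  have i0' : (0 : ℝ) ∈ Icc (h - σ) 0 := ⟨by linarith [hh.2], le_rfl⟩
  have i1 : h ∈ Icc 0 h := ⟨hh.1.le, le_rfl⟩
  have i1' : h - σ ∈ Icc (h - σ) 0 := ⟨le_rfl, by linarith [hh.2]⟩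
  obtain ⟨n, ⟨hm, ev⟩ | ⟨hm, ev⟩ | ⟨hm, ev⟩ | ⟨hm, ev⟩⟩ := profile_eventuallyEq hσ hh h0 s
  · have hd := ((da _ (Ioo_subset_Icc_self hm)).comp_sub_const s (n * σ)).congr_of_eventuallyEq ev
    exact ⟨hd.continuousAt, _, hd.hasDerivWithinAt,
      Or.inl ⟨_, Ioo_subset_Icc_self hm, rfl⟩⟩
  · have hd := ((db _ (Ioo_subset_Icc_self hm)).comp_sub_const s (n * σ)).congr_of_eventuallyEq ev
    exact ⟨hd.continuousAt, _, hd.hasDerivWithinAt,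
      Or.inr ⟨_, Ioo_subset_Icc_self hm, rfl⟩⟩
  · have e : s - n * σ = 0 := by linarith
    have h2 := (e ▸ da 0 i0 : HasDerivAt a (a' 0) (s - n * σ)).comp_sub_const s (n * σ)
    have h3 := (e ▸ db 0 i0' : HasDerivAt b (b' 0) (s - n * σ)).comp_sub_const s (n * σ)
    have hs : profile hσ h a b s = a (s - n * σ) := by
      rw [ev.self_of_nhds]
      simp [e, h0]
    refine ⟨(continuousAt_ite h3.continuousAt h2.continuousAt
      (Or.inr (Or.inr (by rw [e, h0])))).congr ev.symm, a' 0,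
      h2.hasDerivWithinAt.congr_of_eventuallyEq ?_ hs, Or.inl ⟨0, i0, rfl⟩⟩
    filter_upwards [ev.filter_mono nhdsWithin_le_nhds, self_mem_nhdsWithin] with y hy hy'
    rcases (mem_Ici.1 hy').eq_or_lt with rfl | hlt
    · exact hs
    · rw [hy, if_neg (not_le.2 hlt)]
  · have e : s - n * σ = h := by linarith
    have e' : s - (n + 1 : ℤ) * σ = h - σ := by push_cast; linarith
    have h2 := (e ▸ da h i1 : HasDerivAt a (a' h) (s - n * σ)).comp_sub_const s (n * σ)
    have h3 := (e' ▸ db (h - σ) i1' : HasDerivAt b (b' (h - σ)) (s - (n + 1 : ℤ) * σ)).comp_sub_const s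
      ((n + 1 : ℤ) * σ)
    have hs : profile hσ h a b s = b (s - (n + 1 : ℤ) * σ) := by
      rw [ev.self_of_nhds]
      simp only [le_refl, if_true, e, e', h1]
    refine ⟨(continuousAt_ite h2.continuousAt h3.continuousAt
      (Or.inr (Or.inr (by rw [e, e', h1])))).congr ev.symm, b' (h - σ),
      h3.hasDerivWithinAt.congr_of_eventuallyEq ?_ hs, Or.inr ⟨_, i1', rfl⟩⟩
    filter_upwards [ev.filter_mono nhdsWithin_le_nhds, self_mem_nhdsWithin] with y hy hy'
    rcases (mem_Ici.1 hy').eq_or_lt with rfl | hlt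
    · exact hs
    · rw [hy, if_neg (not_le.2 hlt)]

/-- A periodic function pasted from two `C¹` pieces is Lipschitz. -/
lemma exists_lipschitzWith_profile {h : ℝ} {a b a' b' : ℝ → ℝ} (hh : h ∈ Ioo 0 σ)
    (da : ∀ s ∈ Icc 0 h, HasDerivAt a (a' s) s)
    (db : ∀ s ∈ Icc (h - σ) 0, HasDerivAt b (b' s) s)
    (ca : ContinuousOn a' (Icc 0 h)) (cb : ContinuousOn b' (Icc (h - σ) 0))
    (h0 : a 0 = b 0) (h1 : a h = b (h - σ)) :
    ∃ K, LipschitzWith K (profile hσ h a b) := by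
  obtain ⟨A, hA⟩ := isCompact_Icc.exists_bound_of_continuousOn ca
  obtain ⟨B, hB⟩ := isCompact_Icc.exists_bound_of_continuousOn cb
  choose hc d hd hd' using hasDerivWithinAt_profile hσ hh da db h0 h1
  have hbd : ∀ s, ‖d s‖ ≤ max A B := fun s => by
    rcases hd' s with ⟨r, hr, e⟩ | ⟨r, hr, e⟩
    · rw [e]; exact (hA r hr).trans (le_max_left _ _)
    · rw [e]; exact (hB r hr).trans (le_max_right _ _)
  have key : ∀ s t, s ≤ t →
      ‖profile hσ h a b t - profile hσ h a b s‖ ≤ max A B * (t - s) := fun s t hst =>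
    norm_image_sub_le_of_norm_deriv_right_le_segment (a := s) (b := t)
      (fun y _ => (hc y).continuousWithinAt) (fun y _ => hd y) (fun y _ => hbd y) t ⟨hst, le_rfl⟩
  refine ⟨(max A B).toNNReal, LipschitzWith.of_dist_le_mul fun s t => ?_⟩
  rw [Real.coe_toNNReal _ ((norm_nonneg _).trans (hbd 0))]
  rcases le_total s t with hst | hst
  · rw [dist_comm, dist_comm s t, dist_eq_norm, Real.dist_eq, abs_of_nonneg (sub_nonneg.2 hst)]
    exact key s t hst
  · rw [dist_eq_norm, Real.dist_eq, abs_of_nonneg (sub_nonneg.2 hst)]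
    exact key t s hst

variable {α η ε t₁ h : ℝ} {f : ℝ × ℝ × ℝ → ℝ} {xp yp xm ym : ℝ → ℝ}

lemma HalfOrbits.hasDerivAt_profile (H : HalfOrbits α η ε σ f t₁ h xp yp xm ym) (t : ℝ) :
    HasDerivAt (fun t => profile hσ h xp xm (t - t₁)) (profile hσ h yp ym (t - t₁)) t :=
  (DiscontinuousOscillator.hasDerivAt_profile hσ H.mem H.hasDerivAt_xp H.hasDerivAt_xm
    ⟨H.xp_zero.trans H.xm_zero.symm, H.y_zero⟩ ⟨H.xp_end.trans H.xm_end.symm, H.y_end⟩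
    (t - t₁)).comp_sub_const t t₁

lemma HalfOrbits.deriv_profile (H : HalfOrbits α η ε σ f t₁ h xp yp xm ym) :
    deriv (fun t => profile hσ h xp xm (t - t₁)) = fun t => profile hσ h yp ym (t - t₁) :=
  funext fun t => (H.hasDerivAt_profile hσ t).deriv

/-- Two matching half orbits form a periodic Filippov solution. -/
lemma HalfOrbits.isPeriodicSolution (H : HalfOrbits α η ε σ f t₁ h xp yp xm ym)
    (hf : Continuous f) (hper : ∀ t x y : ℝ, f (t + σ, x, y) = f (t, x, y)) :
    IsPeriodicSolution α η ε σ f (fun t => profile hσ h xp xm (t - t₁)) := by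
  have cxp : ContinuousOn xp (Icc 0 h) := fun s hs =>
    (H.hasDerivAt_xp s hs).continuousAt.continuousWithinAt
  have cyp : ContinuousOn yp (Icc 0 h) := fun s hs =>
    (H.hasDerivAt_yp s hs).continuousAt.continuousWithinAt
  have cxm : ContinuousOn xm (Icc (h - σ) 0) := fun s hs =>
    (H.hasDerivAt_xm s hs).continuousAt.continuousWithinAt
  have cym : ContinuousOn ym (Icc (h - σ) 0) := fun s hs =>
    (H.hasDerivAt_ym s hs).continuousAt.continuousWithinAt
  have hx0 := H.xp_zero.trans H.xm_zero.symm
  have hx1 := H.xp_end.trans H.xm_end.symm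
  obtain ⟨K, hK⟩ := exists_lipschitzWith_profile hσ H.mem H.hasDerivAt_xp H.hasDerivAt_xm cyp cym
    hx0 hx1
  obtain ⟨K', hK'⟩ := exists_lipschitzWith_profile hσ H.mem H.hasDerivAt_yp H.hasDerivAt_ym
    (by fun_prop) (by fun_prop) H.y_zero H.y_end
  have hshift : LipschitzWith 1 fun t : ℝ => t - t₁ :=
    LipschitzWith.of_dist_le_mul fun s t => by simp
  have hper' : ∀ (n : ℤ) (t x y : ℝ), f (t - n * σ, x, y) = f (t, x, y) := fun n t x y =>
    Function.Periodic.sub_int_mul_eq (f := fun t => f (t, x, y)) (fun t => hper t x y) n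
  refine ⟨⟨fun a b => ?_, ?_⟩, fun t => ?_⟩
  · rw [H.deriv_profile hσ]
    exact ((hK.comp hshift).prodMk (hK'.comp hshift)).lipschitzOnWith.absolutelyContinuousOnInterval
  · have hcount : (range (fun n : ℤ => n * σ + t₁) ∪ range fun n : ℤ => n * σ + h + t₁).Countable :=
      (countable_range _).union (countable_range _)
    filter_upwards [hcount.ae_notMem volume] with t ht
    rw [H.deriv_profile hσ]
    have hmem : ∀ w, HasDerivAt (fun t => profile hσ h yp ym (t - t₁)) w t →
        HasDerivAt (fun t => (profile hσ h xp xm (t - t₁), profile hσ h yp ym (t - t₁)))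
          (profile hσ h yp ym (t - t₁), w) t := fun w hw => (H.hasDerivAt_profile hσ t).prodMk hw
    obtain ⟨n, ⟨hm, ev⟩ | ⟨hm, ev⟩ | ⟨hm, -⟩ | ⟨hm, -⟩⟩ :=
      profile_eventuallyEq hσ H.mem H.y_zero (t - t₁)
    · have hi := Ioo_subset_Icc_self hm
      have hx : profile hσ h xp xm (t - t₁) = xp (t - t₁ - n * σ) := by
        rw [← profile_sub_int hσ h xp xm n, profile_eq_left hσ H.mem hi]
      have hd := ((H.hasDerivAt_yp _ hi).comp_sub_const (t - t₁) (n * σ)).congr_of_eventuallyEq ev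
      refine ⟨_, ?_, hmem _ (hd.comp_sub_const t t₁)⟩
      have hy : profile hσ h yp ym (t - t₁) = yp (t - t₁ - n * σ) := ev.self_of_nhds
      rw [filippovSet, if_pos (by simpa only [hx] using H.xp_pos _ hm), mem_singleton_iff]
      simp only [smoothField, hx, hy]
      rw [show t₁ + (t - t₁ - n * σ) = t - n * σ by ring, hper']
    · have hi := Ioo_subset_Icc_self hm
      have hx : profile hσ h xp xm (t - t₁) = xm (t - t₁ - n * σ) := by
        rw [← profile_sub_int hσ h xp xm n, profile_eq_right hσ H.mem hx0 hx1 hi]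
      have hd := ((H.hasDerivAt_ym _ hi).comp_sub_const (t - t₁) (n * σ)).congr_of_eventuallyEq ev
      have hneg := H.xm_neg _ hm
      rw [← hx] at hneg
      refine ⟨_, ?_, hmem _ (hd.comp_sub_const t t₁)⟩
      have hy : profile hσ h yp ym (t - t₁) = ym (t - t₁ - n * σ) := ev.self_of_nhds
      rw [filippovSet, if_neg hneg.not_gt, if_pos hneg, mem_singleton_iff]
      simp only [smoothField, hx, hy]
      rw [show t₁ + (t - t₁ - n * σ) = t - n * σ by ring, hper']
    · exact absurd (Or.inl ⟨n, by dsimp only; linarith⟩) ht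
    · exact absurd (Or.inr ⟨n, by dsimp only; linarith⟩) ht
  · dsimp only
    rw [add_sub_right_comm, profile_periodic]

/-- A periodic function is determined by two pieces which cover a period. -/
lemma eq_profile {z : ℝ → ℝ} (hz : Function.Periodic z σ) {t₁ h : ℝ}
    {a b : ℝ → ℝ} (ha : ∀ s ∈ Icc 0 h, z (t₁ + s) = a s)
    (hb : ∀ s ∈ Icc (h - σ) 0, z (t₁ + s) = b s) (t : ℝ) :
    z t = profile hσ h a b (t - t₁) := by
  obtain ⟨n, hn⟩ := exists_int_sub_mem hσ (t - t₁)
  rw [← profile_sub_int hσ h a b n, ← hz.sub_int_mul_eq n, profile_of_mem hσ hn]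
  have e : t - n * σ = t₁ + (t - t₁ - n * σ) := by ring
  split_ifs with h1
  · rw [e]; exact ha _ ⟨hn.1, h1⟩
  · rw [← hb _ ⟨by linarith, by linarith [hn.2]⟩, e, ← hz.sub_eq]
    congr 1; ring

end Construction

/-! ### Location of the zeros -/

/-- Near `l` the function increases away from its zero, near `r` it decreases to its zero, and it is
positive in between. These conditions survive `C¹`-small perturbations, although positivity up to
the zeros is not itself an open condition. -/
lemma pos_of_zeros {x y : ℝ → ℝ} {l r κ t₁ t₂ : ℝ}
    (hd : ∀ t ∈ Icc (l - κ) (r + κ), HasDerivAt x (y t) t)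
    (hlr : l + κ ≤ r - κ)
    (h1 : ∀ t ∈ Icc (l - κ) (l + κ), 0 < y t) (h2 : ∀ t ∈ Icc (l + κ) (r - κ), 0 < x t)
    (h3 : ∀ t ∈ Icc (r - κ) (r + κ), y t < 0) (m1 : t₁ ∈ Icc (l - κ) (l + κ)) (x1 : x t₁ = 0)
    (m2 : t₂ ∈ Icc (r - κ) (r + κ)) (x2 : x t₂ = 0) : ∀ t ∈ Ioo t₁ t₂, 0 < x t := by
  have hκ : 0 ≤ κ := by linarith [m1.1, m1.2]
  intro t ht
  rcases le_or_gt t (l + κ) with h | h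
  · have hm : StrictMonoOn x (Icc (l - κ) (l + κ)) := by
      refine strictMonoOn_of_deriv_pos (convex_Icc _ _) (fun s hs =>
        (hd s ⟨hs.1, by linarith [hs.2]⟩).continuousAt.continuousWithinAt) fun s hs => ?_
      rw [interior_Icc] at hs
      rw [(hd s ⟨hs.1.le, by linarith [hs.2]⟩).deriv]
      exact h1 s (Ioo_subset_Icc_self hs)
    rw [← x1]
    exact hm m1 ⟨by linarith [m1.1, ht.1], h⟩ ht.1
  rcases le_or_gt (r - κ) t with h' | h'
  · have hm : StrictAntiOn x (Icc (r - κ) (r + κ)) := by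
      refine strictAntiOn_of_deriv_neg (convex_Icc _ _) (fun s hs =>
        (hd s ⟨by linarith [hs.1], hs.2⟩).continuousAt.continuousWithinAt) fun s hs => ?_
      rw [interior_Icc] at hs
      rw [(hd s ⟨by linarith [hs.1], hs.2.le⟩).deriv]
      exact h3 s (Ioo_subset_Icc_self hs)
    rw [← x2]
    exact hm ⟨h', by linarith [m2.2, ht.2]⟩ m2 ht.2
  · exact h2 t ⟨h.le, h'.le⟩

lemma neg_of_zeros {x y : ℝ → ℝ} {l r κ t₁ t₂ : ℝ}
    (hd : ∀ t ∈ Icc (l - κ) (r + κ), HasDerivAt x (y t) t)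
    (hlr : l + κ ≤ r - κ)
    (h1 : ∀ t ∈ Icc (l - κ) (l + κ), y t < 0) (h2 : ∀ t ∈ Icc (l + κ) (r - κ), x t < 0)
    (h3 : ∀ t ∈ Icc (r - κ) (r + κ), 0 < y t) (m1 : t₁ ∈ Icc (l - κ) (l + κ)) (x1 : x t₁ = 0)
    (m2 : t₂ ∈ Icc (r - κ) (r + κ)) (x2 : x t₂ = 0) : ∀ t ∈ Ioo t₁ t₂, x t < 0 := fun t ht => by
  have := pos_of_zeros (x := fun t => -x t) (y := fun t => -y t) (fun t ht => (hd t ht).neg) hlr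
    (fun t ht => neg_pos.2 (h1 t ht)) (fun t ht => neg_pos.2 (h2 t ht))
    (fun t ht => neg_neg_of_pos (h3 t ht)) m1 (by simp [x1]) m2 (by simp [x2]) t ht
  linarith

lemma exists_forall_Icc_of_eventually {P : ℝ → Prop} {c : ℝ} (h : ∀ᶠ t in 𝓝 c, P t) :
    ∃ κ > 0, ∀ κ' ≤ κ, ∀ t ∈ Icc (c - κ') (c + κ'), P t := by
  obtain ⟨δ, hδ, H⟩ := Metric.eventually_nhds_iff.1 h
  refine ⟨δ / 2, half_pos hδ, fun κ' hκ' t ht => H ?_⟩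
  rw [Real.dist_eq, abs_lt]
  constructor <;> linarith [ht.1, ht.2]

lemma exists_pos_le_of_isCompact {g : ℝ → ℝ} {K : Set ℝ} (hK : IsCompact K) (hg : Continuous g)
    (h : ∀ t ∈ K, 0 < g t) : ∃ r > 0, ∀ t ∈ K, r ≤ g t := by
  obtain ⟨r, hr, H⟩ := hK.exists_forall_le' hg.continuousOn h
  exact ⟨r, hr, H⟩

/-- Zeros of `C¹` periodic functions near one which changes sign, transversally, twice a period. -/
lemma exists_zeros_of_phaseClose {σ φ ρ : ℝ} {x : ℝ → ℝ} (hσ : 0 < σ) (hρ : 0 < ρ)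
    (dx : ∀ t, HasDerivAt x (deriv x t) t) (cx : Continuous (deriv x))
    (d1 : 0 < deriv x φ) (d2 : deriv x (φ + σ / 2) < 0)
    (pos : ∀ t ∈ Ioo φ (φ + σ / 2), 0 < x t) (neg : ∀ t ∈ Ioo (φ - σ / 2) φ, x t < 0) :
    ∃ r > 0, ∀ z : ℝ → ℝ, (∀ t, HasDerivAt z (deriv z t) t) → Function.Periodic z σ →
      PhaseClose r z x → ∃ t₁ h, |t₁ - φ| < ρ ∧ |h - σ / 2| < ρ ∧ |deriv z t₁ - deriv x φ| < ρ ∧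
        h ∈ Ioo 0 σ ∧ z t₁ = 0 ∧ z (t₁ + h) = 0 ∧ (∀ t ∈ Ioo t₁ (t₁ + h), 0 < z t) ∧
        ∀ t ∈ Ioo (t₁ + (h - σ)) t₁, z t < 0 := by
  have hx : Continuous x := continuous_iff_continuousAt.2 fun t => (dx t).continuousAt
  have ev1 : ∀ᶠ t in 𝓝 φ, 0 < deriv x t ∧ |deriv x t - deriv x φ| < ρ / 2 :=
    (cx.continuousAt.eventually (lt_mem_nhds d1)).and
      (((cx.sub continuous_const).abs.continuousAt (x := φ)).eventually
        (gt_mem_nhds (by simpa using hρ)))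
  have ev2 : ∀ᶠ t in 𝓝 (φ + σ / 2), deriv x t < 0 := cx.continuousAt.eventually (gt_mem_nhds d2)
  obtain ⟨κ₁, hκ₁, H1⟩ := exists_forall_Icc_of_eventually ev1
  obtain ⟨κ₂, hκ₂, H2⟩ := exists_forall_Icc_of_eventually ev2
  -- The windows of radius `κ` around the zeros are disjoint by `κ ≤ σ / 8`. By `κ ≤ ρ / 4`, zeros
  -- inside them satisfy the required bounds on `t₁` and `h`.
  obtain ⟨κ, hκ, l1, l2, l3, l4⟩ : ∃ κ > 0, κ ≤ κ₁ ∧ κ ≤ κ₂ ∧ κ ≤ σ / 8 ∧ κ ≤ ρ / 4 :=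
    ⟨min (min κ₁ κ₂) (min (σ / 8) (ρ / 4)), by positivity,
      (min_le_left _ _).trans (min_le_left _ _), (min_le_left _ _).trans (min_le_right _ _),
      (min_le_right _ _).trans (min_le_left _ _), (min_le_right _ _).trans (min_le_right _ _)⟩
  replace H1 := H1 κ l1
  replace H2 := H2 κ l2
  obtain ⟨r₁, hr₁, R1⟩ := exists_pos_le_of_isCompact isCompact_Icc cx fun t ht => (H1 t ht).1
  obtain ⟨r₂, hr₂, R2⟩ := exists_pos_le_of_isCompact isCompact_Icc cx.neg
    fun t ht => neg_pos.2 (H2 t ht)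
  obtain ⟨r₃, hr₃, R3⟩ := exists_pos_le_of_isCompact (K := Icc (φ + κ) (φ + σ / 2 - κ))
    isCompact_Icc hx fun t ht => pos t ⟨by linarith [ht.1], by linarith [ht.2]⟩
  obtain ⟨r₄, hr₄, R4⟩ := exists_pos_le_of_isCompact (K := Icc (φ - σ / 2 + κ) (φ - κ))
    isCompact_Icc hx.neg fun t ht => neg_pos.2 (neg t ⟨by linarith [ht.1], by linarith [ht.2]⟩)
  -- Below the four lower bounds `z` inherits all signs of `x` and `deriv x`. The bound `ρ / 2` is
  -- the remaining half of the estimate for the crossing velocity.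
  obtain ⟨r, hr, b1, b2, b3, b4, b5⟩ :
      ∃ r > 0, r ≤ r₁ ∧ r ≤ r₂ ∧ r ≤ r₃ ∧ r ≤ r₄ ∧ r ≤ ρ / 2 :=
    ⟨min (min r₁ r₂) (min (min r₃ r₄) (ρ / 2)), by positivity,
      (min_le_left _ _).trans (min_le_left _ _), (min_le_left _ _).trans (min_le_right _ _),
      (min_le_right _ _).trans ((min_le_left _ _).trans (min_le_left _ _)),
      (min_le_right _ _).trans ((min_le_left _ _).trans (min_le_right _ _)),
      (min_le_right _ _).trans (min_le_right _ _)⟩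
  refine ⟨r, hr, fun z dz pz hz => ?_⟩
  have hzc : Continuous z := continuous_iff_continuousAt.2 fun t => (dz t).continuousAt
  have A1 : ∀ t ∈ Icc (φ - κ) (φ + κ), 0 < deriv z t := fun t ht => by
    have := R1 t ht
    have := (abs_lt.1 (hz t).2).1
    linarith
  have A2 : ∀ t ∈ Icc (φ + σ / 2 - κ) (φ + σ / 2 + κ), deriv z t < 0 := fun t ht => by
    have : r₂ ≤ -deriv x t := R2 t ht
    have := (abs_lt.1 (hz t).2).2
    linarith
  have A3 : ∀ t ∈ Icc (φ + κ) (φ + σ / 2 - κ), 0 < z t := fun t ht => by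
    have := R3 t ht
    have := (abs_lt.1 (hz t).1).1
    linarith
  have A4 : ∀ t ∈ Icc (φ - σ / 2 + κ) (φ - κ), z t < 0 := fun t ht => by
    have : r₄ ≤ -x t := R4 t ht
    have := (abs_lt.1 (hz t).1).2
    linarith
  have pz' : Function.Periodic (deriv z) σ := fun t => by
    rw [← deriv_comp_add_const, funext pz]
  have A5 : ∀ t ∈ Icc (φ - σ / 2 - κ) (φ - σ / 2 + κ), deriv z t < 0 := fun t ht => by
    rw [← pz' t]
    exact A2 _ ⟨by linarith [ht.1], by linarith [ht.2]⟩
  obtain ⟨t₁, m1, z1⟩ : (0 : ℝ) ∈ z '' Ioo (φ - κ) (φ + κ) :=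
    intermediate_value_Ioo (by linarith) hzc.continuousOn
      ⟨A4 _ ⟨by linarith, le_rfl⟩, A3 _ ⟨le_rfl, by linarith⟩⟩
  obtain ⟨t₂, m2, z2⟩ : (0 : ℝ) ∈ z '' Ioo (φ + σ / 2 - κ) (φ + σ / 2 + κ) := by
    refine intermediate_value_Ioo' (by linarith) hzc.continuousOn ⟨?_, A3 _ ⟨by linarith, le_rfl⟩⟩
    rw [show φ + σ / 2 + κ = φ - σ / 2 + κ + σ by ring, pz]
    exact A4 _ ⟨le_rfl, by linarith⟩
  have z2' : z (t₂ - σ) = 0 := by rw [pz.sub_eq, z2]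
  refine ⟨t₁, t₂ - t₁, ?_, ?_, ?_, ⟨by linarith [m1.2, m2.1], by linarith [m1.1, m2.2]⟩, z1,
    by rw [add_sub_cancel, z2], ?_, ?_⟩
  · rw [abs_lt]; constructor <;> linarith [m1.1, m1.2]
  · rw [abs_lt]; constructor <;> linarith [m1.1, m1.2, m2.1, m2.2]
  · have h1 := (H1 t₁ (Ioo_subset_Icc_self m1)).2
    have h2 := (hz t₁).2
    rw [abs_lt] at *
    constructor <;> linarith [h1.1, h1.2, h2.1, h2.2]
  · rw [add_sub_cancel]
    exact pos_of_zeros (fun t _ => dz t) (by linarith) A1 A3 A2 (Ioo_subset_Icc_self m1) z1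
      (Ioo_subset_Icc_self m2) z2
  · rw [show t₁ + (t₂ - t₁ - σ) = t₂ - σ by ring]
    exact neg_of_zeros (fun t _ => dz t) (by linarith) A5 A4 A1
      ⟨by linarith [m2.1], by linarith [m2.2]⟩ z2' (Ioo_subset_Icc_self m1) z1

/-- A function which agrees with a positive function as long as it is positive is positive. -/
lemma pos_of_follows {w g : ℝ → ℝ} {T d : ℝ} (hw : Continuous w) (h0 : w 0 = 0)
    (hd : HasDerivAt w d 0) (hdpos : 0 < d)
    (hg : ∀ t ∈ Ioo 0 T, 0 < g t)
    (follows : ∀ b ∈ Ioo 0 T, (∀ t ∈ Ioo 0 b, 0 < w t) → w b = g b) :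
    ∀ t ∈ Ioo 0 T, 0 < w t := by
  by_contra! hcon
  obtain ⟨c, hc, hwc⟩ := hcon
  have hev : ∀ᶠ t in 𝓝[>] (0 : ℝ), 0 < w t := by
    have h1 := (hasDerivAt_iff_tendsto_slope.1 hd).mono_left
      (nhdsWithin_mono 0 fun t (ht : t ∈ Ioi 0) => ne_of_gt ht)
    filter_upwards [h1.eventually (lt_mem_nhds hdpos), self_mem_nhdsWithin] with t ht ht'
    rw [slope_def_field, h0, sub_zero, sub_zero] at ht
    exact (div_pos_iff_of_pos_right ht').1 ht
  obtain ⟨δ, hδ, hpos⟩ := mem_nhdsGT_iff_exists_Ioo_subset.1 hev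
  have hδ' : 0 < δ := hδ
  -- The first time at which positivity fails. Cutting off at `δ` removes the zero at `0` and makes
  -- the set closed. Up to its infimum `w` follows `g`, which is positive there.
  let S := {t | δ ≤ t ∧ w t ≤ 0}
  have hcS : c ∈ S := ⟨not_lt.1 fun h => (not_lt.2 hwc) (hpos ⟨hc.1, h⟩), hwc⟩
  have hSc : IsClosed S := (isClosed_le continuous_const continuous_id).inter
    (isClosed_le hw continuous_const)
  have hbdd : BddBelow S := ⟨δ, fun t ht => ht.1⟩
  have hb := hSc.csInf_mem ⟨c, hcS⟩ hbdd
  have hbT : sInf S ∈ Ioo 0 T :=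
    ⟨hδ'.trans_le hb.1, (csInf_le hbdd hcS).trans_lt hc.2⟩
  have hposb : ∀ t ∈ Ioo 0 (sInf S), 0 < w t := fun t ht => by
    by_contra! h
    rcases lt_or_ge t δ with h' | h'
    · exact (not_lt.2 h) (hpos ⟨ht.1, h'⟩)
    · exact (not_le.2 ht.2) (csInf_le hbdd ⟨h', h⟩)
  have := hg _ hbT
  rw [← follows _ hbT hposb] at this
  exact (not_lt.2 hb.2) this

lemma eventually_forall_pos {N : Set (ℝ × ℝ × ℝ)} (hN : IsOpen N) {F : ℝ × ℝ × ℝ → ℝ → ℝ}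
    (hF : ContinuousOn (fun q : (ℝ × ℝ × ℝ) × ℝ => F q.1 q.2) (N ×ˢ univ)) {p₀ : ℝ × ℝ × ℝ}
    (hp₀ : p₀ ∈ N) {K : Set ℝ} (hK : IsCompact K) (h : ∀ t ∈ K, 0 < F p₀ t) :
    ∀ᶠ p in 𝓝 p₀, ∀ t ∈ K, 0 < F p t := by
  refine hK.eventually_forall_of_forall_eventually fun t ht => ?_
  exact (hF.continuousAt ((hN.prod isOpen_univ).mem_nhds ⟨hp₀, mem_univ t⟩)).eventually
    (lt_mem_nhds (h t ht))

/-! ### Regular points near the base point -/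

section Orbits

variable {α η σ φ v : ℝ} {f : ℝ × ℝ × ℝ → ℝ}
  (Lp : LocalFlow α η σ f (0, φ, v)) (Lm : LocalFlow (-α) η σ f (0, φ, v))

/-- What holds for the local flows near the base point. -/
structure IsRegular (q : ℝ × ℝ × ℝ × ℝ) : Prop where
  mem_p : (q.1, q.2.1, q.2.2.2) ∈ Lp.N
  mem_m : (q.1, q.2.1, q.2.2.2) ∈ Lm.N
  y_pos : 0 < q.2.2.2
  mem_Ioo : q.2.2.1 ∈ Ioo 0 σ
  sn_pos : 0 < sn η (q.2.2.1 / 2)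
  sn_neg : sn η ((q.2.2.1 - σ) / 2) < 0
  eq_half : sn η (q.2.2.1 - σ / 2) = 0 → q.2.2.1 = σ / 2
  xp_pos : Lp.X (q.1, q.2.1, q.2.2.2) q.2.2.1 = 0 →
    ∀ s ∈ Ioo 0 q.2.2.1, 0 < Lp.X (q.1, q.2.1, q.2.2.2) s
  xm_neg : Lm.X (q.1, q.2.1, q.2.2.2) (q.2.2.1 - σ) = 0 →
    ∀ s ∈ Ioo (q.2.2.1 - σ) 0, Lm.X (q.1, q.2.1, q.2.2.2) s < 0

lemma eventually_isRegular (hs : IsHalfPeriod α η (σ / 2)) (hv : v = halfPeriodInv α η (σ / 2)) :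
    ∀ᶠ q in 𝓝 (basePoint σ φ v), IsRegular Lp Lm q := by
  have hσ := hs.pos
  have hvpos : 0 < v := hv ▸ hs.halfPeriodInv_pos
  let g : ℝ → ℝ := fun t => v * cs η t - α * sn η t
  have hg : Continuous g := by fun_prop
  have hg0 : 0 < g 0 := by simpa [g] using hvpos
  have hg1 : g (σ / 2) < 0 := by
    have := hs.velocity_eq
    rw [← hv] at this
    simp only [g]; linarith
  obtain ⟨κ₁, hκ₁, H1⟩ := exists_forall_Icc_of_eventually
    (hg.continuousAt.eventually (lt_mem_nhds hg0))
  obtain ⟨κ₂, hκ₂, H2⟩ := exists_forall_Icc_of_eventually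
    (hg.continuousAt.eventually (gt_mem_nhds hg1))
  obtain ⟨κ, hκ, l1, l2, l3⟩ : ∃ κ > 0, κ ≤ κ₁ ∧ κ ≤ κ₂ ∧ κ ≤ σ / 8 :=
    ⟨min (min κ₁ κ₂) (σ / 8), lt_min (lt_min hκ₁ hκ₂) (by linarith),
      (min_le_left _ _).trans (min_le_left _ _), (min_le_left _ _).trans (min_le_right _ _),
      min_le_right _ _⟩
  replace H1 := H1 κ l1
  replace H2 := H2 κ l2
  have hpos : ∀ t, 0 < t → t < σ / 2 → 0 < v * sn η t - α * vs η t := fun t h1 h2 =>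
    hv ▸ hs.position_pos h1 h2
  -- By reversibility the estimates for the right half orbit, read backwards in time, also serve the
  -- left one.
  have eY : ∀ t, Lm.Y (0, φ, v) t = g (-t) := fun t => by
    simp only [Lm.Y_unperturbed, g, DiscontinuousOscillator.sn_neg, cs_neg]; ring
  have eX : ∀ t, Lm.X (0, φ, v) t = -(v * sn η (-t) - α * vs η (-t)) := fun t => by
    simp only [Lm.X_unperturbed, DiscontinuousOscillator.sn_neg, vs_neg]; ring
  have cp := Lp.contDiffOn_X.continuousOn
  have cp' := Lp.contDiffOn_Y.continuousOn
  have cm := Lm.contDiffOn_X.continuousOn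
  have cm' := Lm.contDiffOn_Y.continuousOn
  have E1 := eventually_forall_pos Lp.isOpen cp' Lp.mem (K := Icc (0 - κ) (0 + κ)) isCompact_Icc
    fun t ht => by rw [Lp.Y_unperturbed]; exact H1 t ht
  have E2 := eventually_forall_pos Lp.isOpen cp Lp.mem (K := Icc (0 + κ) (σ / 2 - κ))
    isCompact_Icc fun t ht => by
      rw [Lp.X_unperturbed]; exact hpos t (by linarith [ht.1]) (by linarith [ht.2])
  have E3 := eventually_forall_pos Lp.isOpen cp'.neg Lp.mem
    (F := fun p t => -Lp.Y p t) (K := Icc (σ / 2 - κ) (σ / 2 + κ))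
    isCompact_Icc fun t ht => by
      rw [Lp.Y_unperturbed]; exact neg_pos.2 (H2 t ht)
  have E4 := eventually_forall_pos Lm.isOpen cm' Lm.mem (K := Icc (0 - κ) (0 + κ)) isCompact_Icc
    fun t ht => by rw [eY]; exact H1 _ ⟨by linarith [ht.2], by linarith [ht.1]⟩
  have E5 := eventually_forall_pos Lm.isOpen cm.neg Lm.mem
    (F := fun p t => -Lm.X p t) (K := Icc (-(σ / 2) + κ) (0 - κ))
    isCompact_Icc fun t ht => by
      rw [eX, neg_neg]; exact hpos _ (by linarith [ht.2]) (by linarith [ht.1])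
  have E6 := eventually_forall_pos Lm.isOpen cm'.neg Lm.mem
    (F := fun p t => -Lm.Y p t) (K := Icc (-(σ / 2) - κ) (-(σ / 2) + κ))
    isCompact_Icc fun t ht => by
      rw [eY]; exact neg_pos.2 (H2 _ ⟨by linarith [ht.2], by linarith [ht.1]⟩)
  have N1 := Lp.isOpen.mem_nhds Lp.mem
  have N2 := Lm.isOpen.mem_nhds Lm.mem
  have proj : Filter.Tendsto (fun q : ℝ × ℝ × ℝ × ℝ => (q.1, q.2.1, q.2.2.2))
      (𝓝 (basePoint σ φ v)) (𝓝 (0, φ, v)) :=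
    Continuous.tendsto' (by fun_prop) _ _ rfl
  have projh : Filter.Tendsto (fun q : ℝ × ℝ × ℝ × ℝ => q.2.2.1)
      (𝓝 (basePoint σ φ v)) (𝓝 (σ / 2)) :=
    Continuous.tendsto' (by fun_prop) _ _ rfl
  have projy : Filter.Tendsto (fun q : ℝ × ℝ × ℝ × ℝ => q.2.2.2)
      (𝓝 (basePoint σ φ v)) (𝓝 v) :=
    Continuous.tendsto' (by fun_prop) _ _ rfl
  have F1 : ∀ᶠ h in 𝓝 (σ / 2), 0 < sn η (h / 2) :=
    (show Continuous fun h => sn η (h / 2) by fun_prop).continuousAt.eventually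
      (lt_mem_nhds hs.sn_half_pos)
  have F2 : ∀ᶠ h in 𝓝 (σ / 2), sn η ((h - σ) / 2) < 0 := by
    refine (show Continuous fun h => sn η ((h - σ) / 2) by fun_prop).continuousAt.eventually
      (gt_mem_nhds ?_)
    dsimp only
    rw [show (σ / 2 - σ) / 2 = -(σ / 2 / 2) by ring, DiscontinuousOscillator.sn_neg]
    exact neg_neg_of_pos hs.sn_half_pos
  -- The zero of `sn` at `0` is isolated, because its derivative there is `1`.
  have F3 : ∀ᶠ h in 𝓝 (σ / 2), sn η (h - σ / 2) = 0 → h = σ / 2 := by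
    have h1 : HasDerivAt (fun h => sn η (h - σ / 2)) (cs η (σ / 2 - σ / 2)) (σ / 2) :=
      (hasDerivAt_sn η _).comp_sub_const _ _
    have h2 := h1.eventually_ne (c := 0) (by simp)
    rw [eventually_nhdsWithin_iff] at h2
    filter_upwards [h2] with h hh h0
    by_contra hne
    exact hh hne h0
  have F4 : ∀ᶠ h in 𝓝 (σ / 2), h ∈ Icc (σ / 2 - κ) (σ / 2 + κ) :=
    Icc_mem_nhds (by linarith) (by linarith)
  filter_upwards [proj.eventually E1, proj.eventually E2, proj.eventually E3, proj.eventually E4,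
    proj.eventually E5, proj.eventually E6, proj N1, proj N2, projh.eventually F1,
    projh.eventually F2, projh.eventually F3, projh.eventually F4,
    projy.eventually (lt_mem_nhds hvpos)] with q e1 e2 e3 e4 e5 e6 n1 n2 f1 f2 f3 f4 hy
  refine ⟨n1, n2, hy, ⟨by linarith [f4.1], by linarith [f4.2]⟩, f1, f2, f3, fun h0 => ?_,
    fun h0 => ?_⟩
  · exact pos_of_zeros
      (fun t ht => Lp.hasDerivAt_X n1 ⟨by linarith [ht.1], by linarith [ht.2]⟩) (by linarith)
      e1 e2 (fun t ht => neg_pos.1 (e3 t ht)) ⟨by linarith, by linarith⟩ (Lp.X_zero _) f4 h0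
  · exact neg_of_zeros
      (fun t ht => Lm.hasDerivAt_X n2 ⟨by linarith [ht.1], by linarith [ht.2]⟩) (by linarith)
      (fun t ht => neg_pos.1 (e6 t ht)) (fun t ht => neg_pos.1 (e5 t ht)) e4
      ⟨by linarith [f4.1], by linarith [f4.2]⟩ h0 ⟨by linarith, by linarith⟩ (Lm.X_zero _)

/-- The undivided velocity mismatch, obtained by eliminating `y` between the half identities of the
two sides. On the zero set of the positions it equals `ε` times the third bifurcation equation, so
it can be used in both directions. -/
lemma bifurcation_identity (q : ℝ × ℝ × ℝ × ℝ) :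
    sn η ((q.2.2.1 - σ) / 2) * sn η (q.2.2.1 / 2) * (Lp.Y (q.1, q.2.1, q.2.2.2) q.2.2.1 -
      Lm.Y (q.1, q.2.1, q.2.2.2) (q.2.2.1 - σ)) =
    q.1 * (bifurcation Lp Lm q).2.2 +
      sn η ((q.2.2.1 - σ) / 2) * cs η (q.2.2.1 / 2) * (bifurcation Lp Lm q).1 -
      sn η (q.2.2.1 / 2) * cs η ((q.2.2.1 - σ) / 2) * (bifurcation Lp Lm q).2.1 := by
  have h1 := Lp.half_identity (q.1, q.2.1, q.2.2.2) q.2.2.1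
  have h2 := Lm.half_identity (q.1, q.2.1, q.2.2.2) (q.2.2.1 - σ)
  simp only [bifurcation] at *
  linear_combination sn η ((q.2.2.1 - σ) / 2) * h1 - sn η (q.2.2.1 / 2) * h2

lemma IsRegular.halfOrbits {q : ℝ × ℝ × ℝ × ℝ} (hq : IsRegular Lp Lm q)
    (h0 : bifurcation Lp Lm q = 0) :
    HalfOrbits α η q.1 σ f q.2.1 q.2.2.1 (Lp.X (q.1, q.2.1, q.2.2.2))
      (Lp.Y (q.1, q.2.1, q.2.2.2)) (Lm.X (q.1, q.2.1, q.2.2.2))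
      (Lm.Y (q.1, q.2.1, q.2.2.2)) := by
  have x1 : Lp.X (q.1, q.2.1, q.2.2.2) q.2.2.1 = 0 := congrArg Prod.fst h0
  have x2 : Lm.X (q.1, q.2.1, q.2.2.2) (q.2.2.1 - σ) = 0 := congrArg (fun z => z.2.1) h0
  have hm := hq.mem_Ioo
  have hid := bifurcation_identity Lp Lm q
  rw [h0] at hid
  simp only [Prod.fst_zero, Prod.snd_zero, mul_zero, add_zero, sub_zero] at hid
  have hy := (mul_eq_zero.1 hid).resolve_left (mul_ne_zero hq.sn_neg.ne hq.sn_pos.ne')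
  exact {
    mem := hm
    hasDerivAt_xp := fun s hs => Lp.hasDerivAt_X hq.mem_p
      ⟨by linarith [hs.1, hm.1, hm.2], by linarith [hs.2, hm.2]⟩
    hasDerivAt_yp := fun s hs => Lp.hasDerivAt_Y hq.mem_p
      ⟨by linarith [hs.1, hm.1, hm.2], by linarith [hs.2, hm.2]⟩
    hasDerivAt_xm := fun s hs => Lm.hasDerivAt_X hq.mem_m
      ⟨by linarith [hs.1, hm.1, hm.2], by linarith [hs.2, hm.1, hm.2]⟩
    hasDerivAt_ym := fun s hs => Lm.hasDerivAt_Y hq.mem_m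
      ⟨by linarith [hs.1, hm.1, hm.2], by linarith [hs.2, hm.1, hm.2]⟩
    xp_zero := Lp.X_zero _
    xm_zero := Lm.X_zero _
    xp_end := x1
    xm_end := x2
    y_zero := by simp
    y_end := sub_eq_zero.1 hy
    xp_pos := hq.xp_pos x1
    xm_neg := hq.xm_neg x2 }

/-- At `ε = 0` the time conditions determine `h` and `y`. -/
lemma IsRegular.eq_of_unperturbed {t₁ h y : ℝ} (hq : IsRegular Lp Lm (0, t₁, h, y))
    (hs : IsHalfPeriod α η (σ / 2)) (hv : v = halfPeriodInv α η (σ / 2))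
    (h1 : Lp.X (0, t₁, y) h = 0) (h2 : Lm.X (0, t₁, y) (h - σ) = 0) : h = σ / 2 ∧ y = v := by
  have hS : 0 < sn η (h / 2) := hq.sn_pos
  have hS' : sn η ((h - σ) / 2) < 0 := hq.sn_neg
  rw [Lp.X_unperturbed, vs, sn_eq_half η h] at h1
  rw [Lm.X_unperturbed, vs, sn_eq_half η (h - σ)] at h2
  have e1 : y * cs η (h / 2) - α * sn η (h / 2) = 0 := by
    refine ((mul_eq_zero (a := 2 * sn η (h / 2))).1 ?_).resolve_left (by positivity)
    linear_combination h1
  have e2 : y * cs η ((h - σ) / 2) + α * sn η ((h - σ) / 2) = 0 := by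
    refine ((mul_eq_zero (a := 2 * sn η ((h - σ) / 2))).1 ?_).resolve_left (by simpa using hS'.ne)
    linear_combination h2
  -- Eliminating `y` from the two time conditions leaves the addition formula for `sn` at `h / 2 +
  -- (h - σ) / 2`.
  have e3 : sn η (h - σ / 2) = 0 := by
    rw [show h - σ / 2 = h / 2 + (h - σ) / 2 by ring, sn_add]
    refine ((mul_eq_zero (a := α)).1 ?_).resolve_left hs.ne_zero
    linear_combination cs η (h / 2) * e2 - cs η ((h - σ) / 2) * e1
  have e4 : h = σ / 2 := hq.eq_half e3
  refine ⟨e4, ?_⟩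
  rw [hv, halfPeriodInv_eq, eq_div_iff hs.cs_half_ne, ← e4]
  linear_combination e1

end Orbits

/-! ### Smooth branches -/

lemma periodic_deriv {z : ℝ → ℝ} {σ : ℝ} (hz : Function.Periodic z σ) :
    Function.Periodic (deriv z) σ := fun t => by
  rw [← deriv_comp_add_const, funext hz]

lemma eventually_forall_abs_sub_lt {J : Set ℝ} (hJ : IsOpen J) {g : ℝ → ℝ → ℝ}
    (hg : ContinuousOn (fun q : ℝ × ℝ => g q.1 q.2) (J ×ˢ univ)) {ε' : ℝ} (h : ε' ∈ J) {K : Set ℝ}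
    (hK : IsCompact K) {r : ℝ} (hr : 0 < r) : ∀ᶠ ε in 𝓝 ε', ∀ t ∈ K, |g ε t - g ε' t| < r := by
  refine hK.eventually_forall_of_forall_eventually fun t ht => ?_
  have h1 : ContinuousAt (fun q : ℝ × ℝ => g q.1 q.2) (ε', t) :=
    hg.continuousAt ((hJ.prod isOpen_univ).mem_nhds ⟨h, mem_univ _⟩)
  have h2 : ContinuousAt (fun q : ℝ × ℝ => g ε' q.2) (ε', t) :=
    ContinuousAt.comp (g := fun q : ℝ × ℝ => g q.1 q.2) (f := fun q : ℝ × ℝ => ((ε', q.2) : ℝ × ℝ))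
      (x := (ε', t)) h1 (by fun_prop)
  exact (h1.sub h2).abs.eventually (gt_mem_nhds (by simpa using hr))

section Branch

variable {α η σ φ ε₀ : ℝ} {f : ℝ × ℝ × ℝ → ℝ} {Z : ℝ → ℝ → ℝ}

lemma IsSmoothBranch.mono (hZ : IsSmoothBranch α η σ f φ ε₀ Z) {ε₁ : ℝ} (h : ε₁ ≤ ε₀) :
    IsSmoothBranch α η σ f φ ε₁ Z :=
  have hs : Ioo (-ε₁) ε₁ ⊆ Ioo (-ε₀) ε₀ := Ioo_subset_Ioo (neg_le_neg h) h
  ⟨hZ.smooth.mono (prod_mono hs subset_rfl), fun ε hε => hZ.periodicSolution ε (hs hε), hZ.initial⟩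

/-- Members of a smooth branch depend continuously on `ε`, uniformly in time. -/
lemma IsSmoothBranch.eventually_phaseClose (hσ : 0 < σ) (hZ : IsSmoothBranch α η σ f φ ε₀ Z)
    {ε' : ℝ} (h : ε' ∈ Ioo (-ε₀) ε₀) {r : ℝ} (hr : 0 < r) :
    ∀ᶠ ε in 𝓝 ε', PhaseClose r (Z ε) (Z ε') := by
  have hO : IsOpen (Ioo (-ε₀) ε₀ ×ˢ (univ : Set ℝ)) := isOpen_Ioo.prod isOpen_univ
  have hd : ContinuousOn (fun q : ℝ × ℝ => deriv (Z q.1) q.2) (Ioo (-ε₀) ε₀ ×ˢ univ) := by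
    have h1 := (hZ.smooth.continuousOn_fderiv_of_isOpen hO le_rfl).clm_apply
      (continuousOn_const (c := ((0, 1) : ℝ × ℝ)))
    refine h1.congr fun q hq => ?_
    have h2 := ((hZ.smooth.contDiffAt (hO.mem_nhds hq)).differentiableAt one_ne_zero).hasFDerivAt
    exact (h2.comp_hasDerivAt q.2 ((hasDerivAt_const q.2 q.1).prodMk (hasDerivAt_id q.2))).deriv
  have E1 := eventually_forall_abs_sub_lt isOpen_Ioo hZ.smooth.continuousOn h
    (isCompact_Icc (a := 0) (b := σ)) hr
  have E2 := eventually_forall_abs_sub_lt (g := fun ε => deriv (Z ε)) isOpen_Ioo hd h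
    (isCompact_Icc (a := 0) (b := σ)) hr
  filter_upwards [E1, E2, isOpen_Ioo.mem_nhds h] with ε e1 e2 hε t
  obtain ⟨n, hn⟩ := exists_int_sub_mem hσ t
  have p1 := (hZ.periodicSolution ε hε).2
  have p2 := (hZ.periodicSolution ε' h).2
  rw [← p1.sub_int_mul_eq n, ← p2.sub_int_mul_eq n, ← (periodic_deriv p1).sub_int_mul_eq n,
    ← (periodic_deriv p2).sub_int_mul_eq n]
  exact ⟨e1 _ (Ico_subset_Icc_self hn), e2 _ (Ico_subset_Icc_self hn)⟩

lemma PhaseClose.trans {r s : ℝ} {x y z : ℝ → ℝ} (h₁ : PhaseClose r x y) (h₂ : PhaseClose s y z) :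
    PhaseClose (r + s) x z := fun t =>
  ⟨(abs_sub_le _ (y t) _).trans_lt (add_lt_add (h₁ t).1 (h₂ t).1),
    (abs_sub_le _ (deriv y t) _).trans_lt (add_lt_add (h₁ t).2 (h₂ t).2)⟩

/-- Two smooth branches agree if, near one of them, periodic solutions are unique. -/
lemma IsSmoothBranch.eq_of_unique (hσ : 0 < σ) {X : ℝ → ℝ → ℝ}
    (hZ : IsSmoothBranch α η σ f φ ε₀ Z) (hX : IsSmoothBranch α η σ f φ ε₀ X) (hε₀ : 0 < ε₀)
    {r : ℝ} (hr : 0 < r) (h0 : Z 0 = X 0)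
    (huniq : ∀ ε ∈ Ioo (-ε₀) ε₀, ε ≠ 0 → ∀ z, IsPeriodicSolution α η ε σ f z →
      ∀ ε' ∈ Ioo (-ε₀) ε₀, PhaseClose r z (X ε') → z = X ε) :
    ∀ ε ∈ Ioo (-ε₀) ε₀, Z ε = X ε := by
  have hO : IsOpen (Ioo (-ε₀) ε₀ ×ˢ (univ : Set ℝ)) := isOpen_Ioo.prod isOpen_univ
  let u := {ε | ε ∈ Ioo (-ε₀) ε₀ ∧ Z ε = X ε}
  have hu : IsOpen u := by
    -- For `ε` near `ε'` the function `Z ε` is close to `Z ε' = X ε'`, so local uniqueness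
    -- identifies it with `X ε`. The value `ε = 0`, where uniqueness fails because of translations,
    -- is covered by `h0`.
    refine isOpen_iff_mem_nhds.2 fun ε' h' => ?_
    filter_upwards [isOpen_Ioo.mem_nhds h'.1, hZ.eventually_phaseClose hσ h'.1 hr] with ε hε hc
    refine ⟨hε, ?_⟩
    by_cases hz : ε = 0
    · rw [hz, h0]
    · rw [h'.2] at hc
      exact huniq ε hε hz _ (hZ.periodicSolution ε hε) ε' h'.1 hc
  have hm : (0 : ℝ) ∈ Ioo (-ε₀) ε₀ := ⟨neg_neg_of_pos hε₀, hε₀⟩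
  refine fun ε hε => (isPreconnected_Ioo.subset_of_closure_inter_subset hu ⟨0, hm, hm, h0⟩ ?_ hε).2
  rintro ε' ⟨hcl, hε'⟩
  refine ⟨hε', funext fun t => ?_⟩
  have cont : ∀ {W : ℝ → ℝ → ℝ}, IsSmoothBranch α η σ f φ ε₀ W →
      ContinuousAt (fun ε => W ε t) ε' := fun {W} hW => by
    have h1 : ContinuousAt (fun q : ℝ × ℝ => W q.1 q.2) (ε', t) :=
      hW.smooth.continuousOn.continuousAt (hO.mem_nhds ⟨hε', mem_univ _⟩)
    exact ContinuousAt.comp (f := fun ε : ℝ => ((ε, t) : ℝ × ℝ)) h1 (by fun_prop)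
  by_contra hne
  have hev := ((cont hZ).sub (cont hX)).eventually_ne (sub_ne_zero.2 hne)
  obtain ⟨ε, h1, h2⟩ := mem_closure_iff_nhds.1 hcl _ hev
  exact h1 (sub_eq_zero.2 (congrFun h2.2 t))

end Branch

/-! ### Periodic orbits from the bifurcation equations -/

section Orbits

variable {α η σ φ v : ℝ} {f : ℝ × ℝ × ℝ → ℝ} (hσ : 0 < σ)
  (Lp : LocalFlow α η σ f (0, φ, v)) (Lm : LocalFlow (-α) η σ f (0, φ, v))

/-- The periodic function that belongs to a solution `(ε, t₁, h, y)` of the bifurcation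
equations. -/
def orbit (q : ℝ × ℝ × ℝ × ℝ) (t : ℝ) : ℝ :=
  profile hσ q.2.2.1 (Lp.X (q.1, q.2.1, q.2.2.2)) (Lm.X (q.1, q.2.1, q.2.2.2)) (t - q.2.1)

variable {Lp Lm}

lemma IsRegular.isPeriodicSolution_orbit {q : ℝ × ℝ × ℝ × ℝ} (hq : IsRegular Lp Lm q)
    (h0 : bifurcation Lp Lm q = 0) (hf : Continuous f)
    (hper : ∀ t x y : ℝ, f (t + σ, x, y) = f (t, x, y)) :
    IsPeriodicSolution α η q.1 σ f (orbit hσ Lp Lm q) :=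
  (hq.halfOrbits Lp Lm h0).isPeriodicSolution hσ hf hper

lemma IsRegular.deriv_orbit {q : ℝ × ℝ × ℝ × ℝ} (hq : IsRegular Lp Lm q)
    (h0 : bifurcation Lp Lm q = 0) {s : ℝ} (hs : s ∈ Icc 0 q.2.2.1) :
    deriv (orbit hσ Lp Lm q) (q.2.1 + s) = Lp.Y (q.1, q.2.1, q.2.2.2) s := by
  have := congrFun ((hq.halfOrbits Lp Lm h0).deriv_profile hσ) (q.2.1 + s)
  rw [add_sub_cancel_left, profile_eq_left hσ hq.mem_Ioo hs] at this
  exact this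

lemma IsRegular.orbit_pos {q : ℝ × ℝ × ℝ × ℝ} (hq : IsRegular Lp Lm q)
    (h0 : bifurcation Lp Lm q = 0) :
    ∀ t ∈ Ioo q.2.1 (q.2.1 + q.2.2.1), 0 < orbit hσ Lp Lm q t := fun t ht => by
  have hm : t - q.2.1 ∈ Ioo 0 q.2.2.1 := ⟨by linarith [ht.1], by linarith [ht.2]⟩
  rw [orbit, profile_eq_left hσ hq.mem_Ioo (Ioo_subset_Icc_self hm)]
  exact (hq.halfOrbits Lp Lm h0).xp_pos _ hm

lemma IsRegular.orbit_neg {q : ℝ × ℝ × ℝ × ℝ} (hq : IsRegular Lp Lm q)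
    (h0 : bifurcation Lp Lm q = 0) :
    ∀ t ∈ Ioo (q.2.1 + (q.2.2.1 - σ)) q.2.1, orbit hσ Lp Lm q t < 0 := fun t ht => by
  have H := hq.halfOrbits Lp Lm h0
  have hm : t - q.2.1 ∈ Ioo (q.2.2.1 - σ) 0 := ⟨by linarith [ht.1], by linarith [ht.2]⟩
  rw [orbit, profile_eq_right hσ hq.mem_Ioo (H.xp_zero.trans H.xm_zero.symm)
    (H.xp_end.trans H.xm_end.symm) (Ioo_subset_Icc_self hm)]
  exact H.xm_neg _ hm

lemma IsRegular.orbit_zero {q : ℝ × ℝ × ℝ × ℝ} (hq : IsRegular Lp Lm q) :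
    orbit hσ Lp Lm q q.2.1 = 0 := by
  rw [orbit, sub_self, profile_eq_left hσ hq.mem_Ioo ⟨le_rfl, hq.mem_Ioo.1.le⟩, Lp.X_zero]

/-- A periodic solution with two sign changes in a period follows the local flows. -/
lemma IsPeriodicSolution.eq_orbit {ε t₁ h : ℝ} {z : ℝ → ℝ}
    (hz : IsPeriodicSolution α η ε σ f z) (hf : ContDiff ℝ 1 f)
    (hp : (ε, t₁, deriv z t₁) ∈ Lp.N) (hm : (ε, t₁, deriv z t₁) ∈ Lm.N) (hh : h ∈ Ioo 0 σ)
    (z1 : z t₁ = 0) (z2 : z (t₁ + h) = 0) (pos : ∀ t ∈ Ioo t₁ (t₁ + h), 0 < z t)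
    (neg : ∀ t ∈ Ioo (t₁ + (h - σ)) t₁, z t < 0) :
    z = orbit hσ Lp Lm (ε, t₁, h, deriv z t₁) ∧ Lp.X (ε, t₁, deriv z t₁) h = 0 ∧
      Lm.X (ε, t₁, deriv z t₁) (h - σ) = 0 ∧
      Lp.Y (ε, t₁, deriv z t₁) h = Lm.Y (ε, t₁, deriv z t₁) (h - σ) := by
  have hpos : ∀ s ∈ Icc 0 h, z (t₁ + s) = Lp.X (ε, t₁, deriv z t₁) s ∧
      deriv z (t₁ + s) = Lp.Y (ε, t₁, deriv z t₁) s := fun s hs =>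
    hz.1.eq_localFlow hf Lp (Or.inl rfl) (by linarith) hh.2
      (Or.inl ⟨rfl, by simpa only [add_zero] using pos⟩) z1 hp hs
  have hneg : ∀ s ∈ Icc (h - σ) 0, z (t₁ + s) = Lm.X (ε, t₁, deriv z t₁) s ∧
      deriv z (t₁ + s) = Lm.Y (ε, t₁, deriv z t₁) s := fun s hs =>
    hz.1.eq_localFlow hf Lm (Or.inr rfl) (by linarith [hh.1]) hσ
      (Or.inr ⟨rfl, by simpa only [add_zero] using neg⟩) z1 hm hs
  have i1 : h ∈ Icc 0 h := ⟨hh.1.le, le_rfl⟩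
  have i2 : h - σ ∈ Icc (h - σ) 0 := ⟨le_rfl, by linarith [hh.2]⟩
  have e : t₁ + (h - σ) = t₁ + h - σ := by ring
  refine ⟨funext fun t => eq_profile hσ hz.2 (fun s hs => (hpos s hs).1)
    (fun s hs => (hneg s hs).1) t, ?_, ?_, ?_⟩
  · rw [← (hpos h i1).1, z2]
  · rw [← (hneg _ i2).1, e, hz.2.sub_eq, z2]
  · rw [← (hneg _ i2).2, ← (hpos h i1).2, e, (periodic_deriv hz.2).sub_eq]

/-- Only here is `ε` cancelled: for `ε = 0` the velocities match automatically and say nothing about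
the third equation. -/
lemma bifurcation_eq_zero {q : ℝ × ℝ × ℝ × ℝ}
    (h1 : Lp.X (q.1, q.2.1, q.2.2.2) q.2.2.1 = 0)
    (h2 : Lm.X (q.1, q.2.1, q.2.2.2) (q.2.2.1 - σ) = 0)
    (h3 : Lp.Y (q.1, q.2.1, q.2.2.2) q.2.2.1 = Lm.Y (q.1, q.2.1, q.2.2.2) (q.2.2.1 - σ))
    (hε : q.1 ≠ 0) : bifurcation Lp Lm q = 0 := by
  have e1 : (bifurcation Lp Lm q).1 = 0 := h1
  have e2 : (bifurcation Lp Lm q).2.1 = 0 := h2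
  have hid := bifurcation_identity Lp Lm q
  rw [h3, e1, e2] at hid
  simp only [sub_self, mul_zero, add_zero, sub_zero] at hid
  exact Prod.ext e1 (Prod.ext e2 ((mul_eq_zero.1 hid.symm).resolve_left hε))

/-- The unperturbed solution through `(0, v)` at time `φ` is unique. -/
lemma IsPeriodicSolution.eq_orbit_of_initial {z : ℝ → ℝ} (hz : IsPeriodicSolution α η 0 σ f z)
    (hf : ContDiff ℝ 1 f) (hs : IsHalfPeriod α η (σ / 2)) (hv : v = halfPeriodInv α η (σ / 2))
    (z0 : z φ = 0) (z1 : deriv z φ = v) : z = orbit hσ Lp Lm (0, φ, σ / 2, v) := by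
  have hvpos : 0 < v := hv ▸ hs.halfPeriodInv_pos
  have hpos : ∀ t ∈ Ioo 0 (σ / 2), 0 < v * sn η t - α * vs η t := fun t ht =>
    hv ▸ hs.position_pos ht.1 ht.2
  have hend : v * sn η (σ / 2) - α * vs η (σ / 2) = 0 := hv ▸ hs.position_eq_zero
  have Np : (0, φ, deriv z φ) ∈ Lp.N := z1 ▸ Lp.mem
  have Nm : (0, φ, deriv z φ) ∈ Lm.N := z1 ▸ Lm.mem
  have dp : HasDerivAt (fun t => z (φ + t)) v 0 := by
    have := (hz.1.hasDerivAt (φ + 0)).comp_const_add φ 0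
    rwa [add_zero, z1] at this
  have dm : HasDerivAt (fun t => -z (φ - t)) v 0 := by
    have := ((hz.1.hasDerivAt (φ - 0)).comp_const_sub φ 0).neg
    rwa [sub_zero, z1, neg_neg] at this
  have flow_p : ∀ b, 0 < b → b < σ → (∀ t ∈ Ioo 0 b, 0 < z (φ + t)) → ∀ s ∈ Icc 0 b,
      z (φ + s) = v * sn η s - α * vs η s := fun b hb hb' h s hs => by
    rw [(hz.1.eq_localFlow hf Lp (Or.inl rfl) (by linarith) hb'
      (Or.inl ⟨rfl, fun t ht => by
        have := h (t - φ) ⟨by linarith [ht.1], by linarith [ht.2]⟩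
        rwa [add_sub_cancel] at this⟩) z0 Np hs).1, z1, Lp.X_unperturbed]
  have flow_m : ∀ b, 0 < b → b < σ → (∀ t ∈ Ioo 0 b, 0 < -z (φ - t)) → ∀ s ∈ Icc (-b) 0,
      z (φ + s) = v * sn η s - -α * vs η s := fun b hb hb' h s hs => by
    rw [(hz.1.eq_localFlow hf Lm (Or.inr rfl) (by linarith) hσ
      (Or.inr ⟨rfl, fun t ht => by
        have := h (φ - t) ⟨by linarith [ht.2], by linarith [ht.1]⟩
        rw [sub_sub_cancel] at this
        linarith⟩) z0 Nm hs).1, z1, Lm.X_unperturbed]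
  -- No closeness to a known orbit is assumed, so the signs of `z` are not known beforehand. They
  -- are found by following `z` away from its transversal crossing, forwards here and backwards
  -- below.
  have pos : ∀ t ∈ Ioo 0 (σ / 2), 0 < z (φ + t) := by
    have hc := hz.1.continuous
    refine pos_of_follows (by fun_prop) (by simpa using z0) dp hvpos hpos fun b hb h => ?_
    exact flow_p b hb.1 (by linarith [hb.2]) h b ⟨hb.1.le, le_rfl⟩
  have neg : ∀ t ∈ Ioo 0 (σ / 2), 0 < -z (φ - t) := by
    have hc := hz.1.continuous
    refine pos_of_follows (by fun_prop) (by simpa using z0) dm hvpos hpos fun b hb h => ?_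
    rw [sub_eq_add_neg, flow_m b hb.1 (by linarith [hb.2]) h (-b) ⟨le_rfl, by linarith [hb.1]⟩,
      sn_neg, vs_neg]
    ring
  have z2 : z (φ + σ / 2) = 0 := by
    rw [flow_p (σ / 2) (half_pos hσ) (half_lt_self hσ) pos _ ⟨(half_pos hσ).le, le_rfl⟩, hend]
  have := (hz.eq_orbit (Lp := Lp) (Lm := Lm) hσ hf Np Nm ⟨half_pos hσ, half_lt_self hσ⟩ z0 z2
    (fun t ht => by
      have := pos (t - φ) ⟨by linarith [ht.1], by linarith [ht.2]⟩
      rwa [add_sub_cancel] at this)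
    (fun t ht => by
      have := neg (φ - t) ⟨by linarith [ht.2], by linarith [ht.1]⟩
      rw [sub_sub_cancel] at this
      linarith)).1
  rwa [z1] at this

end Orbits

/-! ### Families of orbits and nearby periodic solutions -/

section OrbitBranch

variable {α η σ φ v : ℝ} {f : ℝ × ℝ × ℝ → ℝ} (hσ : 0 < σ)
  {Lp : LocalFlow α η σ f (0, φ, v)} {Lm : LocalFlow (-α) η σ f (0, φ, v)}

/-- A smooth branch of solutions of the bifurcation equations gives a smooth family of orbits. -/
lemma contDiffOn_orbit {J : Set ℝ} (hJ : IsOpen J) {ψ : ℝ → ℝ × ℝ × ℝ}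
    (hψ : ContDiffOn ℝ 1 ψ J) (hreg : ∀ ε ∈ J, IsRegular Lp Lm (ε, ψ ε))
    (h0 : ∀ ε ∈ J, bifurcation Lp Lm (ε, ψ ε) = 0) :
    ContDiffOn ℝ 1 (fun p : ℝ × ℝ => orbit hσ Lp Lm (p.1, ψ p.1) p.2) (J ×ˢ univ) := by
  have hψ' : ContDiffOn ℝ 1 (fun p : ℝ × ℝ => ψ p.1) (J ×ˢ univ) :=
    hψ.comp contDiffOn_fst fun p hp => hp.1
  have hψ2 := hψ'.fst
  have hψ3 := hψ'.snd.snd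
  have hparam : ContDiffOn ℝ 1
      (fun p : ℝ × ℝ => (((p.1, (ψ p.1).1, (ψ p.1).2.2), p.2) : (ℝ × ℝ × ℝ) × ℝ)) (J ×ˢ univ) :=
    (contDiffOn_fst.prodMk (hψ2.prodMk hψ3)).prodMk contDiffOn_snd
  have hp : ContDiffOn ℝ 1 (fun p : ℝ × ℝ => Lp.X (p.1, (ψ p.1).1, (ψ p.1).2.2) p.2)
      (J ×ˢ univ) :=
    Lp.contDiffOn_X.comp hparam fun p hp => ⟨(hreg p.1 hp.1).mem_p, mem_univ _⟩
  have hm : ContDiffOn ℝ 1 (fun p : ℝ × ℝ => Lm.X (p.1, (ψ p.1).1, (ψ p.1).2.2) p.2)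
      (J ×ˢ univ) :=
    Lm.contDiffOn_X.comp hparam fun p hp => ⟨(hreg p.1 hp.1).mem_m, mem_univ _⟩
  have H := fun ε (hε : ε ∈ J) => (hreg ε hε).halfOrbits Lp Lm (h0 ε hε)
  have key := contDiffOn_profile hσ hJ (h := fun ε => (ψ ε).2.1)
    (a := fun ε => Lp.X (ε, (ψ ε).1, (ψ ε).2.2)) (b := fun ε => Lm.X (ε, (ψ ε).1, (ψ ε).2.2))
    (a' := fun ε => Lp.Y (ε, (ψ ε).1, (ψ ε).2.2)) (b' := fun ε => Lm.Y (ε, (ψ ε).1, (ψ ε).2.2))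
    hp hm hψ.snd.fst (fun ε hε => (H ε hε).mem) (fun ε hε => (H ε hε).hasDerivAt_xp)
    (fun ε hε => (H ε hε).hasDerivAt_xm)
    (fun ε hε => ⟨(H ε hε).xp_zero.trans (H ε hε).xm_zero.symm, (H ε hε).y_zero⟩)
    (fun ε hε => ⟨(H ε hε).xp_end.trans (H ε hε).xm_end.symm, (H ε hε).y_end⟩)
  exact key.comp (g := fun q : ℝ × ℝ => profile hσ (ψ q.1).2.1
    (Lp.X (q.1, (ψ q.1).1, (ψ q.1).2.2)) (Lm.X (q.1, (ψ q.1).1, (ψ q.1).2.2)) q.2)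
    (f := fun p : ℝ × ℝ => (p.1, p.2 - (ψ p.1).1))
    (contDiffOn_fst.prodMk (contDiffOn_snd.sub hψ2)) fun p hp => ⟨hp.1, mem_univ _⟩

/-- Periodic solutions close to the unperturbed orbit come from the bifurcation equations near the
base point. -/
lemma exists_eq_orbit_of_phaseClose (hf : ContDiff ℝ 1 f)
    (hper : ∀ t x y : ℝ, f (t + σ, x, y) = f (t, x, y)) (hs : IsHalfPeriod α η (σ / 2))
    (hv : v = halfPeriodInv α η (σ / 2)) (hreg : IsRegular Lp Lm (basePoint σ φ v))
    (h0 : bifurcation Lp Lm (basePoint σ φ v) = 0) {S : Set (ℝ × ℝ × ℝ × ℝ)}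
    (hS : S ∈ 𝓝 (basePoint σ φ v)) (hSreg : ∀ q ∈ S, IsRegular Lp Lm q) :
    ∃ r > 0, ∀ᶠ ε in 𝓝 (0 : ℝ), ∀ z, IsPeriodicSolution α η ε σ f z →
      PhaseClose r z (orbit hσ Lp Lm (basePoint σ φ v)) → ∃ p : ℝ × ℝ × ℝ, (ε, p) ∈ S ∧
        z = orbit hσ Lp Lm (ε, p) ∧ (ε ≠ 0 → bifurcation Lp Lm (ε, p) = 0) ∧
        (ε = 0 → p.2 = (σ / 2, v)) := by
  obtain ⟨ρ, hρ, hball⟩ := Metric.mem_nhds_iff.1 hS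
  have hvpos : 0 < v := hreg.y_pos
  have hx : IsPeriodicSolution α η 0 σ f (orbit hσ Lp Lm (basePoint σ φ v)) :=
    hreg.isPeriodicSolution_orbit hσ h0 hf.continuous hper
  have d : ∀ s ∈ Icc 0 (σ / 2), deriv (orbit hσ Lp Lm (basePoint σ φ v)) (φ + s) =
      v * cs η s - α * sn η s := fun s hs => by
    have := hreg.deriv_orbit hσ h0 (s := s) hs
    rwa [basePoint, Lp.Y_unperturbed] at this
  have d1 : deriv (orbit hσ Lp Lm (basePoint σ φ v)) φ = v := by
    simpa using d 0 ⟨le_rfl, (half_pos hσ).le⟩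
  have d2 : deriv (orbit hσ Lp Lm (basePoint σ φ v)) (φ + σ / 2) = -v := by
    have := hs.velocity_eq
    rw [← hv] at this
    rw [d _ ⟨(half_pos hσ).le, le_rfl⟩, this]
  obtain ⟨r, hr, H⟩ := exists_zeros_of_phaseClose (φ := φ) hσ hρ hx.1.hasDerivAt hx.1.continuous_deriv
    (by rwa [d1]) (by rw [d2]; exact neg_neg_of_pos hvpos) (hreg.orbit_pos hσ h0) (fun t ht =>
      hreg.orbit_neg hσ h0 t ⟨by
        have h1 := ht.1
        have : φ + (σ / 2 - σ) = φ - σ / 2 := by ring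
        exact this ▸ h1, ht.2⟩)
  refine ⟨r, hr, ?_⟩
  -- The zeros of `z` put `(ε, t₁, h, deriv z t₁)` within `ρ` of the base point; the radius `r` was
  -- chosen from `ρ` independently of `ε`.
  filter_upwards [Metric.ball_mem_nhds 0 hρ] with ε hε z hz hc
  obtain ⟨t₁, h, b1, b2, b3, hh, z1, z2, pos, neg⟩ := H z hz.1.hasDerivAt hz.2 hc
  rw [d1] at b3
  have hq : (ε, t₁, h, deriv z t₁) ∈ S := by
    refine hball ?_
    simp only [basePoint, Metric.mem_ball, Prod.dist_eq, max_lt_iff]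
    exact ⟨hε, b1, b2, b3⟩
  have hqr := hSreg _ hq
  obtain ⟨e, x1, x2, y⟩ := hz.eq_orbit hσ hf hqr.mem_p hqr.mem_m hh z1 z2 pos neg
  refine ⟨(t₁, h, deriv z t₁), hq, e, bifurcation_eq_zero x1 x2 y, ?_⟩
  rintro rfl
  obtain ⟨i1, i2⟩ := hqr.eq_of_unperturbed Lp Lm hs hv x1 x2
  exact Prod.ext i1 i2

/-- Unperturbed orbits differ by a translation in time. -/
lemma orbit_unperturbed (t₁ t₂ h y t : ℝ) :
    orbit hσ Lp Lm (0, t₁, h, y) t = orbit hσ Lp Lm (0, t₂, h, y) (t + (t₂ - t₁)) := by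
  have e1 : Lp.X (0, t₁, y) = Lp.X (0, t₂, y) := funext fun s => by simp only [Lp.X_unperturbed]
  have e2 : Lm.X (0, t₁, y) = Lm.X (0, t₂, y) := funext fun s => by simp only [Lm.X_unperturbed]
  simp only [orbit, e1, e2]
  congr 1
  ring

end OrbitBranch

end DiscontinuousOscillator

end

/-! ### The theorem -/

open DiscontinuousOscillator Set Topology

theorem theoremA (α η σ : ℝ) (f : ℝ × ℝ × ℝ → ℝ)
    (hf : ContDiff ℝ 1 f)
    (hper : ∀ t x y : ℝ, f (t + σ, x, y) = f (t, x, y))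
    (hcase : DiscontinuousOscillator.PeriodAnnulusCase α η)
    (hσ : σ / 2 ∈ DiscontinuousOscillator.halfPeriod α η ''
      DiscontinuousOscillator.halfPeriodDomain α η)
    (φ : ℝ)
    (hzero : DiscontinuousOscillator.melnikov α η σ f φ = 0)
    (hsimple : deriv (DiscontinuousOscillator.melnikov α η σ f) φ ≠ 0) :
    ∃ ε₀ : ℝ, 0 < ε₀ ∧ ∃ X : ℝ → ℝ → ℝ,
      -- `X` is a smooth branch of periodic solutions
      DiscontinuousOscillator.IsSmoothBranch α η σ f φ ε₀ X ∧
      -- which crosses `x = 0` upwards at times and with velocities that depend smoothly on `ε`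
      (∃ Φ Y : ℝ → ℝ, ContDiffOn ℝ 1 Φ (Set.Ioo (-ε₀) ε₀) ∧ ContDiffOn ℝ 1 Y (Set.Ioo (-ε₀) ε₀) ∧
        Φ 0 = φ ∧ ∀ ε ∈ Set.Ioo (-ε₀) ε₀, 0 < Y ε ∧ X ε (Φ ε) = 0 ∧ deriv (X ε) (Φ ε) = Y ε) ∧
      -- whose members are isolated
      (∀ ε ∈ Set.Ioo (-ε₀) ε₀, ε ≠ 0 →
        DiscontinuousOscillator.IsIsolatedPeriodic α η ε σ f (X ε)) ∧
      DiscontinuousOscillator.IsOrbitallyIsolatedPeriodic α η 0 σ f (X 0) ∧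
      -- and any other smooth branch agrees with it wherever both are defined
      (∀ ε₁ : ℝ, 0 < ε₁ → ε₁ ≤ ε₀ → ∀ Z : ℝ → ℝ → ℝ,
        DiscontinuousOscillator.IsSmoothBranch α η σ f φ ε₁ Z →
          ∀ ε ∈ Set.Ioo (-ε₁) ε₁, Z ε = X ε) := by
  have hs := isHalfPeriod_of_mem hcase hσ
  have hσ0 : 0 < σ := by linarith [hs.pos]
  obtain ⟨v, hv⟩ : ∃ v, v = halfPeriodInv α η (σ / 2) := ⟨_, rfl⟩
  obtain ⟨Lp⟩ := nonempty_localFlow hσ0 α η φ v hf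
  obtain ⟨Lm⟩ := nonempty_localFlow hσ0 (-α) η φ v hf
  obtain ⟨ψ, hψ, hψ0, hbif, huniq⟩ := exists_branch Lp Lm hs hv hf.continuous hzero hsimple
  have hregev := eventually_isRegular Lp Lm hs hv
  have hψt : Filter.Tendsto (fun ε => (ε, ψ ε)) (𝓝 0) (𝓝 (basePoint σ φ v)) := by
    have h1 : ContinuousAt (fun ε => (ε, ψ ε)) 0 := continuousAt_id.prodMk hψ.continuousAt
    rw [ContinuousAt, hψ0] at h1
    exact h1
  have hb : (0, ψ 0) = basePoint σ φ v := by rw [hψ0, basePoint]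
  have hX0 : bifurcation Lp Lm (basePoint σ φ v) = 0 := by
    rw [← hb]; exact hbif.self_of_nhds
  have hreg0 : IsRegular Lp Lm (basePoint σ φ v) := hregev.self_of_nhds
  -- The neighbourhood is one in which points are regular and zeros of `bifurcation` lie on the
  -- graph of `ψ`.
  obtain ⟨r, hr, hr'⟩ := exists_eq_orbit_of_phaseClose hσ0 hf hper hs hv hreg0 hX0
    (hregev.and huniq) fun q hq => hq.1
  obtain ⟨ε₁, hε₁, H⟩ := Metric.eventually_nhds_iff.1
    (((hψ.eventually (by simp)).and hbif).and ((hψt.eventually hregev).and hr'))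
  have mem_dist : ∀ {δ ε : ℝ}, ε ∈ Ioo (-δ) δ → dist ε 0 < δ := fun h => by
    rw [Real.dist_0_eq_abs]; exact abs_lt.2 h
  let X : ℝ → ℝ → ℝ := fun ε => orbit hσ0 Lp Lm (ε, ψ ε)
  have hXzero : X 0 = orbit hσ0 Lp Lm (basePoint σ φ v) :=
    congrArg (orbit hσ0 Lp Lm) hb
  have hderiv : ∀ ε ∈ Ioo (-ε₁) ε₁, deriv (X ε) (ψ ε).1 = (ψ ε).2.2 := fun ε hε => by
    have h := H (mem_dist hε)
    have := h.2.1.deriv_orbit hσ0 h.1.2 (s := 0) ⟨le_rfl, h.2.1.mem_Ioo.1.le⟩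
    rwa [add_zero, Lp.Y_zero] at this
  have hψon : ContDiffOn ℝ 1 ψ (Ioo (-ε₁) ε₁) := fun ε hε =>
    (H (mem_dist hε)).1.1.contDiffWithinAt
  have h0mem : (0 : ℝ) ∈ Ioo (-ε₁) ε₁ := ⟨neg_neg_of_pos hε₁, hε₁⟩
  have hX : IsSmoothBranch α η σ f φ ε₁ X := by
    refine ⟨contDiffOn_orbit hσ0 isOpen_Ioo hψon (fun ε hε => (H (mem_dist hε)).2.1)
      fun ε hε => (H (mem_dist hε)).1.2, fun ε hε => ?_, ?_⟩
    · have h := H (mem_dist hε)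
      exact h.2.1.isPeriodicSolution_orbit hσ0 h.1.2 hf.continuous hper
    · have h1 := hreg0.orbit_zero hσ0
      have h2 := hderiv 0 h0mem
      rw [hψ0] at h2
      exact ⟨hXzero ▸ h1, h2.trans hv⟩
  -- Members of the branch stay within `r / 2` of `X 0`, so that being `r / 2`-close to any of them
  -- implies being `r`-close to `X 0`. The isolation radius is thereby uniform in `ε`.
  obtain ⟨ε₂, hε₂, H₂⟩ := Metric.eventually_nhds_iff.1
    (hX.eventually_phaseClose hσ0 h0mem (half_pos hr))
  obtain ⟨ε₀, hε₀, l1, l2⟩ : ∃ ε₀ > 0, ε₀ ≤ ε₁ ∧ ε₀ ≤ ε₂ :=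
    ⟨min ε₁ ε₂, lt_min hε₁ hε₂, min_le_left _ _, min_le_right _ _⟩
  have hIoo : Ioo (-ε₀) ε₀ ⊆ Ioo (-ε₁) ε₁ := Ioo_subset_Ioo (neg_le_neg l1) l1
  have hunique : ∀ ε ∈ Ioo (-ε₀) ε₀, ε ≠ 0 → ∀ z, IsPeriodicSolution α η ε σ f z →
      ∀ ε' ∈ Ioo (-ε₀) ε₀, PhaseClose (r / 2) z (X ε') → z = X ε := by
    intro ε hε hne z hz ε' hε' hc
    have hc' := hc.trans (H₂ ((mem_dist hε').trans_le l2))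
    rw [add_halves, hXzero] at hc'
    obtain ⟨p, hp, e, hp0, -⟩ := (H (mem_dist (hIoo hε))).2.2 z hz hc'
    have : p = ψ ε := hp.2 (hp0 hne)
    rw [e, this]
  refine ⟨ε₀, hε₀, X, hX.mono l1, ⟨fun ε => (ψ ε).1, fun ε => (ψ ε).2.2, (hψon.mono hIoo).fst,
    (hψon.mono hIoo).snd.snd, by simp only [hψ0], fun ε hε => ?_⟩, fun ε hε hne => ?_, ?_, ?_⟩
  · have h := H (mem_dist (hIoo hε))
    exact ⟨h.2.1.y_pos, h.2.1.orbit_zero hσ0, hderiv ε (hIoo hε)⟩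
  · exact ⟨r / 2, half_pos hr, fun z hz hc => hunique ε hε hne z hz ε hε hc⟩
  · refine ⟨r, hr, fun z hz hc => ?_⟩
    rw [hXzero] at hc
    -- At `ε = 0` the crossing time `t₁` is undetermined and accounts for the translation.
    obtain ⟨⟨t₁, p⟩, -, e, -, hp⟩ := (H (mem_dist h0mem)).2.2 z hz hc
    obtain rfl : p = (σ / 2, v) := hp rfl
    refine ⟨φ - t₁, fun t => ?_⟩
    rw [e, hXzero]
    exact orbit_unperturbed hσ0 _ _ _ _ _
  · intro ε₃ hε₃ hle Z hZ
    have hsub : Ioo (-ε₃) ε₃ ⊆ Ioo (-ε₀) ε₀ := Ioo_subset_Ioo (neg_le_neg hle) hle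
    refine hZ.eq_of_unique hσ0 (hX.mono (hle.trans l1)) hε₃ (half_pos hr) ?_
      fun ε hε hne z hz ε' hε' hc => hunique ε (hsub hε) hne z hz ε' (hsub hε') hc
    -- At `ε = 0` the two branches coincide because both have the prescribed data at time `φ`.
    rw [hXzero]
    exact (hZ.periodicSolution 0 ⟨neg_neg_of_pos hε₃, hε₃⟩).eq_orbit_of_initial hσ0 hf hs hv
      hZ.initial.1 (hZ.initial.2.trans hv.symm)
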